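/- **Conventions.** An $\mathcal L$-*scheme* consists of $\mathcal L$-sentences and of sentences $\sigma(P)$ of $\mathcal L$ augmented with a predicate variable $P$. Let $M$ be an $\mathcal L$-structure and let $\mathcal X$ be a collection of relations (of all arities) on $M$. We say that $(M,\mathcal X)$ *satisfies* a scheme $S$ if $M$ satisfies the sentences of $S$ and, for every $\sigma(P)$ in $S$, $(M,P)\models\sigma$ for all $P\in\mathcal X$ of the right arity. We write $(M,\mathcal X)\models \mathsf{PC}(S)$ if moreover $\mathcal X$ contains every relation on $M$ definable by a formula without second-order quantifiers, with first-order parameters from $M$ and second-order parameters from $\mathcal X$; and $(M,\mathcal X)\models \mathsf{PC}^{-}(S)$ (*standalone* predicative comprehension) if this is only required of formulas without first-order parameters (second-order parameters from $\mathcal X$ being still allowed). A first-order theory is treated as a scheme without predicate variables. A structure $\mathcal N$ for a relational language, with nonempty domain contained in $M$ and with equality interpreted by a congruence $=^{\mathcal N}$ on the domain, belongs to $\mathcal X$ if its domain, $=^{\mathcal N}$ and all its relations do. It is an $\mathcal X$-*strong model* of a scheme $\tau$ if it belongs to $\mathcal X$, satisfies the sentences of $\tau$, and satisfies every $\sigma(P)$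 in $\tau$ for all $=^{\mathcal N}$-invariant relations $P\in\mathcal X$ on its domain. A bijection or isomorphism between two such structures is a bijection or isomorphism of their quotients by the internal equalities; it belongs to $\mathcal X$ if the corresponding binary relation on $M$ does. * $\tau$ is *standalone categorical in* $S$ if, whenever $(M,\mathcal X)\models\mathsf{PC}^{-}(S)$, any two $\mathcal X$-strong models of $\tau$ are isomorphic via an isomorphism in $\mathcal X$. * $\tau$ is *categorical-in-every-cardinality in* $S$ if, whenever $(M,\mathcal X)\models\mathsf{PC}(S)$, any two $\mathcal X$-strong models of $\tau$ between which there is a bijection in $\mathcal X$ are isomorphic via an isomorphism in $\mathcal X$. The *induction scheme*, in the language $\{0,S,+,\cdot,<\}$, consists of $Sx\ne 0$, $Sx=Sy\to x=y$, the recursion equations for $+$ and $\cdot$, $x<y\leftrightarrow\exists z\,(x+Sz=y)$, and $P(0)\wedge\forall x(P(x)\to P(Sx))\to\forall x\,P(x)$. $\mathrm{PA}$ is the first-order theory of all its instances by formulas (with parameters) of this language. The scheme $\mathsf{HF}(\mathrm{DLO})$, in the language $\{\in,A,<\}$ (elements of $A$ are called atoms, all other objects are called sets), consists of: replacement (if $P$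 is functional on $w$, there is a set whose elements are exactly the values of $P$ at the elements of $w$); $\in$-induction $\forall x(\forall y\in x\,P(y)\to P(x))\to\forall x\,P(x)$; for every $x$ there is $y$ whose elements are exactly the sets all of whose elements are in $x$; for every $x$ there is a set whose elements are exactly the elements of elements of $x$; every set is in bijection with a natural number (finite von Neumann ordinal); extensionality for sets; atoms have no elements; and the axioms of dense linear orders without endpoints relativized to $A$, that is, $<$ is a relation on $A$, $A$ is nonempty, and $<$ is a dense linear order of $A$ without endpoints. **Theorem.** 1. $\mathsf{HF}(\mathrm{DLO})$ is standalone categorical in the induction scheme. 2. $\mathsf{HF}(\mathrm{DLO})$ is not categorical-in-every-cardinality in $\mathrm{PA}$, treated as a theory. 3. Failure in (2) occurs in the following form: there are an uncountable $M$ and $\mathcal X$ with $(M,\mathcal X)\models\mathsf{PC}(\mathrm{PA})$, a proper initial segment $I$ of $M$ of cardinality $2^{\aleph_0}$, and two $\mathcal X$-strong models $\mathcal N_0,\mathcal N_1$ of $\mathsf{HF}(\mathrm{DLO})$ with absolute equality, the same domain, the same membership relation and the same set of atoms $I$ (so that there is a bijection between them in $\mathcal X$), such that $\mathcal N_0$ orders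 $I$ in the type $\mathbb R\oplus\mathbb Q$ (a copy of $\mathbb R$ followed by a copy of $\mathbb Q$), $\mathcal N_1$ orders $I$ by the reverse order, and $\mathcal N_0\not\cong\mathcal N_1$. -/

import Mathlib

open FirstOrder FirstOrder.Language

universe u

namespace Definiteness

/-! ### Schemes -/

/-- The only symbol of the language of a single `k`-ary predicate variable. -/
inductive PredSymbol (k : ℕ) : ℕ → Type
  | P : PredSymbol k k

/-- The language consisting of one `k`-ary predicate variable `P`. -/
def predLang (k : ℕ) : FirstOrder.Language.{0, 0} := ⟨fun _ => Empty, PredSymbol k⟩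

/-- The predicate variable, as a symbol of `L` augmented with it. -/
abbrev predVar (L : FirstOrder.Language.{0, 0}) (k : ℕ) : (L.sum (predLang k)).Relations k :=
  Sum.inr PredSymbol.P

/-- The interpretation of the predicate variable by a given `k`-ary relation. -/
@[reducible] def predStructure {k : ℕ} {M : Type u} (P : Set (Fin k → M)) :
    (predLang k).Structure M where
  funMap f := f.elim
  RelMap R v := match R, v with
    | .P, v => v ∈ P

/-- An `L`-template: a sentence of `L` augmented with a `k`-ary predicate variable `P`. -/
structure Template (L : FirstOrder.Language.{0, 0}) where
  arity : ℕ
  sentence : (L.sum (predLang arity)).Sentence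

/-- The template holds in `M` when its predicate variable is interpreted as `P`. -/
def Template.Holds {L : FirstOrder.Language.{0, 0}} (t : Template L) (M : Type u) [L.Structure M]
    (P : Set (Fin t.arity → M)) : Prop :=
  letI := predStructure P
  M ⊨ t.sentence

/-- A scheme: a conjunction of ordinary axioms (with no predicate variable) and of templates. -/
structure Scheme (L : FirstOrder.Language.{0, 0}) where
  axioms : L.Theory
  templates : Set (Template L)

section Instances

variable {L : FirstOrder.Language.{0, 0}} {k m : ℕ}

/-- A term of `L` augmented with `P` is just a term of `L`. -/
def eraseTerm {α : Type} : (L.sum (predLang k)).Term α → L.Term α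
  | .var a => .var a
  | .func (.inl f) ts => .func f fun i => eraseTerm (ts i)
  | .func (.inr f) _ => Empty.elim f

/-- As `eraseTerm`, where the free variables of the result may include the `m` parameters. -/
def paramTerm {n : ℕ} (t : (L.sum (predLang k)).Term (Empty ⊕ Fin n)) :
    L.Term (Fin m ⊕ Fin n) :=
  (eraseTerm t).relabel (Sum.map Empty.elim id)

/-- Replace every atomic subformula `P(t₁, …, tₖ)` by `φ(t₁, …, tₖ, v₁, …, vₘ)`, where the
parameters `v₁, …, vₘ` are the free variables of the resulting formula. -/
def substPred (φ : L.Formula (Fin k ⊕ Fin m)) :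
    ∀ {n : ℕ}, (L.sum (predLang k)).BoundedFormula Empty n → L.BoundedFormula (Fin m) n
  | _, .falsum => .falsum
  | _, .equal t s => .equal (paramTerm t) (paramTerm s)
  | _, .rel (.inl R) ts => .rel R fun i => paramTerm (ts i)
  | n, .rel (.inr .P) ts =>
      (BoundedFormula.subst φ
        (Sum.elim (fun i => paramTerm (ts i)) fun j => .var (.inl j) :
          Fin k ⊕ Fin m → L.Term (Fin m ⊕ Fin n))).relabel (n := n) id
  | _, .imp ψ χ => .imp (substPred φ ψ) (substPred φ χ)
  | _, .all ψ => .all (substPred φ ψ)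

/-- The instance of the template for the formula `φ(x₁, …, xₖ, v₁, …, vₘ)`: the universal closure
over the parameters `v₁, …, vₘ` of the result of substituting `φ` for `P`. -/
def Template.inst (t : Template L) {m : ℕ} (φ : L.Formula (Fin t.arity ⊕ Fin m)) : L.Sentence :=
  ((substPred φ t.sentence).relabel (n := m) (Sum.inr : Fin m → Empty ⊕ Fin m)).alls

/-- The first-order theory of a scheme `S`: its axioms together with all instances of its templates
for formulas of its own language `L`. -/
def Scheme.theory (S : Scheme L) : L.Theory :=
  S.axioms ∪ {σ | ∃ t ∈ S.templates, ∃ (m : ℕ) (φ : L.Formula (Fin t.arity ⊕ Fin m)), σ = t.inst φ}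

/-- A first-order theory treated as a scheme. -/
def ofTheory (T : L.Theory) : Scheme L := ⟨T, ∅⟩

end Instances

/-! ### Models of predicative comprehension -/

/-- A second-order universe over `M`: for each `n`, a collection of `n`-ary relations on `M`. -/
abbrev SetUniverse (M : Type u) := ∀ n : ℕ, Set (Set (Fin n → M))

/-- The language with a predicate for each relation in `X`, for second-order parameters. -/
def setLang {M : Type u} (X : SetUniverse M) : FirstOrder.Language.{0, u} := ⟨fun _ => Empty, fun n => X n⟩

instance {M : Type u} (X : SetUniverse M) : (setLang X).Structure M where
  funMap f := f.elim
  RelMap R v := v ∈ R.1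

section Models

variable {L : FirstOrder.Language.{0, 0}} {M : Type u} [L.Structure M]

/-- `(M, X)` satisfies the scheme, in the sense that all templates hold for all relations in `X`. -/
def SatisfiesScheme (S : Scheme L) (X : SetUniverse M) : Prop :=
  M ⊨ S.axioms ∧ ∀ t ∈ S.templates, ∀ P ∈ X t.arity, t.Holds M P

/-- `(M, X)` is a model of the scheme `S` with predicative comprehension: every relation definable
by a formula with no second-order quantifiers, with first-order and second-order parameters, is in
`X`. -/
def ModelsPC (S : Scheme L) (X : SetUniverse M) : Prop :=
  SatisfiesScheme S X ∧
    ∀ (n : ℕ) (s : Set (Fin n → M)),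
      (Set.univ : Set M).Definable (L.sum (setLang X)) s → s ∈ X n

/-- `(M, X)` is a model of the scheme `S` with standalone predicative comprehension: as `ModelsPC`,
with second-order parameters but without first-order parameters. -/
def ModelsStandalonePC (S : Scheme L) (X : SetUniverse M) : Prop :=
  SatisfiesScheme S X ∧
    ∀ (n : ℕ) (s : Set (Fin n → M)),
      (∅ : Set M).Definable (L.sum (setLang X)) s → s ∈ X n

end Models

/-! ### Internal structures and strong models -/

/-- A structure for a relational language `K` whose domain is a nonempty subset of `M`, and whose
equality is an equivalence relation on the domain which is a congruence for all the relations. The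
relations are recorded as relations on the quotient. -/
structure InternalStructure (K : FirstOrder.Language.{0, 0}) (M : Type u) where
  dom : Set M
  dom_nonempty : dom.Nonempty
  equality : Setoid dom
  str : K.Structure (Quotient equality)

namespace InternalStructure

variable {K : FirstOrder.Language.{0, 0}} {M : Type u} (N N' : InternalStructure K M)

/-- The internal structure as a first-order structure, with the internal equality factored out. -/
abbrev Carrier : Type u := Quotient N.equality

instance : K.Structure N.Carrier := N.str

/-- The invariant relation on (the domain inside) `M` that corresponds to a relation on the
quotient. -/
def lift {n : ℕ} (R : Set (Fin n → N.Carrier)) : Set (Fin n → M) :=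
  {w | ∃ h : ∀ i, w i ∈ N.dom, (fun i => (⟦⟨w i, h i⟩⟧ : N.Carrier)) ∈ R}

/-- The interpretation of a relation symbol, as a relation on `M`. -/
def rel {n : ℕ} (R : K.Relations n) : Set (Fin n → M) := N.lift {v | Structure.RelMap R v}

/-- The internal equality, as a binary relation on `M`. -/
def eqRel : Set (Fin 2 → M) := N.lift {v | v 0 = v 1}

/-- The binary relation on `M` that corresponds to a function between the quotients. -/
def graph {N N' : InternalStructure K M} (f : N.Carrier → N'.Carrier) : Set (Fin 2 → M) :=
  {w | ∃ (h : w 0 ∈ N.dom) (h' : w 1 ∈ N'.dom),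
    f (⟦⟨w 0, h⟩⟧ : N.Carrier) = (⟦⟨w 1, h'⟩⟧ : N'.Carrier)}

variable (X : SetUniverse M)

/-- `N ∈ X`: the domain, the equality and all relations of `N` are in `X`. -/
def MemUniverse : Prop :=
  {w : Fin 1 → M | w 0 ∈ N.dom} ∈ X 1 ∧ N.eqRel ∈ X 2 ∧
    ∀ (n : ℕ) (R : K.Relations n), N.rel R ∈ X n

/-- `N` is an `X`-strong model of the scheme `τ`: it is in `X`, and it satisfies `τ` for all
relations on `N` that are in `X`. -/
def IsStrongModel (τ : Scheme K) : Prop :=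
  N.MemUniverse X ∧ N.Carrier ⊨ τ.axioms ∧
    ∀ t ∈ τ.templates, ∀ P : Set (Fin t.arity → N.Carrier),
      N.lift P ∈ X t.arity → t.Holds N.Carrier P

/-- Some bijection from `N` to `N'` is in `X`. -/
def EquinumerousIn : Prop := ∃ e : N.Carrier ≃ N'.Carrier, graph (N := N) (N' := N') e ∈ X 2

/-- Some isomorphism from `N` to `N'` is in `X`. -/
def IsomorphicIn : Prop := ∃ e : N.Carrier ≃[K] N'.Carrier, graph (N := N) (N' := N') e ∈ X 2

end InternalStructure

/-! ### Definiteness notions -/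

section Notions

variable {K L : FirstOrder.Language.{0, 0}} [K.IsRelational]

/-- `τ` is standalone categorical in `S`. -/
def StandaloneCategorical (τ : Scheme K) (S : Scheme L) : Prop :=
  ∀ (M : Type u) [Nonempty M] [L.Structure M] (X : SetUniverse M), ModelsStandalonePC S X →
    ∀ N₀ N₁ : InternalStructure K M, N₀.IsStrongModel X τ → N₁.IsStrongModel X τ →
      N₀.IsomorphicIn N₁ X

/-- `τ` is categorical-in-every-cardinality in `S`. -/
def CategoricalInEveryCardinality (τ : Scheme K) (S : Scheme L) : Prop :=
  ∀ (M : Type u) [Nonempty M] [L.Structure M] (X : SetUniverse M), ModelsPC S X →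
    ∀ N₀ N₁ : InternalStructure K M, N₀.IsStrongModel X τ → N₁.IsStrongModel X τ →
      N₀.EquinumerousIn N₁ X → N₀.IsomorphicIn N₁ X

end Notions

/-! ### Arithmetic -/

/-- Function symbols of arithmetic. -/
inductive ArithFunc : ℕ → Type
  | zero : ArithFunc 0
  | succ : ArithFunc 1
  | add : ArithFunc 2
  | mul : ArithFunc 2

/-- Relation symbols of arithmetic. -/
inductive ArithRel : ℕ → Type
  | lt : ArithRel 2

/-- The language `{0, S, +, ·, <}` of arithmetic. -/
def arith : FirstOrder.Language.{0, 0} := ⟨ArithFunc, ArithRel⟩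

abbrev zeroSym : arith.Functions 0 := ArithFunc.zero

abbrev succSym : arith.Functions 1 := ArithFunc.succ

abbrev addSym : arith.Functions 2 := ArithFunc.add

abbrev mulSym : arith.Functions 2 := ArithFunc.mul

abbrev ltSym : arith.Relations 2 := ArithRel.lt

namespace Arith

variable {α : Type} {n : ℕ}

def zero : arith.Term α := Constants.term zeroSym

def succ (t : arith.Term α) : arith.Term α := succSym.apply₁ t

def add (t s : arith.Term α) : arith.Term α := addSym.apply₂ t s

def mul (t s : arith.Term α) : arith.Term α := mulSym.apply₂ t s

def lt (t s : arith.Term (α ⊕ Fin n)) : arith.BoundedFormula α n :=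
  ltSym.boundedFormula₂ t s

/-- The strict order that an arithmetical structure carries. -/
def Lt {M : Type u} [arith.Structure M] (x y : M) : Prop :=
  Structure.RelMap ltSym ![x, y]

/-- The axioms of arithmetic other than induction. -/
def baseAxioms : arith.Theory :=
  { ∀' ∼(succ &0 =' zero),
    ∀' ∀' ((succ &0 =' succ &1) ⟹ (&0 =' &1)),
    ∀' (add &0 zero =' &0),
    ∀' ∀' (add &0 (succ &1) =' succ (add &0 &1)),
    ∀' (mul &0 zero =' zero),
    ∀' ∀' (mul &0 (succ &1) =' add (mul &0 &1) &0),
    ∀' ∀' ((lt &0 &1) ⇔ ∃' (add &0 (succ &2) =' &1)) }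

/-- The predicate variable of the induction template, applied to a term of arithmetic. -/
def pred (t : arith.Term (Empty ⊕ Fin n)) : (arith.sum (predLang 1)).BoundedFormula Empty n :=
  (predVar arith 1).boundedFormula₁ (LHom.sumInl.onTerm t)

/-- `P(0) ∧ ∀ x (P(x) → P(S x)) → ∀ x P(x)`. -/
def inductionSentence : (arith.sum (predLang 1)).Sentence :=
  (pred (n := 0) zero ⊓ ∀' (pred &0 ⟹ pred (succ &0))) ⟹ ∀' pred &0

/-- The induction template. -/
def inductionTemplate : Template arith := ⟨1, inductionSentence⟩

/-- The induction scheme (over the base axioms of arithmetic). -/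
def inductionScheme : Scheme arith := ⟨baseAxioms, {inductionTemplate}⟩

/-- Peano arithmetic, a first-order theory: all instances of the induction scheme for formulas of
the language of arithmetic. -/
def peano : arith.Theory := inductionScheme.theory

end Arith

/-! ### Hereditarily finite sets over a dense linear order of atoms -/

/-- Relation symbols of set theory with ordered atoms. -/
inductive HFRel : ℕ → Type
  | mem : HFRel 2
  | atom : HFRel 1
  | lt : HFRel 2

/-- The language `{∈, A, <}`. -/
def hfLang : FirstOrder.Language.{0, 0} := ⟨fun _ => Empty, HFRel⟩

/-- The symbol `∈`. -/
abbrev memSym : hfLang.Relations 2 := HFRel.mem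

/-- The symbol `A`. -/
abbrev atomSym : hfLang.Relations 1 := HFRel.atom

/-- The symbol `<`. -/
abbrev atomLtSym : hfLang.Relations 2 := HFRel.lt

instance : hfLang.IsRelational := fun _ => inferInstanceAs (IsEmpty Empty)

namespace HF

/-- Formulas with `n` free variables, indexed by `Fin n`. Under one more quantifier, a variable `x`
becomes `x.castSucc`, and the newly bound variable is `Fin.last n`. -/
abbrev Fml (n : ℕ) := hfLang.BoundedFormula Empty n

/-- A variable, under one more quantifier. -/
local postfix:max "ꜛ" => Fin.castSucc

variable {n : ℕ}

/-- `x ∈ y` -/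
def mem (x y : Fin n) : Fml n := memSym.boundedFormula₂ (&x) (&y)

/-- `A(x)`: `x` is an atom. -/
def atom (x : Fin n) : Fml n := atomSym.boundedFormula₁ (&x)

/-- `x < y` -/
def lt (x y : Fin n) : Fml n := atomLtSym.boundedFormula₂ (&x) (&y)

/-- `x = y` -/
def eq (x y : Fin n) : Fml n := Term.bdEqual (&x) (&y)

/-- `∀ z ∈ x, φ` -/
def allMem (x : Fin n) (φ : Fml (n + 1)) : Fml n := ∀' (mem (Fin.last n) xꜛ ⟹ φ)

/-- `∃ z ∈ x, φ` -/
def exMem (x : Fin n) (φ : Fml (n + 1)) : Fml n := ∃' (mem (Fin.last n) xꜛ ⊓ φ)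

/-- The set `z` is `{x, y}`. -/
def isUpair (z x y : Fin n) : Fml n :=
  ∼(atom z) ⊓ ∀' (mem (Fin.last n) zꜛ ⇔ (eq (Fin.last n) xꜛ ⊔ eq (Fin.last n) yꜛ))

/-- The set `p` is the Kuratowski pair `{{x}, {x, y}}`. -/
def isPair (p x y : Fin n) : Fml n :=
  ∼(atom p) ⊓
    ∀' (mem (Fin.last n) pꜛ ⇔ (isUpair (Fin.last n) xꜛ xꜛ ⊔ isUpair (Fin.last n) xꜛ yꜛ))

/-- `⟨x, y⟩ ∈ f` -/
def pairMem (x y f : Fin n) : Fml n := exMem f (isPair (Fin.last n) xꜛ yꜛ)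

/-- `x` is the empty set. -/
def isEmptySet (x : Fin n) : Fml n := ∼(atom x) ⊓ ∀' ∼(mem (Fin.last n) xꜛ)

/-- The set `y` is `x ∪ {x}`. -/
def isSucc (y x : Fin n) : Fml n :=
  ∼(atom y) ⊓ ∀' (mem (Fin.last n) yꜛ ⇔ (mem (Fin.last n) xꜛ ⊔ eq (Fin.last n) xꜛ))

/-- `x` is a transitive set all of whose elements are sets. -/
def isTransitive (x : Fin n) : Fml n :=
  ∼(atom x) ⊓
    allMem x (∼(atom (Fin.last n)) ⊓ allMem (Fin.last n) (mem (Fin.last (n + 1)) xꜛꜛ))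

/-- `x` is an ordinal: a transitive set of transitive sets. -/
def isOrdinal (x : Fin n) : Fml n := isTransitive x ⊓ allMem x (isTransitive (Fin.last n))

/-- `x` is zero or a successor. -/
def isZeroOrSucc (x : Fin n) : Fml n := isEmptySet x ⊔ ∃' (isSucc xꜛ (Fin.last n))

/-- `x` is a natural number: an ordinal such that it and all its elements are zero or successors. -/
def isNat (x : Fin n) : Fml n :=
  isOrdinal x ⊓ isZeroOrSucc x ⊓ allMem x (isZeroOrSucc (Fin.last n))

/-- The set `f` is (the graph of) a bijection from `x` to `y`. -/
def isBijection (f x y : Fin n) : Fml n :=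
  ∼(atom f) ⊓
  allMem f (exMem xꜛ (exMem yꜛꜛ
    (isPair (Fin.last n)ꜛꜛ (Fin.last (n + 1))ꜛ (Fin.last (n + 2))))) ⊓
  allMem x (exMem yꜛ (pairMem (Fin.last n)ꜛ (Fin.last (n + 1)) fꜛꜛ ⊓
    ∀' (pairMem (Fin.last n)ꜛꜛ (Fin.last (n + 2)) fꜛꜛꜛ ⟹
      eq (Fin.last (n + 2)) (Fin.last (n + 1))ꜛ))) ⊓
  allMem y (exMem xꜛ (pairMem (Fin.last (n + 1)) (Fin.last n)ꜛ fꜛꜛ ⊓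
    ∀' (pairMem (Fin.last (n + 2)) (Fin.last n)ꜛꜛ fꜛꜛꜛ ⟹
      eq (Fin.last (n + 2)) (Fin.last (n + 1))ꜛ)))

/-- The set-theoretic axioms: powerset, union, every set is in bijection with a natural number,
extensionality for sets, and atoms have no elements. -/
def setAxioms : hfLang.Theory :=
  { ∀' ∃' ∀' (mem 2 1 ⇔ (∼(atom 2) ⊓ ∀' (mem 3 2 ⟹ mem 3 0))),
    ∀' ∃' (∼(atom 1) ⊓ ∀' (mem 2 1 ⇔ ∃' (mem 3 0 ⊓ mem 2 3))),
    ∀' (∼(atom 0) ⟹ ∃' ∃' (isNat 1 ⊓ isBijection 2 1 0)),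
    ∀' ∀' ((∼(atom 0) ⊓ ∼(atom 1) ⊓ ∀' (mem 2 0 ⇔ mem 2 1)) ⟹ eq 0 1),
    ∀' (atom 0 ⟹ ∀' ∼(mem 1 0)) }

/-- The theory of dense linear orders without endpoints, relativized to the atoms: `<` is a relation
on atoms, there is an atom, and the order of the atoms is irreflexive, transitive, total, dense, and
has no greatest and no least element. -/
def atomAxioms : hfLang.Theory :=
  { ∀' ∀' (lt 0 1 ⟹ (atom 0 ⊓ atom 1)),
    ∃' atom 0,
    ∀' (atom 0 ⟹ ∼(lt 0 0)),
    ∀' ∀' ∀' ((atom 0 ⊓ atom 1 ⊓ atom 2) ⟹ ((lt 0 1 ⊓ lt 1 2) ⟹ lt 0 2)),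
    ∀' ∀' ((atom 0 ⊓ atom 1) ⟹ (lt 0 1 ⊔ eq 0 1 ⊔ lt 1 0)),
    ∀' ∀' ((atom 0 ⊓ atom 1) ⟹ (lt 0 1 ⟹ ∃' (atom 2 ⊓ lt 0 2 ⊓ lt 2 1))),
    ∀' (atom 0 ⟹ ∃' (atom 1 ⊓ lt 0 1)),
    ∀' (atom 0 ⟹ ∃' (atom 1 ⊓ lt 1 0)) }

/-- A formula without the predicate variable, as a formula of the language with it. -/
def up {k : ℕ} (φ : Fml n) : (hfLang.sum (predLang k)).BoundedFormula Empty n :=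
  LHom.sumInl.onBoundedFormula φ

/-- `P(x)` -/
def pred₁ (x : Fin n) : (hfLang.sum (predLang 1)).BoundedFormula Empty n :=
  (predVar hfLang 1).boundedFormula₁ (&x)

/-- `P(x, y)` -/
def pred₂ (x y : Fin n) : (hfLang.sum (predLang 2)).BoundedFormula Empty n :=
  (predVar hfLang 2).boundedFormula₂ (&x) (&y)

/-- Replacement: for every `w`, if `P` is functional on `w`, then there is a set whose elements are
exactly the values of `P` at elements of `w`. -/
def replacementSentence : (hfLang.sum (predLang 2)).Sentence :=
  ∀' ((∀' (up (mem 1 0) ⟹ ∀' ∀' ((pred₂ 1 2 ⊓ pred₂ 1 3) ⟹ up (eq 2 3)))) ⟹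
    ∃' (∼(up (atom 1)) ⊓ ∀' (up (mem 2 1) ⇔ ∃' (up (mem 3 0) ⊓ pred₂ 3 2))))

/-- The replacement template. -/
def replacementTemplate : Template hfLang := ⟨2, replacementSentence⟩

/-- `∈`-induction: `∀ x (∀ y ∈ x, P(y) → P(x)) → ∀ x P(x)`. -/
def inductionSentence : (hfLang.sum (predLang 1)).Sentence :=
  (∀' ((∀' (up (mem 1 0) ⟹ pred₁ 1)) ⟹ pred₁ 0)) ⟹ ∀' pred₁ 0

/-- The `∈`-induction template. -/
def inductionTemplate : Template hfLang := ⟨1, inductionSentence⟩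

end HF

/-- The scheme `HF(DLO)`. -/
def hfDLO : Scheme hfLang :=
  ⟨HF.setAxioms ∪ HF.atomAxioms, {HF.replacementTemplate, HF.inductionTemplate}⟩

/-! ### The counterexample -/

/-- Over `M`, the structures `N₀` and `N₁` have absolute equality, the same domain and the same
membership relation; in both, the set of atoms is `I`. The order `N₀` puts on `I` has the type of
`ℝ ⊕ ℚ` (a copy of `ℝ` followed by a copy of `ℚ`), and the one `N₁` puts on it is its reverse. -/
def IsRealRatReversal {M : Type u} (I : Set M) (N₀ N₁ : InternalStructure hfLang M) : Prop :=
  N₀.dom = N₁.dom ∧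
  N₀.eqRel = {w | w 0 ∈ N₀.dom ∧ w 0 = w 1} ∧
  N₁.eqRel = {w | w 0 ∈ N₁.dom ∧ w 0 = w 1} ∧
  N₀.rel memSym = N₁.rel memSym ∧
  N₀.rel atomSym = {w | w 0 ∈ I} ∧
  N₁.rel atomSym = {w | w 0 ∈ I} ∧
  (∃ e : I ≃ ℝ ⊕ₗ ℚ, ∀ x y : I, ![x.1, y.1] ∈ N₀.rel atomLtSym ↔ e x < e y) ∧
  ∀ x y : M, ![x, y] ∈ N₁.rel atomLtSym ↔ ![y, x] ∈ N₀.rel atomLtSym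

end Definiteness

open Definiteness

universe v w

set_option linter.unusedSectionVars false

/-! Both halves depend on whether the atoms are countable from the inside.

Under the induction scheme they are. Every element of an internal structure has a least
representative in `M`, so `M` enumerates the structure. Induction for all definable predicates gives
codes for bounded definable sets and definable recursion of length `M`. The sets of a strong model
of HF(DLO) are then exactly the bounded definable sets of its elements: adjoining one element at a
time along `M` turns each bounded predicate into a set (`exists_comprehension`), and the finiteness
axiom with `∈`-induction bounds each set (`HFStr.IsSetTheory.bdd`). So Cantor's back-and-forth works
internally. A bounded set of atoms has a greatest and a least element, hence a coded partial
isomorphism extends by any atom, and stage `n` of a recursion along `M` treats the atoms of rank `n`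
on both sides (`exists_atom_iso`). The union of the coded bisimulations over the resulting
isomorphism of atoms is an isomorphism of the structures (`FinSets.exists_iso`).

This argument uses first-order parameters, which standalone comprehension does not provide. They are
eliminated by least numbers: a nonempty set of tuples that is definable without parameters has a
member that is definable without parameters. Hence a definable property that fails for some
predicate defined with parameters already fails for one defined without (`LeastNumber.transfer`).
This is used twice: to extend replacement and `∈`-induction to predicates with parameters, and to
replace the isomorphism obtained by one without parameters.

When PA is only a theory, it says nothing about the relations in the universe, so all relations on a
model may be admitted. Internal countability is then lost: over any dense order of atoms, the true
hereditarily finite sets form a strong model as soon as they fit into `M`. In an ultrapower of `ℕ`,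
the segment below the class of `2 ^ n` has the cardinality of the continuum and can be ordered as `ℝ
⊕ ℚ` or in reverse. In the first order every point has uncountably many predecessors, in the second
some points have only countably many, so the structures are not isomorphic at all. -/

namespace Definiteness

/-! ### Definability calculus for maps between sorts -/

/-- A system of definable sets of tuples of elements of `M`, with two distinct definable points. -/
structure DefSystem (M : Type u) where
  D : ∀ {ι : Type}, Set (Set (ι → M))
  compl : ∀ {ι : Type} {s : Set (ι → M)}, s ∈ D → sᶜ ∈ D
  inter : ∀ {ι : Type} {s t : Set (ι → M)}, s ∈ D → t ∈ D → s ∩ t ∈ D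
  reindex : ∀ {ι κ : Type} (f : ι → κ) {s : Set (ι → M)}, s ∈ D → {v : κ → M | v ∘ f ∈ s} ∈ D
  proj : ∀ {ι κ : Type} [Finite ι] [Finite κ] {s : Set (ι ⊕ κ → M)}, s ∈ D →
    {v : ι → M | ∃ w : κ → M, Sum.elim v w ∈ s} ∈ D
  diag : {v : Bool → M | v true = v false} ∈ D
  -- These two points code the truth values, so that predicates are maps into the sort `Prop` and
  -- one notion `DefFun` serves for functions and predicates.
  zero : M
  one : M
  zero_ne_one : zero ≠ one
  zero_def : {v : Unit → M | v () = zero} ∈ D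
  one_def : {v : Unit → M | v () = one} ∈ D

/-- A sort of a definability system: a type coded by tuples. -/
class Srt {M : Type u} (𝒟 : DefSystem M) (γ : Type v) where
  Ix : Type
  fin : Finite Ix
  code' : γ → Ix → M
  inj' : Function.Injective code'
  range' : {v | ∃ g, code' g = v} ∈ 𝒟.D

section

variable {M : Type u} (𝒟 : DefSystem M)

/-- The index type of the codes of a sort. -/
abbrev Ix (γ : Type v) [h : Srt 𝒟 γ] : Type := h.Ix

instance (γ : Type v) [h : Srt 𝒟 γ] : Finite (Ix 𝒟 γ) := h.fin

/-- The tuple that codes an element of a sort. -/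
def Srt.code {γ : Type v} [h : Srt 𝒟 γ] : γ → Ix 𝒟 γ → M := h.code'

variable {𝒟} in
theorem Srt.inj {γ : Type v} [h : Srt 𝒟 γ] {x y : γ} (hxy : Srt.code 𝒟 x = Srt.code 𝒟 y) : x = y :=
  h.inj' hxy

theorem Srt.range (γ : Type v) [h : Srt 𝒟 γ] : {v | ∃ g : γ, Srt.code 𝒟 g = v} ∈ 𝒟.D := h.range'

variable {γ : Type v} {δ : Type w} {ε : Type*} [Srt 𝒟 γ] [Srt 𝒟 δ] [Srt 𝒟 ε]

namespace DefSystem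

theorem congr {ι : Type} {s t : Set (ι → M)} (ht : t ∈ 𝒟.D) (h : ∀ v, v ∈ s ↔ v ∈ t) : s ∈ 𝒟.D :=
  (Set.ext h : s = t) ▸ ht

theorem union {ι : Type} {s t : Set (ι → M)} (hs : s ∈ 𝒟.D) (ht : t ∈ 𝒟.D) : s ∪ t ∈ 𝒟.D := by
  have := 𝒟.compl (𝒟.inter (𝒟.compl hs) (𝒟.compl ht))
  rwa [Set.compl_inter, compl_compl, compl_compl] at this

theorem diag' {ι : Type} (i j : ι) : {v : ι → M | v i = v j} ∈ 𝒟.D :=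
  𝒟.reindex (fun b : Bool => bif b then i else j) 𝒟.diag

theorem univ_mem {ι : Type} : (Set.univ : Set (ι → M)) ∈ 𝒟.D := by
  have h : {v : Unit → M | v () = v ()} ∈ 𝒟.D := 𝒟.diag' () ()
  by_cases hi : Nonempty ι
  · obtain ⟨i⟩ := hi
    refine 𝒟.congr (𝒟.diag' i i) fun v => ?_
    simp
  -- There is no coordinate to compare with itself, so one is added and projected away.
  · have h2 : ({v : Empty ⊕ Unit → M | v (.inr ()) = v (.inr ())}) ∈ 𝒟.D := 𝒟.diag' _ _
    have h3 := 𝒟.proj h2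
    have := 𝒟.reindex (Empty.elim : Empty → ι) h3
    refine 𝒟.congr (this) fun v => ?_
    simp only [Set.mem_univ, true_iff]
    exact ⟨fun _ => 𝒟.zero, trivial⟩

theorem eq_tuples {ι κ : Type} [Finite ι] (f g : ι → κ) : {v : κ → M | v ∘ f = v ∘ g} ∈ 𝒟.D := by
  classical
  have := Fintype.ofFinite ι
  have key : ∀ s : Finset ι, {v : κ → M | ∀ i ∈ s, v (f i) = v (g i)} ∈ 𝒟.D := by
    intro s
    induction s using Finset.induction_on with
    | empty => simpa using 𝒟.univ_mem
    | insert a s _ ih =>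
      refine 𝒟.congr (𝒟.inter (𝒟.diag' (f a) (g a)) ih) fun v => ?_
      simp
  refine 𝒟.congr (key Finset.univ) fun v => ?_
  simp [funext_iff]

end DefSystem

/-- A map between sorts with a definable graph. -/
@[fun_prop]
def DefFun (f : γ → δ) : Prop :=
  {v : Ix 𝒟 γ ⊕ Ix 𝒟 δ → M | ∃ g, Sum.elim (Srt.code 𝒟 g) (Srt.code 𝒟 (f g)) = v} ∈ 𝒟.D

instance : Srt 𝒟 M where
  Ix := Unit
  fin := inferInstance
  code' m _ := m
  inj' _ _ h := congrFun h ()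
  range' := by
    refine 𝒟.congr (𝒟.univ_mem) fun v => ?_
    simp only [Set.mem_univ, iff_true]
    exact ⟨v (), rfl⟩

open Classical in
noncomputable instance : Srt 𝒟 Prop where
  Ix := Unit
  fin := inferInstance
  code' p _ := if p then 𝒟.one else 𝒟.zero
  inj' p q h := by
    have := congrFun h ()
    have h01 := 𝒟.zero_ne_one
    by_cases hp : p <;> by_cases hq : q <;> simp_all
  range' := by
    refine 𝒟.congr (𝒟.union 𝒟.one_def 𝒟.zero_def) fun v => ?_
    constructor
    · rintro ⟨p, rfl⟩
      by_cases hp : p <;> simp [hp]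
    · rintro (h | h)
      · exact ⟨True, funext fun _ => by simpa using h.symm⟩
      · exact ⟨False, funext fun _ => by simpa using h.symm⟩

instance {κ : Type} [Finite κ] : Srt 𝒟 (κ → M) where
  Ix := κ
  fin := inferInstance
  code' v := v
  inj' _ _ h := h
  range' := by
    refine 𝒟.congr (𝒟.univ_mem) fun v => ?_
    simp

instance : Srt 𝒟 (γ × δ) where
  Ix := Ix 𝒟 γ ⊕ Ix 𝒟 δ
  fin := inferInstance
  code' x := Sum.elim (Srt.code 𝒟 x.1) (Srt.code 𝒟 x.2)
  inj' x y h := by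
    have h1 : Srt.code 𝒟 x.1 = Srt.code 𝒟 y.1 := funext fun i => congrFun h (.inl i)
    have h2 : Srt.code 𝒟 x.2 = Srt.code 𝒟 y.2 := funext fun i => congrFun h (.inr i)
    exact Prod.ext (Srt.inj h1) (Srt.inj h2)
  range' := by
    refine 𝒟.congr (𝒟.inter (𝒟.reindex Sum.inl (Srt.range 𝒟 γ))
      (𝒟.reindex Sum.inr (Srt.range 𝒟 δ))) fun v => ?_
    constructor
    · rintro ⟨⟨a, b⟩, rfl⟩
      exact ⟨⟨a, rfl⟩, ⟨b, rfl⟩⟩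
    · rintro ⟨⟨a, ha⟩, ⟨b, hb⟩⟩
      refine ⟨(a, b), ?_⟩
      ext (i | i)
      · exact congrFun ha i
      · exact congrFun hb i

variable {𝒟}

/-- With `DefFun.pred`, this passes between definable maps into `Prop` and definable sets of codes.
The graph is split according to the truth value. -/
theorem DefFun.of_pred {p : γ → Prop} (h : {v | ∃ g, Srt.code 𝒟 g = v ∧ p g} ∈ 𝒟.D) :
    DefFun 𝒟 p := by
  classical
  have h1 := 𝒟.inter (𝒟.reindex (Sum.inl : _ → Ix 𝒟 γ ⊕ Unit) h)
    (𝒟.reindex (Sum.inr : _ → Ix 𝒟 γ ⊕ Unit) 𝒟.one_def)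
  have h2 := 𝒟.inter (𝒟.inter (𝒟.reindex (Sum.inl : _ → Ix 𝒟 γ ⊕ Unit) (Srt.range 𝒟 γ))
    (𝒟.compl (𝒟.reindex (Sum.inl : _ → Ix 𝒟 γ ⊕ Unit) h)))
    (𝒟.reindex (Sum.inr : _ → Ix 𝒟 γ ⊕ Unit) 𝒟.zero_def)
  have := 𝒟.union h1 h2
  unfold DefFun
  refine 𝒟.congr (this) fun v => ?_
  constructor
  · rintro ⟨g, rfl⟩
    by_cases hp : p g
    · exact Or.inl ⟨⟨g, rfl, hp⟩, if_pos hp⟩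
    · refine Or.inr ⟨⟨⟨g, rfl⟩, ?_⟩, if_neg hp⟩
      rintro ⟨g', hg', hp'⟩
      exact hp (Srt.inj hg' ▸ hp')
  · rintro (⟨⟨g, hg, hp⟩, h⟩ | ⟨⟨⟨g, hg⟩, hp⟩, h⟩)
    · refine ⟨g, ?_⟩
      ext (i | i)
      · exact congrFun hg i
      · exact (if_pos hp).trans h.symm
    · refine ⟨g, ?_⟩
      ext (i | i)
      · exact congrFun hg i
      · refine (if_neg fun hp' => hp ⟨g, hg, hp'⟩).trans h.symm

theorem DefFun.pred {p : γ → Prop} (h : DefFun 𝒟 p) :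
    {v | ∃ g, Srt.code 𝒟 g = v ∧ p g} ∈ 𝒟.D := by
  classical
  have h1 := 𝒟.proj (𝒟.inter h (𝒟.reindex (Sum.inr : _ → Ix 𝒟 γ ⊕ Unit) 𝒟.one_def))
  refine 𝒟.congr (h1) fun v => ?_
  constructor
  · rintro ⟨g, rfl, hp⟩
    refine ⟨fun _ => 𝒟.one, ⟨g, ?_⟩, rfl⟩
    congr 1
    exact funext fun _ => if_pos hp
  · rintro ⟨w, ⟨g, hg⟩, h⟩
    refine ⟨g, funext fun i => congrFun hg (.inl i), ?_⟩
    by_contra hp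
    have := congrFun hg (.inr ())
    have h0 : (if p g then 𝒟.one else 𝒟.zero) = 𝒟.one := this.trans h
    rw [if_neg hp] at h0
    exact 𝒟.zero_ne_one h0

@[fun_prop]
theorem DefFun.id : DefFun 𝒟 (fun x : γ => x) := by
  unfold DefFun
  refine 𝒟.congr (𝒟.inter (𝒟.eq_tuples Sum.inl Sum.inr) (𝒟.reindex Sum.inl (Srt.range 𝒟 γ))) fun v => ?_
  constructor
  · rintro ⟨g, rfl⟩
    exact ⟨rfl, g, rfl⟩
  · rintro ⟨h, g, hg⟩
    refine ⟨g, ?_⟩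
    ext (i | i)
    · exact congrFun hg i
    · exact (congrFun hg i).trans (congrFun h i)

@[fun_prop]
theorem DefFun.comp {f : δ → ε} {g : γ → δ} (hf : DefFun 𝒟 f) (hg : DefFun 𝒟 g) :
    DefFun 𝒟 (fun x => f (g x)) := by
  have h1 := 𝒟.reindex
    (Sum.elim (fun i => Sum.inl (Sum.inl i)) Sum.inr : Ix 𝒟 γ ⊕ Ix 𝒟 δ → (Ix 𝒟 γ ⊕ Ix 𝒟 ε) ⊕ Ix 𝒟 δ) hg
  have h2 := 𝒟.reindex
    (Sum.elim Sum.inr (fun i => Sum.inl (Sum.inr i)) : Ix 𝒟 δ ⊕ Ix 𝒟 ε → (Ix 𝒟 γ ⊕ Ix 𝒟 ε) ⊕ Ix 𝒟 δ) hf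
  have := 𝒟.proj (𝒟.inter h1 h2)
  unfold DefFun
  refine 𝒟.congr (this) fun v => ?_
  constructor
  · rintro ⟨x, rfl⟩
    refine ⟨Srt.code 𝒟 (g x), ⟨x, ?_⟩, ⟨g x, ?_⟩⟩ <;> (ext (i | i) <;> rfl)
  · rintro ⟨w, ⟨x, hx⟩, ⟨y, hy⟩⟩
    have h3 : Srt.code 𝒟 y = Srt.code 𝒟 (g x) := funext fun i =>
      (congrFun hy (.inl i)).trans (congrFun hx (.inr i)).symm
    obtain rfl := Srt.inj h3
    refine ⟨x, ?_⟩
    ext (i | i)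
    · exact congrFun hx (.inl i)
    · exact congrFun hy (.inr i)

@[fun_prop]
theorem DefFun.prodMk {f : γ → δ} {g : γ → ε} (hf : DefFun 𝒟 f) (hg : DefFun 𝒟 g) :
    DefFun 𝒟 (fun x => (f x, g x)) := by
  have h1 := 𝒟.reindex
    (Sum.elim Sum.inl (fun i => Sum.inr (Sum.inl i)) : Ix 𝒟 γ ⊕ Ix 𝒟 δ → Ix 𝒟 γ ⊕ (Ix 𝒟 δ ⊕ Ix 𝒟 ε)) hf
  have h2 := 𝒟.reindex
    (Sum.elim Sum.inl (fun i => Sum.inr (Sum.inr i)) : Ix 𝒟 γ ⊕ Ix 𝒟 ε → Ix 𝒟 γ ⊕ (Ix 𝒟 δ ⊕ Ix 𝒟 ε)) hg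
  have := 𝒟.inter h1 h2
  unfold DefFun
  refine 𝒟.congr (this) fun v => ?_
  constructor
  · rintro ⟨x, rfl⟩
    refine ⟨⟨x, ?_⟩, ⟨x, ?_⟩⟩ <;> (ext (i | i) <;> rfl)
  · rintro ⟨⟨x, hx⟩, ⟨y, hy⟩⟩
    have h3 : Srt.code 𝒟 x = Srt.code 𝒟 y := funext fun i =>
      (congrFun hx (.inl i)).trans (congrFun hy (.inl i)).symm
    obtain rfl := Srt.inj h3
    refine ⟨x, ?_⟩
    ext (i | i | i)
    · exact congrFun hx (.inl i)
    · exact congrFun hx (.inr i)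
    · exact congrFun hy (.inr i)

/-- A map is definable if its graph is. -/
theorem DefFun.of_graph {f : γ → δ} (h : DefFun 𝒟 (fun q : γ × δ => f q.1 = q.2)) : DefFun 𝒟 f := by
  have := h.pred
  unfold DefFun
  refine 𝒟.congr (this) fun v => ?_
  constructor
  · rintro ⟨x, rfl⟩
    exact ⟨(x, f x), rfl, rfl⟩
  · rintro ⟨⟨x, y⟩, rfl, hxy⟩
    obtain rfl : f x = y := hxy
    exact ⟨x, rfl⟩

theorem DefFun.fst' : DefFun 𝒟 (Prod.fst : γ × δ → γ) := by
  unfold DefFun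
  have := 𝒟.inter (𝒟.eq_tuples (fun i : Ix 𝒟 γ => (Sum.inl (Sum.inl i) : (Ix 𝒟 γ ⊕ Ix 𝒟 δ) ⊕ Ix 𝒟 γ)) Sum.inr)
    (𝒟.reindex Sum.inl (Srt.range 𝒟 (γ × δ)))
  refine 𝒟.congr (this) fun v => ?_
  constructor
  · rintro ⟨x, rfl⟩
    exact ⟨rfl, x, rfl⟩
  · rintro ⟨h, x, hx⟩
    refine ⟨x, ?_⟩
    ext (i | i)
    · exact congrFun hx i
    · exact (congrFun hx (.inl i)).trans (congrFun h i)

theorem DefFun.snd' : DefFun 𝒟 (Prod.snd : γ × δ → δ) := by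
  unfold DefFun
  have := 𝒟.inter (𝒟.eq_tuples (fun i : Ix 𝒟 δ => (Sum.inl (Sum.inr i) : (Ix 𝒟 γ ⊕ Ix 𝒟 δ) ⊕ Ix 𝒟 δ)) Sum.inr)
    (𝒟.reindex Sum.inl (Srt.range 𝒟 (γ × δ)))
  refine 𝒟.congr (this) fun v => ?_
  constructor
  · rintro ⟨x, rfl⟩
    exact ⟨rfl, x, rfl⟩
  · rintro ⟨h, x, hx⟩
    refine ⟨x, ?_⟩
    ext (i | i)
    · exact congrFun hx i
    · exact (congrFun hx (.inr i)).trans (congrFun h i)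

@[fun_prop]
theorem DefFun.fst {f : γ → δ × ε} (hf : DefFun 𝒟 f) : DefFun 𝒟 (fun x => (f x).1) :=
  DefFun.fst'.comp hf

@[fun_prop]
theorem DefFun.snd {f : γ → δ × ε} (hf : DefFun 𝒟 f) : DefFun 𝒟 (fun x => (f x).2) :=
  DefFun.snd'.comp hf

@[fun_prop]
theorem DefFun.eq {f g : γ → δ} (hf : DefFun 𝒟 f) (hg : DefFun 𝒟 g) :
    DefFun 𝒟 (fun x => f x = g x) := by
  have h : DefFun 𝒟 (fun q : δ × δ => q.1 = q.2) := by
    apply DefFun.of_pred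
    refine 𝒟.congr (𝒟.inter (𝒟.eq_tuples (Sum.inl : Ix 𝒟 δ → Ix 𝒟 δ ⊕ Ix 𝒟 δ) Sum.inr)
      (Srt.range 𝒟 (δ × δ))) fun v => ?_
    constructor
    · rintro ⟨⟨a, b⟩, rfl, h⟩
      obtain rfl : a = b := h
      exact ⟨rfl, _, rfl⟩
    · rintro ⟨h, ⟨a, b⟩, rfl⟩
      exact ⟨(a, b), rfl, Srt.inj h⟩
  exact h.comp (hf.prodMk hg)

@[fun_prop]
theorem DefFun.not {p : γ → Prop} (hp : DefFun 𝒟 p) : DefFun 𝒟 (fun x => ¬ p x) := by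
  apply DefFun.of_pred
  refine 𝒟.congr (𝒟.inter (𝒟.compl hp.pred) (Srt.range 𝒟 γ)) fun v => ?_
  constructor
  · rintro ⟨x, rfl, hx⟩
    refine ⟨?_, x, rfl⟩
    rintro ⟨y, hy, hpy⟩
    exact hx (Srt.inj hy ▸ hpy)
  · rintro ⟨h, x, rfl⟩
    exact ⟨x, rfl, fun hx => h ⟨x, rfl, hx⟩⟩

@[fun_prop]
theorem DefFun.and {p q : γ → Prop} (hp : DefFun 𝒟 p) (hq : DefFun 𝒟 q) :
    DefFun 𝒟 (fun x => p x ∧ q x) := by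
  apply DefFun.of_pred
  refine 𝒟.congr (𝒟.inter hp.pred hq.pred) fun v => ?_
  constructor
  · rintro ⟨x, rfl, hx, hx'⟩
    exact ⟨⟨x, rfl, hx⟩, ⟨x, rfl, hx'⟩⟩
  · rintro ⟨⟨x, rfl, hx⟩, ⟨y, hy, hx'⟩⟩
    exact ⟨x, rfl, hx, Srt.inj hy ▸ hx'⟩

@[fun_prop]
theorem DefFun.or {p q : γ → Prop} (hp : DefFun 𝒟 p) (hq : DefFun 𝒟 q) :
    DefFun 𝒟 (fun x => p x ∨ q x) := by
  have := (hp.not.and hq.not).not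
  simpa only [not_and_or, not_not] using this

/-- Implication, as a function. -/
def Imp (p q : Prop) : Prop := p → q

/-- Universal quantification, as a function. -/
def All {α : Type v} (p : α → Prop) : Prop := ∀ x, p x

/-- Arrows and dependent products are not applications of functions. Rewriting with this and
`forall_iff_All` gives formulas a shape that `fun_prop` can take apart. -/
theorem imp_iff_Imp {p q : Prop} : (p → q) ↔ Imp p q := Iff.rfl

theorem forall_iff_All {α : Type v} {p : α → Prop} : (∀ x, p x) ↔ All p := Iff.rfl

@[fun_prop]
theorem DefFun.imp {p q : γ → Prop} (hp : DefFun 𝒟 p) (hq : DefFun 𝒟 q) :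
    DefFun 𝒟 (fun x => Imp (p x) (q x)) := by
  simpa only [Imp, imp_iff_not_or] using hp.not.or hq

@[fun_prop]
theorem DefFun.iff {p q : γ → Prop} (hp : DefFun 𝒟 p) (hq : DefFun 𝒟 q) :
    DefFun 𝒟 (fun x => p x ↔ q x) := by
  simpa only [Imp, iff_iff_implies_and_implies] using (hp.imp hq).and (hq.imp hp)

@[fun_prop]
theorem DefFun.exists {p : γ → δ → Prop} (hp : DefFun 𝒟 (fun q : γ × δ => p q.1 q.2)) :
    DefFun 𝒟 (fun x => ∃ y, p x y) := by
  apply DefFun.of_pred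
  refine 𝒟.congr (𝒟.proj hp.pred) fun v => ?_
  constructor
  · rintro ⟨x, rfl, y, hy⟩
    exact ⟨Srt.code 𝒟 y, (x, y), rfl, hy⟩
  · rintro ⟨w, ⟨x, y⟩, h, hp⟩
    exact ⟨x, funext fun i => congrFun h (.inl i), y, hp⟩

@[fun_prop]
theorem DefFun.all {p : γ → δ → Prop} (hp : DefFun 𝒟 (fun q : γ × δ => p q.1 q.2)) :
    DefFun 𝒟 (fun x => All fun y => p x y) := by
  have := (DefFun.exists (p := fun x y => ¬ p x y) hp.not).not
  simpa only [All, not_exists, not_not] using this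

end

/-! ### Parameters, and their elimination by least numbers -/

section

variable {M : Type u} {𝒟 : DefSystem M} {γ : Type v} {δ : Type w} [Srt 𝒟 γ] [Srt 𝒟 δ]

/-- A coordinate of a tuple. -/
def coord {κ : Type} (i : κ) (p : κ → M) : M := p i

@[fun_prop]
theorem DefFun.coord {κ : Type} [Finite κ] (i : κ) {f : γ → κ → M} (hf : DefFun 𝒟 f) :
    DefFun 𝒟 (fun x => coord i (f x)) := by
  have h : DefFun 𝒟 (fun p : κ → M => p i) := by
    unfold DefFun
    refine 𝒟.congr (𝒟.diag' (Sum.inl i : κ ⊕ Unit) (Sum.inr ())) fun v => ?_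
    constructor
    · rintro ⟨p, rfl⟩
      rfl
    · intro h
      refine ⟨fun i => v (.inl i), ?_⟩
      ext (j | j)
      · rfl
      · exact h
  exact h.comp hf

/-- Every element is definable. -/
class HasConsts (𝒟 : DefSystem M) : Prop where
  const : ∀ m : M, {v : Unit → M | v () = m} ∈ 𝒟.D

@[fun_prop]
theorem DefFun.const [HasConsts 𝒟] (d : δ) : DefFun 𝒟 (fun _ : γ => d) := by
  classical
  have := Fintype.ofFinite (Ix 𝒟 δ)
  have key : ∀ s : Finset (Ix 𝒟 δ),
      {v : Ix 𝒟 γ ⊕ Ix 𝒟 δ → M | ∀ i ∈ s, v (.inr i) = Srt.code 𝒟 d i} ∈ 𝒟.D := by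
    intro s
    induction s using Finset.induction_on with
    | empty => simpa using 𝒟.univ_mem
    | insert a s _ ih =>
      refine 𝒟.congr (𝒟.inter (𝒟.reindex (fun _ : Unit => Sum.inr a)
        (HasConsts.const (𝒟 := 𝒟) (Srt.code 𝒟 d a))) ih) fun v => ?_
      simp
  unfold DefFun
  refine 𝒟.congr (𝒟.inter (𝒟.reindex Sum.inl (Srt.range 𝒟 γ)) (key Finset.univ)) fun v => ?_
  constructor
  · rintro ⟨x, rfl⟩
    exact ⟨⟨x, rfl⟩, fun i _ => rfl⟩
  · rintro ⟨⟨x, hx⟩, h⟩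
    refine ⟨x, ?_⟩
    ext (i | i)
    · exact congrFun hx i
    · exact (h i (Finset.mem_univ i)).symm

namespace DefSystem

variable (𝒟)

/-- The sets that are definable with parameters. -/
def param : DefSystem M where
  D {ι} := {s | ∃ (κ : Type) (_ : Finite κ) (p : κ → M) (t : Set (ι ⊕ κ → M)),
    t ∈ 𝒟.D ∧ ∀ v, v ∈ s ↔ Sum.elim v p ∈ t}
  compl := by
    rintro ι s ⟨κ, _, p, t, ht, h⟩
    exact ⟨κ, ‹_›, p, tᶜ, 𝒟.compl ht, fun v => not_congr (h v)⟩
  inter := by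
    rintro ι s s' ⟨κ, _, p, t, ht, h⟩ ⟨κ', _, p', t', ht', h'⟩
    refine ⟨κ ⊕ κ', inferInstance, Sum.elim p p', _, 𝒟.inter
      (𝒟.reindex (Sum.map id Sum.inl : ι ⊕ κ → ι ⊕ (κ ⊕ κ')) ht)
      (𝒟.reindex (Sum.map id Sum.inr : ι ⊕ κ' → ι ⊕ (κ ⊕ κ')) ht'), fun v => ?_⟩
    refine and_congr ((h v).trans ?_) ((h' v).trans ?_)
    · show _ ↔ Sum.elim v (Sum.elim p p') ∘ Sum.map id Sum.inl ∈ t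
      rw [Sum.elim_comp_map]; rfl
    · show _ ↔ Sum.elim v (Sum.elim p p') ∘ Sum.map id Sum.inr ∈ t'
      rw [Sum.elim_comp_map]; rfl
  reindex := by
    rintro ι ι' f s ⟨κ, _, p, t, ht, h⟩
    refine ⟨κ, ‹_›, p, _, 𝒟.reindex (Sum.map f id : ι ⊕ κ → ι' ⊕ κ) ht, fun v => ?_⟩
    refine (h (v ∘ f)).trans ?_
    show _ ↔ Sum.elim v p ∘ Sum.map f id ∈ t
    rw [Sum.elim_comp_map]; rfl
  proj := by
    rintro ι ι' _ _ s ⟨κ, _, p, t, ht, h⟩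
    refine ⟨κ, ‹_›, p, _, 𝒟.proj (𝒟.reindex
      (Sum.elim (Sum.elim (Sum.inl ∘ Sum.inl) Sum.inr) (Sum.inl ∘ Sum.inr) :
        (ι ⊕ ι') ⊕ κ → (ι ⊕ κ) ⊕ ι') ht), fun v => exists_congr fun w => (h _).trans ?_⟩
    have : Sum.elim (Sum.elim v w) p = Sum.elim (Sum.elim v p) w ∘
        (Sum.elim (Sum.elim (Sum.inl ∘ Sum.inl) Sum.inr) (Sum.inl ∘ Sum.inr) :
        (ι ⊕ ι') ⊕ κ → (ι ⊕ κ) ⊕ ι') := by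
      ext ((i | i) | i) <;> rfl
    rw [this]; rfl
  diag := ⟨Empty, inferInstance, Empty.elim, _, 𝒟.reindex Sum.inl 𝒟.diag, fun _ => Iff.rfl⟩
  zero := 𝒟.zero
  one := 𝒟.one
  zero_ne_one := 𝒟.zero_ne_one
  zero_def := ⟨Empty, inferInstance, Empty.elim, _, 𝒟.reindex Sum.inl 𝒟.zero_def, fun _ => Iff.rfl⟩
  one_def := ⟨Empty, inferInstance, Empty.elim, _, 𝒟.reindex Sum.inl 𝒟.one_def, fun _ => Iff.rfl⟩

theorem mem_param {ι : Type} {s : Set (ι → M)} (h : s ∈ 𝒟.D) : s ∈ 𝒟.param.D :=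
  ⟨Empty, inferInstance, Empty.elim, _, 𝒟.reindex Sum.inl h, fun _ => Iff.rfl⟩

instance : HasConsts 𝒟.param where
  const m := ⟨Unit, inferInstance, fun _ => m, _,
    𝒟.diag' (Sum.inl () : Unit ⊕ Unit) (Sum.inr ()), fun _ => Iff.rfl⟩

end DefSystem

/-- A sort, when definability with parameters is considered. -/
@[reducible] def Srt.param (γ : Type v) (h : Srt 𝒟 γ) : Srt 𝒟.param γ where
  Ix := h.Ix
  fin := h.fin
  code' := h.code'
  inj' := h.inj'
  range' := 𝒟.mem_param h.range'

end

section

variable {M : Type u} {𝒟 : DefSystem M} {γ : Type v} {δ : Type w} [hγ : Srt 𝒟 γ] [hδ : Srt 𝒟 δ]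

theorem DefFun.param {f : γ → δ} (hf : DefFun 𝒟 f) :
    letI := hγ.param; letI := hδ.param; DefFun 𝒟.param f := 𝒟.mem_param hf

theorem DefFun.param_pred {f : γ → Prop} (hf : DefFun 𝒟 f) :
    letI := hγ.param; DefFun 𝒟.param f := 𝒟.mem_param hf

theorem DefFun.param_pred₂ {f : γ → δ → Prop} (hf : DefFun 𝒟 fun q : γ × δ => f q.1 q.2) :
    letI := hγ.param; letI := hδ.param; DefFun 𝒟.param fun q : γ × δ => f q.1 q.2 := 𝒟.mem_param hf

/-- Separates the parameters from the formula: the family `R` is definable without parameters, and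
so are statements that quantify over its members. -/
theorem DefFun.exists_family {P : γ → Prop} (hP : letI := hγ.param; DefFun 𝒟.param P) :
    ∃ (κ : Type) (_ : Finite κ) (p : κ → M) (R : (κ → M) → γ → Prop),
      DefFun 𝒟 (fun q : (κ → M) × γ => R q.1 q.2) ∧ P = R p := by
  let := hγ.param
  obtain ⟨κ, hκ, p, t, ht, h⟩ := DefFun.pred hP
  refine ⟨κ, hκ, p, fun q x => Sum.elim (Srt.code 𝒟 x) q ∈ t, ?_, ?_⟩
  · apply DefFun.of_pred
    refine 𝒟.congr (𝒟.inter (𝒟.reindex (Sum.elim Sum.inr Sum.inl : Ix 𝒟 γ ⊕ κ → κ ⊕ Ix 𝒟 γ) ht)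
      (Srt.range 𝒟 ((κ → M) × γ))) fun v => ?_
    have key : ∀ q x, Srt.code 𝒟 (q, x) ∘
        (Sum.elim Sum.inr Sum.inl : Ix 𝒟 γ ⊕ κ → κ ⊕ Ix 𝒟 γ) = Sum.elim (Srt.code 𝒟 x) q := by
      intro q x
      ext (i | i) <;> rfl
    constructor
    · rintro ⟨⟨q, x⟩, rfl, hx⟩
      refine ⟨?_, _, rfl⟩
      show _ ∈ t
      rw [key]
      exact hx
    · rintro ⟨hx, ⟨q, x⟩, rfl⟩
      refine ⟨_, rfl, ?_⟩
      show _ ∈ t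
      rw [← key]
      exact hx
  · ext x
    refine Iff.trans ?_ (h (Srt.code 𝒟 x))
    constructor
    · intro hx
      exact ⟨x, rfl, hx⟩
    · rintro ⟨y, hy, hp⟩
      exact hγ.inj' hy ▸ hp

/-- The least number principle. -/
def LeastNumber (𝒟 : DefSystem M) [LinearOrder M] : Prop :=
  ∀ P : M → Prop, DefFun 𝒟 P → (∃ x, P x) → ∃ x, P x ∧ ∀ y, P y → x ≤ y

variable [LinearOrder M]

/-- The coordinates are minimized one after another. Each minimization is definable, and when all
coordinates are fixed the remaining set is a singleton, which defines its element. -/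
theorem LeastNumber.exists_definable (hL : LeastNumber 𝒟)
    (hle : DefFun 𝒟 (fun q : M × M => q.1 ≤ q.2)) {κ : Type} [Finite κ]
    {T : (κ → M) → Prop} (hT : DefFun 𝒟 T) (hne : ∃ p, T p) :
    ∃ p, T p ∧ DefFun 𝒟 (fun q : κ → M => q = p) := by
  classical
  have := Fintype.ofFinite κ
  have key : ∀ s : Finset κ, ∃ T' : (κ → M) → Prop, DefFun 𝒟 T' ∧ (∃ p, T' p) ∧
      (∀ p, T' p → T p) ∧ ∀ p q, T' p → T' q → ∀ i ∈ s, p i = q i := by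
    intro s
    induction s using Finset.induction_on with
    | empty => exact ⟨T, hT, hne, fun _ h => h, by simp⟩
    | insert a s _ ih =>
      obtain ⟨T', hT', ⟨p, hp⟩, hsub, heq⟩ := ih
      refine ⟨fun p => T' p ∧ ∀ q, T' q → coord a p ≤ coord a q, ?_, ?_, fun p hp => hsub p hp.1, ?_⟩
      · simp only [imp_iff_Imp, forall_iff_All]
        fun_prop
      · obtain ⟨x, ⟨p, hp, rfl⟩, hx⟩ :=
          hL (fun x => ∃ p, T' p ∧ coord a p = x) (by fun_prop) ⟨p a, p, hp, rfl⟩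
        exact ⟨p, hp, fun q hq => hx _ ⟨q, hq, rfl⟩⟩
      · intro p q hp hq i hi
        rcases Finset.mem_insert.1 hi with rfl | hi
        · exact le_antisymm (hp.2 q hq.1) (hq.2 p hp.1)
        · exact heq p q hp.1 hq.1 i hi
  obtain ⟨T', hT', ⟨p, hp⟩, hsub, heq⟩ := key Finset.univ
  refine ⟨p, hsub p hp, ?_⟩
  have : (fun q : κ → M => q = p) = T' := by
    ext q
    constructor
    · rintro rfl; exact hp
    · intro hq; exact funext fun i => heq q p hq hp i (Finset.mem_univ i)
  rw [this]
  exact hT'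

/-- A definable property of definable predicates holds for all predicates that are definable with
parameters once it holds for those that are definable without. -/
theorem LeastNumber.transfer (hL : LeastNumber 𝒟)
    (hle : DefFun 𝒟 (fun q : M × M => q.1 ≤ q.2)) {Φ : (γ → Prop) → Prop}
    (hΦ : ∀ (κ : Type) (_ : Finite κ) (R : (κ → M) → γ → Prop),
      DefFun 𝒟 (fun q : (κ → M) × γ => R q.1 q.2) → DefFun 𝒟 (fun p => Φ (R p)))
    (h0 : ∀ P, DefFun 𝒟 P → Φ P) {P : γ → Prop} (hP : letI := hγ.param; DefFun 𝒟.param P) :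
    Φ P := by
  obtain ⟨κ, hκ, p, R, hR, rfl⟩ := DefFun.exists_family hP
  by_contra hp
  -- The parameters at which `Φ` fails form a nonempty definable set. It contains a definable tuple
  -- `p'`, and `R p'` is then definable without parameters.
  obtain ⟨p', hp', hdef⟩ := hL.exists_definable hle (hΦ κ hκ R hR).not ⟨p, hp⟩
  refine hp' (h0 _ ?_)
  have : R p' = fun x => ∃ q, q = p' ∧ R q x := by simp
  rw [this]
  fun_prop

end

/-! ### Coding of bounded definable sets in models of arithmetic -/

/-- Semirings that satisfy the induction principle for definable sets. -/
class PAModel {M : Type u} (𝒟 : DefSystem M) [CommSemiring M] [LinearOrder M] : Prop where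
  add_def : DefFun 𝒟 (fun q : M × M => q.1 + q.2)
  mul_def : DefFun 𝒟 (fun q : M × M => q.1 * q.2)
  lt_add_one : ∀ x y : M, x < y + 1 ↔ x ≤ y
  ind : ∀ P : M → Prop, DefFun 𝒟 P → P 0 → (∀ x, P x → P (x + 1)) → ∀ x, P x

/-- Linear orders with induction for definable sets, and with definable codes for pairs and
for bounded definable sets. -/
class CodedOrder {M : Type u} (𝒟 : DefSystem M) [LinearOrder M] where
  zero : M
  succ : M → M
  pair : M → M → M
  mem : M → M → Prop
  le_def : DefFun 𝒟 (fun q : M × M => q.1 ≤ q.2)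
  succ_def : DefFun 𝒟 succ
  pair_def : DefFun 𝒟 (fun q : M × M => pair q.1 q.2)
  mem_def : DefFun 𝒟 (fun q : M × M => mem q.1 q.2)
  zero_le : ∀ x, zero ≤ x
  lt_succ : ∀ x y, x < succ y ↔ x ≤ y
  ind : ∀ P : M → Prop, DefFun 𝒟 P → P zero → (∀ x, P x → P (succ x)) → ∀ x, P x
  least : LeastNumber 𝒟
  pair_inj : ∀ x y x' y', pair x y = pair x' y' → x = x' ∧ y = y'
  pair_le : ∀ x y x' y', x ≤ x' → y ≤ y' → pair x y ≤ pair x' y'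
  le_pair : ∀ x y, x ≤ pair x y ∧ y ≤ pair x y
  -- Since codes exceed the elements of what they code, the union of all coded sets with codes below
  -- `b` is itself bounded by `b`.
  mem_lt : ∀ i s, mem i s → i < s
  exists_code : ∀ P : M → Prop, DefFun 𝒟 P → (∃ b, ∀ x, P x → x < b) → ∃ s, ∀ x, mem x s ↔ P x

section

variable {M : Type u} {𝒟 : DefSystem M} {γ : Type v} [Srt 𝒟 γ]
  [CommSemiring M] [LinearOrder M] [PAModel 𝒟]

@[fun_prop]
theorem DefFun.add {f g : γ → M} (hf : DefFun 𝒟 f) (hg : DefFun 𝒟 g) :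
    DefFun 𝒟 (fun x => f x + g x) := PAModel.add_def.comp (hf.prodMk hg)

@[fun_prop]
theorem DefFun.mul {f g : γ → M} (hf : DefFun 𝒟 f) (hg : DefFun 𝒟 g) :
    DefFun 𝒟 (fun x => f x * g x) := PAModel.mul_def.comp (hf.prodMk hg)

@[fun_prop]
theorem DefFun.dvd {f g : γ → M} (hf : DefFun 𝒟 f) (hg : DefFun 𝒟 g) :
    DefFun 𝒟 (fun x => f x ∣ g x) := by
  simp only [dvd_def]
  fun_prop

end

namespace PAModel

section

variable {M : Type u} {𝒟 : DefSystem M} {γ : Type v} [Srt 𝒟 γ]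
  [CommSemiring M] [LinearOrder M] [IsStrictOrderedRing M] [CanonicallyOrderedAdd M]

/-- In the absence of subtraction the two cofactors are compared. If that of `b` is the larger one,
`c` is zero. -/
theorem dvd_of_dvd_add {a b c : M} (hb : a ∣ b) (h : a ∣ b + c) : a ∣ c := by
  obtain ⟨u, rfl⟩ := hb
  obtain ⟨v, hv⟩ := h
  rcases le_total u v with huv | huv
  · obtain ⟨w, rfl⟩ := le_iff_exists_add.1 huv
    rw [mul_add] at hv
    exact ⟨w, add_left_cancel hv⟩
  · obtain ⟨w, rfl⟩ := le_iff_exists_add.1 huv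
    have : a * w + c = 0 := by
      apply add_left_cancel (a := a * v)
      rw [← add_assoc, ← mul_add, hv, add_zero]
    have hc : c = 0 := by
      have := (add_eq_zero.1 this).2
      exact this
    simp [hc]

/-- The moduli for the coding of sets. -/
def modulus (d i : M) : M := 1 + (i + 1) * d

/-- A modulus is congruent to `1` modulo `d`, hence prime to `d` and to each divisor of `d`. The
factors `d` and `k` are cancelled in turn by the identity `(i + 1) * (y * d) + y = y * modulus d i`.
-/
theorem dvd_of_modulus_dvd_mul {d i k x : M} (hk : k ∣ d) (h : modulus d i ∣ x * (k * d)) :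
    modulus d i ∣ x := by
  obtain ⟨e, he⟩ := hk
  have h1 : modulus d i ∣ x * k := by
    refine dvd_of_dvd_add (b := (i + 1) * (x * (k * d))) (h.mul_left _) ⟨x * k, ?_⟩
    unfold modulus; ring
  have h2 : modulus d i ∣ x * d := by
    have h2 := h1.mul_right e
    rwa [mul_assoc, ← he] at h2
  refine dvd_of_dvd_add (b := (i + 1) * (x * d)) (h2.mul_left _) ⟨x, ?_⟩
  unfold modulus; ring

/-- Two moduli differ by `k * d` with `0 < k ≤ b`, so that `k ∣ d` and `dvd_of_modulus_dvd_mul`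
applies. This is all the coprimality that the coding needs; neither greatest common divisors nor
primes occur. -/
theorem modulus_dvd_of_dvd_mul {b d i m x : M} (hd : ∀ k, 0 < k → k ≤ b → k ∣ d) (him : i ≠ m)
    (hi : i < b) (hm : m < b) (h : modulus d i ∣ x * modulus d m) : modulus d i ∣ x := by
  rcases lt_or_gt_of_ne him with hlt | hlt
  · obtain ⟨k, rfl⟩ := le_iff_exists_add.1 hlt.le
    have hk : 0 < k := pos_iff_ne_zero.2 fun h => by simp [h] at hlt
    refine dvd_of_modulus_dvd_mul (hd k hk (le_trans le_add_self hm.le)) ?_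
    refine dvd_of_dvd_add (b := x * modulus d i) (dvd_mul_left _ _) ?_
    convert h using 1
    unfold modulus; ring
  · obtain ⟨k, rfl⟩ := le_iff_exists_add.1 hlt.le
    have hk : 0 < k := pos_iff_ne_zero.2 fun h => by simp [h] at hlt
    refine dvd_of_modulus_dvd_mul (hd k hk (le_trans le_add_self hi.le)) ?_
    refine dvd_of_dvd_add (b := x * modulus d m) h ⟨x, ?_⟩
    unfold modulus; ring

/-- The pairing function. -/
def pair (x y : M) : M := (x + y) * (x + y) + x

theorem pair_le {x y x' y' : M} (hx : x ≤ x') (hy : y ≤ y') : pair x y ≤ pair x' y' := by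
  unfold pair
  gcongr

theorem le_of_lt_add_one (𝒟 : DefSystem M) [PAModel 𝒟] {x y : M} (h : x < y + 1) : x ≤ y := (lt_add_one (𝒟 := 𝒟) x y).1 h

theorem add_one_le (𝒟 : DefSystem M) [PAModel 𝒟] {x y : M} (h : x < y) : x + 1 ≤ y :=
  not_lt.1 fun h' => absurd h (not_lt.2 (le_of_lt_add_one 𝒟 h'))

theorem le_mul_self (𝒟 : DefSystem M) [PAModel 𝒟] (x : M) : x ≤ x * x := by
  rcases eq_or_ne x 0 with rfl | h
  · simp
  · have : 1 ≤ x := by simpa using add_one_le 𝒟 (pos_iff_ne_zero.2 h)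
    exact le_mul_of_one_le_right' this

theorem right_le_pair (𝒟 : DefSystem M) [PAModel 𝒟] (x y : M) : y ≤ pair x y :=
  (le_add_self.trans (le_mul_self 𝒟 (x + y))).trans le_self_add

theorem not_modulus_dvd_one (𝒟 : DefSystem M) [PAModel 𝒟] {d i : M} (hd : d ≠ 0) :
    ¬ modulus d i ∣ 1 := by
  rintro ⟨e, he⟩
  have h1 : (1 : M) < modulus d i := by
    unfold modulus
    refine lt_add_of_pos_right _ (pos_iff_ne_zero.2 (mul_ne_zero ?_ hd))
    exact (lt_of_lt_of_le zero_lt_one le_add_self).ne'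
  rcases eq_or_ne e 0 with rfl | h0
  · simp at he
  · have : 1 ≤ e := by simpa using add_one_le 𝒟 (pos_iff_ne_zero.2 h0)
    exact absurd (h1.trans_le (le_mul_of_one_le_right' this)) (he ▸ lt_irrefl _)

/-- The pair lies in the interval from `(x + y) ^ 2` to below `(x + y + 1) ^ 2`, so it determines `x
+ y`, and then `x` is the remainder. -/
theorem pair_inj (𝒟 : DefSystem M) [PAModel 𝒟] {x y x' y' : M} (h : pair x y = pair x' y') : x = x' ∧ y = y' := by
  have key : ∀ x y x' y' : M, pair x y = pair x' y' → ¬ x + y < x' + y' := by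
    intro x y x' y' h hlt
    have h1 := add_one_le 𝒟 hlt
    have h2 : pair x y < (x + y + 1) * (x + y + 1) := by
      have : (x + y + 1) * (x + y + 1) = pair x y + (x + y + y + 1) := by unfold pair; ring
      rw [this]
      exact lt_add_of_pos_right _ (lt_of_lt_of_le zero_lt_one le_add_self)
    have h3 : (x + y + 1) * (x + y + 1) ≤ pair x' y' :=
      (mul_le_mul' h1 h1).trans le_self_add
    exact absurd h (h2.trans_le h3).ne
  have hs : x + y = x' + y' :=
    le_antisymm (not_lt.1 (key _ _ _ _ h.symm)) (not_lt.1 (key _ _ _ _ h))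
  have hx : x = x' := by
    unfold pair at h
    rw [hs] at h
    exact add_left_cancel h
  subst hx
  exact ⟨rfl, add_left_cancel hs⟩

variable [HasConsts 𝒟] [PAModel 𝒟]

@[fun_prop]
theorem _root_.Definiteness.DefFun.le {f g : γ → M} (hf : DefFun 𝒟 f) (hg : DefFun 𝒟 g) :
    DefFun 𝒟 (fun x => f x ≤ g x) := by
  simp only [le_iff_exists_add]
  fun_prop

@[fun_prop]
theorem _root_.Definiteness.DefFun.lt {f g : γ → M} (hf : DefFun 𝒟 f) (hg : DefFun 𝒟 g) :
    DefFun 𝒟 (fun x => f x < g x) := by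
  simp only [← not_le]
  fun_prop

variable (𝒟) in
theorem least : LeastNumber 𝒟 := by
  intro P hP ⟨x, hx⟩
  by_contra hno
  push Not at hno
  have : ∀ n, ∀ y, P y → n ≤ y := by
    refine ind (𝒟 := 𝒟) _ ?_ (fun _ _ => zero_le) ?_
    · simp only [imp_iff_Imp, forall_iff_All]
      fun_prop
    · intro n ih y hy
      rcases (ih y hy).lt_or_eq with h | rfl
      · exact add_one_le 𝒟 h
      · obtain ⟨z, hz, hlt⟩ := hno n hy
        exact absurd hlt (not_lt.2 (ih z hz))
  exact absurd (this (x + 1) x hx) (not_le.2 ((lt_add_one (𝒟 := 𝒟) _ _).2 le_rfl))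

/-- Takes the place of the factorial, whose definition would require the coding of sequences. That
`d` is nonzero keeps the moduli from being units. -/
theorem exists_common_multiple (𝒟 : DefSystem M) [HasConsts 𝒟] [PAModel 𝒟] (b : M) : ∃ d : M, d ≠ 0 ∧ ∀ k, 0 < k → k ≤ b → k ∣ d := by
  refine ind (𝒟 := 𝒟) (fun b => ∃ d : M, d ≠ 0 ∧ ∀ k, 0 < k → k ≤ b → k ∣ d) ?_ ?_ ?_ b
  · simp only [imp_iff_Imp, forall_iff_All, ne_eq]
    fun_prop
  · exact ⟨1, one_ne_zero, fun k h h' => absurd h (not_lt.2 h')⟩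
  · rintro b ⟨d, hd, h⟩
    refine ⟨d * (b + 1), mul_ne_zero hd (lt_of_lt_of_le zero_lt_one le_add_self).ne', ?_⟩
    intro k hk hkb
    rcases hkb.lt_or_eq with hlt | rfl
    · exact (h k hk (le_of_lt_add_one 𝒟 hlt)).mul_right _
    · exact dvd_mul_left _ _

@[fun_prop]
theorem modulus_def {f g : γ → M} (hf : DefFun 𝒟 f) (hg : DefFun 𝒟 g) :
    DefFun 𝒟 (fun x => modulus (f x) (g x)) := by
  unfold modulus
  fun_prop

@[fun_prop]
theorem pair_def {f g : γ → M} (hf : DefFun 𝒟 f) (hg : DefFun 𝒟 g) :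
    DefFun 𝒟 (fun x => pair (f x) (g x)) := by
  unfold pair
  fun_prop

/-- Membership in the set with a given code. -/
def codeMem (i s : M) : Prop := ∃ c d b, s = pair (pair c d) b ∧ i < b ∧ modulus d i ∣ c

/-- The number `c` is in effect the product of the moduli of the elements, built up by induction on
`m`: multiplying by the modulus of `m` makes `m` an element and changes nothing else below `b`. The
bound belongs to the code because the moduli are not controlled beyond it. -/
theorem exists_code (P : M → Prop) (hP : DefFun 𝒟 P) (hb : ∃ b, ∀ x, P x → x < b) :
    ∃ s, ∀ x, codeMem x s ↔ P x := by
  obtain ⟨b, hb⟩ := hb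
  obtain ⟨d, hd, hdvd⟩ := exists_common_multiple 𝒟 b
  have key : ∀ m, ∃ c, ∀ i, i < b → (modulus d i ∣ c ↔ P i ∧ i < m) := by
    refine ind (𝒟 := 𝒟) _ ?_ ⟨1, ?_⟩ ?_
    · simp only [imp_iff_Imp, forall_iff_All]
      fun_prop
    · intro i _
      simp [not_modulus_dvd_one 𝒟 hd]
    · rintro m ⟨c, hc⟩
      by_cases hm : P m
      · refine ⟨c * modulus d m, fun i hi => ?_⟩
        rcases eq_or_ne i m with rfl | him
        · simp [hm, (lt_add_one (𝒟 := 𝒟) _ _).2 le_rfl]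
        · rw [lt_add_one (𝒟 := 𝒟), le_iff_lt_or_eq, or_iff_left him, ← hc i hi]
          exact ⟨modulus_dvd_of_dvd_mul hdvd him hi (hb m hm), fun h => h.mul_right _⟩
      · refine ⟨c, fun i hi => ?_⟩
        rw [hc i hi, lt_add_one (𝒟 := 𝒟), le_iff_lt_or_eq]
        refine and_congr_right fun hPi => (or_iff_left ?_).symm
        rintro rfl
        exact hm hPi
  obtain ⟨c, hc⟩ := key b
  refine ⟨pair (pair c d) b, fun x => ?_⟩
  constructor
  · rintro ⟨c', d', b', h, hx, hdiv⟩
    obtain ⟨h1, rfl⟩ := pair_inj 𝒟 h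
    obtain ⟨rfl, rfl⟩ := pair_inj 𝒟 h1
    exact ((hc x hx).1 hdiv).1
  · intro hx
    exact ⟨c, d, b, rfl, hb x hx, (hc x (hb x hx)).2 ⟨hx, hb x hx⟩⟩

variable (𝒟) in
/-- The coding apparatus of a model of arithmetic. -/
@[reducible] def codedOrder : CodedOrder 𝒟 where
  zero := 0
  succ x := x + 1
  pair := pair
  mem := codeMem
  le_def := by fun_prop
  succ_def := by fun_prop
  pair_def := by fun_prop
  mem_def := by
    unfold codeMem
    fun_prop
  zero_le _ := zero_le
  lt_succ := lt_add_one (𝒟 := 𝒟)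
  ind := ind (𝒟 := 𝒟)
  least := least 𝒟
  pair_inj _ _ _ _ h := pair_inj 𝒟 h
  pair_le _ _ _ _ hx hy := pair_le hx hy
  le_pair _ _ := ⟨le_add_self, right_le_pair 𝒟 _ _⟩
  mem_lt := by
    rintro i s ⟨c, d, b, rfl, h, -⟩
    exact h.trans_le (right_le_pair 𝒟 _ _)
  exists_code := exists_code (𝒟 := 𝒟)

end

end PAModel

/-! ### Bounded predicates and definable recursion -/

section

variable {M : Type u} (𝒟 : DefSystem M) [LinearOrder M] [CodedOrder 𝒟]

/-- The least element. -/
abbrev czero : M := CodedOrder.zero 𝒟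

/-- The successor function. -/
def csucc (x : M) : M := CodedOrder.succ 𝒟 x

/-- The pairing function. -/
def cpair (x y : M) : M := CodedOrder.pair 𝒟 x y

/-- Membership in a coded set. -/
def cmem (x s : M) : Prop := CodedOrder.mem 𝒟 x s

variable {𝒟} {γ : Type v} {δ : Type w} [Srt 𝒟 γ] [Srt 𝒟 δ]

@[fun_prop]
theorem DefFun.cle {f g : γ → M} (hf : DefFun 𝒟 f) (hg : DefFun 𝒟 g) :
    DefFun 𝒟 (fun x => f x ≤ g x) := CodedOrder.le_def.comp (hf.prodMk hg)

@[fun_prop]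
theorem DefFun.clt {f g : γ → M} (hf : DefFun 𝒟 f) (hg : DefFun 𝒟 g) :
    DefFun 𝒟 (fun x => f x < g x) := by
  simp only [← not_le]
  fun_prop

@[fun_prop]
theorem DefFun.csucc {f : γ → M} (hf : DefFun 𝒟 f) : DefFun 𝒟 (fun x => csucc 𝒟 (f x)) :=
  CodedOrder.succ_def.comp hf

@[fun_prop]
theorem DefFun.cpair {f g : γ → M} (hf : DefFun 𝒟 f) (hg : DefFun 𝒟 g) :
    DefFun 𝒟 (fun x => cpair 𝒟 (f x) (g x)) := CodedOrder.pair_def.comp (hf.prodMk hg)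

@[fun_prop]
theorem DefFun.cmem {f g : γ → M} (hf : DefFun 𝒟 f) (hg : DefFun 𝒟 g) :
    DefFun 𝒟 (fun x => cmem 𝒟 (f x) (g x)) := CodedOrder.mem_def.comp (hf.prodMk hg)

theorem lt_csucc {x y : M} : x < csucc 𝒟 y ↔ x ≤ y := CodedOrder.lt_succ x y

variable (𝒟) in
theorem lt_csucc_self (x : M) : x < csucc 𝒟 x := lt_csucc.2 le_rfl

theorem czero_ne_csucc {x : M} : czero 𝒟 ≠ csucc 𝒟 x := fun h =>
  absurd (lt_csucc_self 𝒟 x) (not_lt.2 (h ▸ CodedOrder.zero_le x))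

theorem csucc_inj {x y : M} (h : csucc 𝒟 x = csucc 𝒟 y) : x = y :=
  le_antisymm (lt_csucc.1 (h ▸ lt_csucc_self 𝒟 x)) (lt_csucc.1 (h ▸ lt_csucc_self 𝒟 y))

/-- A predicate is bounded if it holds for elements of bounded rank only. -/
def Bdd (r : γ → M) (P : γ → Prop) : Prop := ∃ b, ∀ x, P x → r x < b

section

variable {r : γ → M} {P Q : γ → Prop}

theorem Bdd.mono (h : Bdd r Q) (hPQ : ∀ x, P x → Q x) : Bdd r P :=
  let ⟨b, hb⟩ := h
  ⟨b, fun x hx => hb x (hPQ x hx)⟩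

theorem Bdd.or (hP : Bdd r P) (hQ : Bdd r Q) : Bdd r (fun x => P x ∨ Q x) := by
  obtain ⟨b, hb⟩ := hP
  obtain ⟨c, hc⟩ := hQ
  exact ⟨max b c, fun x hx => hx.elim (fun h => (hb x h).trans_le (le_max_left _ _))
    fun h => (hc x h).trans_le (le_max_right _ _)⟩

theorem Bdd.eq (𝒟 : DefSystem M) [CodedOrder 𝒟] (r : γ → M) (a : γ) : Bdd r (fun x => x = a) :=
  ⟨csucc 𝒟 (r a), by rintro _ rfl; exact lt_csucc_self 𝒟 _⟩

theorem Bdd.pair {r' : δ → M} {R : γ → δ → Prop} (hP : Bdd r (fun x => ∃ y, R x y))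
    (hQ : Bdd r' (fun y => ∃ x, R x y)) :
    Bdd (fun q : γ × δ => cpair 𝒟 (r q.1) (r' q.2)) (fun q => R q.1 q.2) := by
  obtain ⟨b, hb⟩ := hP
  obtain ⟨c, hc⟩ := hQ
  exact ⟨csucc 𝒟 (cpair 𝒟 b c), fun q hq => lt_csucc.2
    (CodedOrder.pair_le _ _ _ _ (hb _ ⟨_, hq⟩).le (hc _ ⟨_, hq⟩).le)⟩

theorem Bdd.of_cmem (r : γ → M) (s : M) : Bdd r (fun x => cmem 𝒟 (r x) s) :=
  ⟨s, fun _ hx => CodedOrder.mem_lt _ _ hx⟩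

variable [HasConsts 𝒟]

theorem Bdd.exists_code (hb : Bdd r P) (hr : DefFun 𝒟 r) (hinj : Function.Injective r)
    (hP : DefFun 𝒟 P) : ∃ s, ∀ x, cmem 𝒟 (r x) s ↔ P x := by
  obtain ⟨b, hb⟩ := hb
  obtain ⟨s, hs⟩ := CodedOrder.exists_code (𝒟 := 𝒟) (fun m => ∃ x, r x = m ∧ P x)
    (by fun_prop) ⟨b, by rintro _ ⟨x, rfl, hx⟩; exact hb x hx⟩
  refine ⟨s, fun x => (hs (r x)).trans ?_⟩
  constructor
  · rintro ⟨y, hy, h⟩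
    exact hinj hy ▸ h
  · intro h
    exact ⟨x, rfl, h⟩

theorem Bdd.exists_code₂ {r' : δ → M} {R : γ → δ → Prop} (hP : Bdd r (fun x => ∃ y, R x y))
    (hQ : Bdd r' (fun y => ∃ x, R x y)) (hr : DefFun 𝒟 r) (hinj : Function.Injective r)
    (hr' : DefFun 𝒟 r') (hinj' : Function.Injective r')
    (hR : DefFun 𝒟 (fun q : γ × δ => R q.1 q.2)) :
    ∃ s, ∀ x y, cmem 𝒟 (cpair 𝒟 (r x) (r' y)) s ↔ R x y := by
  refine (Bdd.exists_code (hP.pair hQ) (by fun_prop) ?_ hR).elim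
    fun s hs => ⟨s, fun x y => hs (x, y)⟩
  rintro ⟨x, y⟩ ⟨x', y'⟩ h
  obtain ⟨h1, h2⟩ := CodedOrder.pair_inj _ _ _ _ h
  exact Prod.ext (hinj h1) (hinj' h2)

/-- Induction on bounds. -/
theorem Bdd.induction (hb : Bdd r P) {Φ : M → Prop} (hΦ : DefFun 𝒟 Φ) (h0 : Φ (czero 𝒟))
    (hs : ∀ n, Φ n → Φ (csucc 𝒟 n)) : ∃ b, Φ b ∧ ∀ x, P x → r x < b := by
  obtain ⟨b, hb⟩ := hb
  exact ⟨b, CodedOrder.ind (𝒟 := 𝒟) Φ hΦ h0 hs b, hb⟩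

/-- Induction on the bound: as `r` is injective, each stage adds at most one element, whose witness
enlarges the common bound. -/
theorem Bdd.collection (hb : Bdd r P) (hr : DefFun 𝒟 r) (hinj : Function.Injective r)
    (hP : DefFun 𝒟 P) {R : γ → M → Prop} (hR : DefFun 𝒟 (fun q : γ × M => R q.1 q.2))
    (h : ∀ x, P x → ∃ y, R x y) : ∃ b, ∀ x, P x → ∃ y, y < b ∧ R x y := by
  refine (hb.induction (𝒟 := 𝒟)
    (Φ := fun n => ∃ b, ∀ x, P x → r x < n → ∃ y, y < b ∧ R x y) ?_ ?_ ?_).elim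
    fun n ⟨⟨b, h1⟩, h2⟩ => ⟨b, fun x hx => h1 x hx (h2 x hx)⟩
  · simp only [imp_iff_Imp, forall_iff_All]
    fun_prop
  · exact ⟨czero 𝒟, fun x _ hx => absurd hx (not_lt.2 (CodedOrder.zero_le _))⟩
  · rintro n ⟨b, hb⟩
    by_cases hn : ∃ x, P x ∧ r x = n
    · obtain ⟨a, ha, rfl⟩ := hn
      obtain ⟨y, hy⟩ := h a ha
      refine ⟨max b (csucc 𝒟 y), fun x hx hlt => ?_⟩
      rcases (lt_csucc.1 hlt).lt_or_eq with hlt | heq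
      · obtain ⟨y, h, h'⟩ := hb x hx hlt
        exact ⟨y, h.trans_le (le_max_left _ _), h'⟩
      · obtain rfl := hinj heq
        exact ⟨y, (lt_csucc_self 𝒟 y).trans_le (le_max_right _ _), hy⟩
    · refine ⟨b, fun x hx hlt => ?_⟩
      rcases (lt_csucc.1 hlt).lt_or_eq with hlt | heq
      · exact hb x hx hlt
      · exact absurd ⟨x, hx, heq⟩ hn

/-- Bounded nonempty predicates have greatest elements for all definable linear orders. -/
theorem Bdd.exists_greatest (hb : Bdd r P) (hr : DefFun 𝒟 r) (hinj : Function.Injective r)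
    (hP : DefFun 𝒟 P) {R : γ → γ → Prop} (hR : DefFun 𝒟 (fun q : γ × γ => R q.1 q.2))
    (htrans : ∀ x y z, P x → P y → P z → R x y → R y z → R x z)
    (htot : ∀ x y, P x → P y → R x y ∨ x = y ∨ R y x) (hne : ∃ x, P x) :
    ∃ m, P m ∧ ∀ x, P x → x = m ∨ R x m := by
  -- The part of `P` of rank below `n` is treated by induction on `n`. At most one new element is
  -- compared with the previous maximum at each stage, because `r` is injective.
  refine (hb.induction (𝒟 := 𝒟) (Φ := fun n => (∃ x, P x ∧ r x < n) →
    ∃ m, P m ∧ ∀ x, P x → r x < n → x = m ∨ R x m) ?_ ?_ ?_).elim fun n ⟨h1, h2⟩ => ?_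
  · simp only [imp_iff_Imp, forall_iff_All]
    fun_prop
  · rintro ⟨x, -, hx⟩
    exact absurd hx (not_lt.2 (CodedOrder.zero_le _))
  · rintro n ih ⟨a, ha, hlt⟩
    by_cases hn : ∃ x, P x ∧ r x = n
    · obtain ⟨c, hc, rfl⟩ := hn
      by_cases h0 : ∃ x, P x ∧ r x < r c
      · obtain ⟨m, hm, h⟩ := ih h0
        rcases htot m c hm hc with hmc | rfl | hmc
        · refine ⟨c, hc, fun x hx hlt => ?_⟩
          rcases (lt_csucc.1 hlt).lt_or_eq with hlt | heq
          · rcases h x hx hlt with rfl | hxm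
            · exact .inr hmc
            · exact .inr (htrans x m c hx hm hc hxm hmc)
          · exact .inl (hinj heq)
        · refine ⟨m, hm, fun x hx hlt => ?_⟩
          rcases (lt_csucc.1 hlt).lt_or_eq with hlt | heq
          · exact h x hx hlt
          · exact .inl (hinj heq)
        · refine ⟨m, hm, fun x hx hlt => ?_⟩
          rcases (lt_csucc.1 hlt).lt_or_eq with hlt | heq
          · exact h x hx hlt
          · exact .inr (hinj heq ▸ hmc)
      · refine ⟨c, hc, fun x hx hlt => ?_⟩
        rcases (lt_csucc.1 hlt).lt_or_eq with hlt | heq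
        · exact absurd ⟨x, hx, hlt⟩ h0
        · exact .inl (hinj heq)
    · have key : ∀ x, P x → r x < csucc 𝒟 n → r x < n := fun x hx hlt =>
        (lt_csucc.1 hlt).lt_of_ne fun heq => hn ⟨x, hx, heq⟩
      obtain ⟨m, hm, h⟩ := ih ⟨a, ha, key a ha hlt⟩
      exact ⟨m, hm, fun x hx hlt => h x hx (key x hx hlt)⟩
  · obtain ⟨x, hx⟩ := hne
    obtain ⟨m, hm, h⟩ := h1 ⟨x, hx, h2 x hx⟩
    exact ⟨m, hm, fun x hx => h x hx (h2 x hx)⟩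

end

/-- Definable dependent choice along `M`. -/
theorem exists_recursion [HasConsts 𝒟] {Inv : M → Prop} {Step : M → M → M → Prop} (s₀ : M)
    (hInv : DefFun 𝒟 Inv) (hStep : DefFun 𝒟 (fun q : M × M × M => Step q.1 q.2.1 q.2.2))
    (h0 : Inv s₀) (hs : ∀ n s, Inv s → ∃ s', Inv s' ∧ Step n s s') :
    ∃ R : M → M → Prop, DefFun 𝒟 (fun q : M × M => R q.1 q.2) ∧ (∀ n, ∃ s, R n s) ∧
      (∀ n s, R n s → Inv s) ∧ (∀ n s s', R n s → R n s' → s = s') ∧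
      ∀ n s s', R n s → R (csucc 𝒟 n) s' → Step n s s' := by
  -- Taking the least admissible successor makes the choice definable.
  let T : M → M → M → Prop := fun n s s' =>
    (Inv s' ∧ Step n s s') ∧ ∀ t, Inv t ∧ Step n s t → s' ≤ t
  have hT : DefFun 𝒟 (fun q : M × M × M => T q.1 q.2.1 q.2.2) := by
    simp only [T, imp_iff_Imp, forall_iff_All]
    fun_prop
  -- Attempts are coded sets of pairs in which every pair is the initial one or has a predecessor.
  -- They are not required to be functions: that any two attempts agree follows by induction on `n`.
  let att : M → Prop := fun A => ∀ n s, cmem 𝒟 (cpair 𝒟 n s) A → (n = czero 𝒟 ∧ s = s₀) ∨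
    ∃ m t, n = csucc 𝒟 m ∧ cmem 𝒟 (cpair 𝒟 m t) A ∧ T m t s
  have hatt : DefFun 𝒟 att := by
    simp only [att, imp_iff_Imp, forall_iff_All]
    fun_prop
  let R : M → M → Prop := fun n s => ∃ A, att A ∧ cmem 𝒟 (cpair 𝒟 n s) A
  have hR : DefFun 𝒟 (fun q : M × M => R q.1 q.2) := by
    simp only [R]
    fun_prop
  have huniq : ∀ n, ∀ s s', R n s → R n s' → s = s' := by
    refine CodedOrder.ind (𝒟 := 𝒟) _ ?_ ?_ ?_
    · simp only [imp_iff_Imp, forall_iff_All]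
      fun_prop
    · rintro s s' ⟨A, hA, h⟩ ⟨A', hA', h'⟩
      rcases hA _ _ h with ⟨-, rfl⟩ | ⟨m, t, hm, -⟩
      · rcases hA' _ _ h' with ⟨-, rfl⟩ | ⟨m, t, hm, -⟩
        · rfl
        · exact absurd hm czero_ne_csucc
      · exact absurd hm czero_ne_csucc
    · rintro n ih s s' ⟨A, hA, h⟩ ⟨A', hA', h'⟩
      rcases hA _ _ h with ⟨hm, -⟩ | ⟨m, t, hm, ht, hT⟩
      · exact absurd hm.symm czero_ne_csucc
      rcases hA' _ _ h' with ⟨hm, -⟩ | ⟨m', t', hm', ht', hT'⟩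
      · exact absurd hm.symm czero_ne_csucc
      obtain rfl := csucc_inj hm
      obtain rfl := csucc_inj hm'
      obtain rfl := ih t t' ⟨A, hA, ht⟩ ⟨A', hA', ht'⟩
      exact le_antisymm (hT.2 _ hT'.1) (hT'.2 _ hT.1)
  have hex : ∀ n, ∃ s, R n s ∧ Inv s := by
    refine CodedOrder.ind (𝒟 := 𝒟) _ (by fun_prop) ?_ ?_
    · obtain ⟨A, hA⟩ := (Bdd.eq 𝒟 (fun x : M => x) (cpair 𝒟 (czero 𝒟) s₀)).exists_code (𝒟 := 𝒟)
        (by fun_prop) (fun _ _ h => h) (by fun_prop)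
      refine ⟨s₀, ⟨A, ?_, (hA _).2 rfl⟩, h0⟩
      intro n s h
      exact .inl (CodedOrder.pair_inj _ _ _ _ ((hA _).1 h))
    · rintro n ⟨s, ⟨A, hA, h⟩, hInvs⟩
      obtain ⟨s', hs', hmin⟩ := CodedOrder.least (𝒟 := 𝒟) (fun s' => Inv s' ∧ Step n s s')
        (by fun_prop) (hs n s hInvs)
      obtain ⟨A', hA'⟩ := ((Bdd.of_cmem (𝒟 := 𝒟) (fun x : M => x) A).or
        (Bdd.eq 𝒟 (fun x : M => x) (cpair 𝒟 (csucc 𝒟 n) s'))).exists_code (𝒟 := 𝒟)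
        (by fun_prop) (fun _ _ h => h) (by fun_prop)
      refine ⟨s', ⟨A', ?_, (hA' _).2 (.inr rfl)⟩, hs'.1⟩
      intro m t hmt
      rcases (hA' _).1 hmt with hmt | hmt
      · rcases hA _ _ hmt with h | ⟨m', t', h1, h2, h3⟩
        · exact .inl h
        · exact .inr ⟨m', t', h1, (hA' _).2 (.inl h2), h3⟩
      · obtain ⟨h1, h2⟩ := CodedOrder.pair_inj _ _ _ _ hmt
        exact .inr ⟨n, s, h1, (hA' _).2 (.inl h), h2 ▸ ⟨hs', hmin⟩⟩
  refine ⟨R, hR, fun n => (hex n).imp fun _ h => h.1, ?_, huniq, ?_⟩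
  · intro n s h
    obtain ⟨s', h', hs'⟩ := hex n
    exact huniq n s' s h' h ▸ hs'
  · rintro n s s' h ⟨A, hA, h'⟩
    rcases hA _ _ h' with ⟨hm, -⟩ | ⟨m, t, hm, ht, hT⟩
    · exact absurd hm.symm czero_ne_csucc
    obtain rfl := csucc_inj hm
    obtain rfl := huniq _ _ _ h ⟨A, hA, ht⟩
    exact hT.1.2

end

/-! ### Internal categoricity: back-and-forth and bisimulations -/

/-- Interpretations of the symbols `∈`, `A`, `<`. -/
structure HFStr (H : Type u) where
  mem : H → H → Prop
  atom : H → Prop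
  lt : H → H → Prop

/-- A relation is the graph of an isomorphism. -/
structure HFStr.IsIso {H : Type u} {K : Type v} (A : HFStr H) (B : HFStr K) (e : H → K → Prop) :
    Prop where
  total : ∀ x, ∃ y, e x y
  surj : ∀ y, ∃ x, e x y
  eq_iff : ∀ x y x' y', e x y → e x' y' → (x = x' ↔ y = y')
  mem_iff : ∀ x y x' y', e x y → e x' y' → (A.mem x x' ↔ B.mem y y')
  atom_iff : ∀ x y, e x y → (A.atom x ↔ B.atom y)
  lt_iff : ∀ x y x' y', e x y → e x' y' → (A.lt x x' ↔ B.lt y y')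

/-- Dense linear orders of the atoms, without endpoints. -/
structure HFStr.IsDLO {H : Type u} (A : HFStr H) : Prop where
  lt_atom : ∀ x y, A.lt x y → A.atom x ∧ A.atom y
  exists_atom : ∃ x, A.atom x
  irrefl : ∀ x, A.atom x → ¬ A.lt x x
  trans : ∀ x y z, A.atom x → A.atom y → A.atom z → A.lt x y → A.lt y z → A.lt x z
  tot : ∀ x y, A.atom x → A.atom y → A.lt x y ∨ x = y ∨ A.lt y x
  dense : ∀ x y, A.atom x → A.atom y → A.lt x y → ∃ z, A.atom z ∧ A.lt x z ∧ A.lt z y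
  noMax : ∀ x, A.atom x → ∃ y, A.atom y ∧ A.lt x y
  noMin : ∀ x, A.atom x → ∃ y, A.atom y ∧ A.lt y x

/-- Structures whose sets are exactly the bounded definable sets of their elements. -/
structure FinSets {M : Type u} (𝒟 : DefSystem M) [LinearOrder M] {H : Type v} [Srt 𝒟 H]
    (A : HFStr H) (r : H → M) : Prop extends A.IsDLO where
  rank_def : DefFun 𝒟 r
  rank_inj : Function.Injective r
  mem_def : DefFun 𝒟 (fun q : H × H => A.mem q.1 q.2)
  atom_def : DefFun 𝒟 A.atom
  lt_def : DefFun 𝒟 (fun q : H × H => A.lt q.1 q.2)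
  ind : ∀ P : H → Prop, DefFun 𝒟 P → (∀ x, (∀ y, A.mem y x → P y) → P x) → ∀ x, P x
  ext : ∀ x y, ¬ A.atom x → ¬ A.atom y → (∀ z, A.mem z x ↔ A.mem z y) → x = y
  atom_empty : ∀ x y, A.atom x → ¬ A.mem y x
  bdd : ∀ x, Bdd r (fun y => A.mem y x)
  comp : ∀ P : H → Prop, DefFun 𝒟 P → Bdd r P → ∃ s, ¬ A.atom s ∧ ∀ y, A.mem y s ↔ P y

section

variable {M : Type u} {𝒟 : DefSystem M} [LinearOrder M] [CodedOrder 𝒟] [HasConsts 𝒟]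
  {H : Type v} {K : Type w} [Srt 𝒟 H] [Srt 𝒟 K] {A : HFStr H} {B : HFStr K} {r : H → M} {t : K → M}

theorem HFStr.IsDLO.asymm (hA : A.IsDLO) {x y : H} (h : A.lt x y) : ¬ A.lt y x := fun h' =>
  have hx := hA.lt_atom _ _ h
  hA.irrefl x hx.1 (hA.trans x y x hx.1 hx.2 hx.1 h h')

/-- Partial isomorphisms of the orders of the atoms. -/
def PIso (A : HFStr H) (B : HFStr K) (p : H → K → Prop) : Prop :=
  ∀ x y x' y', p x y → p x' y' → A.atom x ∧ B.atom y ∧ (A.lt x x' ↔ B.lt y y') ∧ (x = x' ↔ y = y')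

theorem PIso.flip {p : H → K → Prop} (h : PIso A B p) : PIso B A (flip p) := fun x y x' y' h1 h2 =>
  have := h y x y' x' h1 h2
  ⟨this.2.1, this.1, this.2.2.1.symm, this.2.2.2.symm⟩

namespace FinSets

/-- Bounded definable sets behave as finite sets: if nonempty, `L` has a greatest and `U` a least
element. Density or the absence of endpoints then gives the point, as in Cantor's theorem. -/
theorem exists_between (hB : FinSets 𝒟 B t) {L U : K → Prop} (hL : DefFun 𝒟 L) (hU : DefFun 𝒟 U)
    (hbL : Bdd t L) (hbU : Bdd t U) (hLa : ∀ x, L x → B.atom x) (hUa : ∀ x, U x → B.atom x)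
    (hLU : ∀ x y, L x → U y → B.lt x y) :
    ∃ b, B.atom b ∧ (∀ x, L x → B.lt x b) ∧ ∀ x, U x → B.lt b x := by
  have hlt := hB.lt_def
  have hL' : (∃ x, L x) → ∃ m, L m ∧ ∀ x, L x → x = m ∨ B.lt x m :=
    hbL.exists_greatest hB.rank_def hB.rank_inj hL hB.lt_def
      (fun x y z hx hy hz => hB.trans x y z (hLa x hx) (hLa y hy) (hLa z hz))
      (fun x y hx hy => hB.tot x y (hLa x hx) (hLa y hy))
  have hU' : (∃ x, U x) → ∃ m, U m ∧ ∀ x, U x → x = m ∨ B.lt m x :=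
    hbU.exists_greatest (R := fun x y => B.lt y x) hB.rank_def hB.rank_inj hU (by fun_prop)
      (fun x y z hx hy hz h h' => hB.trans z y x (hUa z hz) (hUa y hy) (hUa x hx) h' h)
      (fun x y hx hy => (hB.tot y x (hUa y hy) (hUa x hx)).imp_right (.imp_left Eq.symm))
  have below : ∀ m b, L m → B.atom b → (∀ x, L x → x = m ∨ B.lt x m) → B.lt m b →
      ∀ x, L x → B.lt x b := by
    intro m b hm hb h hmb x hx
    rcases h x hx with rfl | h
    · exact hmb
    · exact hB.trans x m b (hLa x hx) (hLa m hm) hb h hmb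
  have above : ∀ m b, U m → B.atom b → (∀ x, U x → x = m ∨ B.lt m x) → B.lt b m →
      ∀ x, U x → B.lt b x := by
    intro m b hm hb h hmb x hx
    rcases h x hx with rfl | h
    · exact hmb
    · exact hB.trans b m x hb (hUa m hm) (hUa x hx) hmb h
  by_cases h1 : ∃ x, L x <;> by_cases h2 : ∃ x, U x
  · obtain ⟨m, hm, hm'⟩ := hL' h1
    obtain ⟨n, hn, hn'⟩ := hU' h2
    obtain ⟨b, hb, hmb, hbn⟩ := hB.dense m n (hLa m hm) (hUa n hn) (hLU m n hm hn)
    exact ⟨b, hb, below m b hm hb hm' hmb, above n b hn hb hn' hbn⟩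
  · obtain ⟨m, hm, hm'⟩ := hL' h1
    obtain ⟨b, hb, hmb⟩ := hB.noMax m (hLa m hm)
    exact ⟨b, hb, below m b hm hb hm' hmb, fun x hx => absurd ⟨x, hx⟩ h2⟩
  · obtain ⟨n, hn, hn'⟩ := hU' h2
    obtain ⟨b, hb, hbn⟩ := hB.noMin n (hUa n hn)
    exact ⟨b, hb, fun x hx => absurd ⟨x, hx⟩ h1, above n b hn hb hn' hbn⟩
  · obtain ⟨b, hb⟩ := hB.exists_atom
    exact ⟨b, hb, fun x hx => absurd ⟨x, hx⟩ h1, fun x hx => absurd ⟨x, hx⟩ h2⟩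

/-- The step "forth". The images of the points below `a` and of those above `a` are bounded
definable sets, and any atom between them can be the image of `a`. The step "back" is the same lemma
for the inverse relation. -/
theorem exists_extension (hA : FinSets 𝒟 A r) (hB : FinSets 𝒟 B t) {p : H → K → Prop}
    (hp : DefFun 𝒟 (fun q : H × K => p q.1 q.2)) (hb : Bdd t (fun y => ∃ x, p x y))
    (hiso : PIso A B p) {a : H} (ha : A.atom a) :
    ∃ b, PIso A B (fun x y => p x y ∨ (x = a ∧ y = b)) := by
  by_cases hdom : ∃ b, p a b
  · obtain ⟨b, hab⟩ := hdom
    refine ⟨b, ?_⟩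
    rintro x y x' y' (h | ⟨rfl, rfl⟩) (h' | ⟨rfl, rfl⟩)
    exacts [hiso _ _ _ _ h h', hiso _ _ _ _ h hab, hiso _ _ _ _ hab h', hiso _ _ _ _ hab hab]
  have hlt := hA.lt_def
  obtain ⟨b, hb, hbL, hbU⟩ := hB.exists_between (L := fun y => ∃ x, p x y ∧ A.lt x a)
    (U := fun y => ∃ x, p x y ∧ A.lt a x) (by fun_prop) (by fun_prop)
    (hb.mono fun y ⟨x, h, _⟩ => ⟨x, h⟩) (hb.mono fun y ⟨x, h, _⟩ => ⟨x, h⟩)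
    (fun y ⟨x, h, _⟩ => (hiso _ _ _ _ h h).2.1) (fun y ⟨x, h, _⟩ => (hiso _ _ _ _ h h).2.1)
    (fun y y' ⟨x, h, hx⟩ ⟨x', h', hx'⟩ => (hiso _ _ _ _ h h').2.2.1.1
      (hA.trans x a x' (hiso _ _ _ _ h h).1 ha (hiso _ _ _ _ h' h').1 hx hx'))
  have key : ∀ x y, p x y → A.atom x ∧ B.atom y ∧ (A.lt x a ↔ B.lt y b) ∧ (A.lt a x ↔ B.lt b y) ∧
      x ≠ a ∧ y ≠ b := by
    intro x y h
    obtain ⟨hx, hy, -⟩ := hiso _ _ _ _ h h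
    have hne : x ≠ a := by rintro rfl; exact hdom ⟨y, h⟩
    refine ⟨hx, hy, ?_⟩
    rcases hA.tot x a hx ha with hlt | heq | hlt
    · have hyb := hbL y ⟨x, h, hlt⟩
      refine ⟨iff_of_true hlt hyb, iff_of_false (hA.asymm hlt) (hB.asymm hyb), hne, ?_⟩
      rintro rfl
      exact hB.irrefl y hy hyb
    · exact absurd heq hne
    · have hyb := hbU y ⟨x, h, hlt⟩
      refine ⟨iff_of_false (hA.asymm hlt) (hB.asymm hyb), iff_of_true hlt hyb, hne, ?_⟩
      rintro rfl
      exact hB.irrefl y hy hyb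
  refine ⟨b, ?_⟩
  rintro x y x' y' (h | ⟨rfl, rfl⟩) (h' | ⟨rfl, rfl⟩)
  · exact hiso _ _ _ _ h h'
  · obtain ⟨hx, hy, h1, h2, h3, h4⟩ := key x y h
    exact ⟨hx, hy, h1, iff_of_false h3 h4⟩
  · obtain ⟨hx, hy, h1, h2, h3, h4⟩ := key x' y' h'
    exact ⟨ha, hb, h2, iff_of_false h3.symm h4.symm⟩
  · exact ⟨ha, hb, iff_of_false (hA.irrefl _ ha) (hB.irrefl _ hb), iff_of_true rfl rfl⟩

end FinSets

variable (𝒟) in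
/-- The binary relation with a given code. -/
def crel (r : H → M) (t : K → M) (s : M) (x : H) (y : K) : Prop := cmem 𝒟 (cpair 𝒟 (r x) (t y)) s

theorem crel.bdd_left (s : M) : Bdd r (fun x => ∃ y, crel 𝒟 r t s x y) :=
  ⟨s, fun _ ⟨_, h⟩ => (CodedOrder.le_pair _ _).1.trans_lt (CodedOrder.mem_lt _ _ h)⟩

theorem crel.bdd_right (s : M) : Bdd t (fun y => ∃ x, crel 𝒟 r t s x y) :=
  ⟨s, fun _ ⟨_, h⟩ => (CodedOrder.le_pair _ _).2.trans_lt (CodedOrder.mem_lt _ _ h)⟩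

namespace FinSets

theorem exists_crel (hA : FinSets 𝒟 A r) (hB : FinSets 𝒟 B t) {p : H → K → Prop}
    (hp : DefFun 𝒟 (fun q : H × K => p q.1 q.2)) (h1 : Bdd r (fun x => ∃ y, p x y))
    (h2 : Bdd t (fun y => ∃ x, p x y)) : ∃ s, crel 𝒟 r t s = p := by
  obtain ⟨s, hs⟩ := h1.exists_code₂ h2 hA.rank_def hA.rank_inj hB.rank_def hB.rank_inj hp
  exact ⟨s, funext₂ fun x y => propext (hs x y)⟩

theorem crel_def (hA : FinSets 𝒟 A r) (hB : FinSets 𝒟 B t) :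
    DefFun 𝒟 (fun q : M × H × K => crel 𝒟 r t q.1 q.2.1 q.2.2) := by
  have h1 := hA.rank_def
  have h2 := hB.rank_def
  unfold crel
  fun_prop

theorem exists_crel_insert (hA : FinSets 𝒟 A r) (hB : FinSets 𝒟 B t) (s : M) (a : H) (b : K) :
    ∃ s', crel 𝒟 r t s' = fun x y => crel 𝒟 r t s x y ∨ (x = a ∧ y = b) := by
  have h := crel_def hA hB
  refine hA.exists_crel hB (by fun_prop) ?_ ?_
  · exact ((crel.bdd_left (𝒟 := 𝒟) (r := r) (t := t) s).or (Bdd.eq 𝒟 r a)).mono fun x ⟨y, hxy⟩ =>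
      hxy.imp (fun h => ⟨y, h⟩) And.left
  · exact ((crel.bdd_right (𝒟 := 𝒟) (r := r) (t := t) s).or (Bdd.eq 𝒟 t b)).mono fun y ⟨x, hxy⟩ =>
      hxy.imp (fun h => ⟨x, h⟩) And.right

theorem exists_extension_left (hA : FinSets 𝒟 A r) (hB : FinSets 𝒟 B t) (n s : M)
    (hs : PIso A B (crel 𝒟 r t s)) : ∃ s', PIso A B (crel 𝒟 r t s') ∧
      (∀ x y, crel 𝒟 r t s x y → crel 𝒟 r t s' x y) ∧
      ∀ x, A.atom x → r x = n → ∃ y, crel 𝒟 r t s' x y := by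
  by_cases h : ∃ a, A.atom a ∧ r a = n
  · obtain ⟨a, ha, rfl⟩ := h
    have := crel_def hA hB
    obtain ⟨b, hb⟩ := hA.exists_extension hB (by fun_prop) (crel.bdd_right s) hs ha
    obtain ⟨s', hs'⟩ := hA.exists_crel_insert hB s a b
    refine ⟨s', hs' ▸ hb, fun x y h => ?_, fun x hx hr => ⟨b, ?_⟩⟩
    · rw [hs']; exact .inl h
    · rw [hs']; exact .inr ⟨hA.rank_inj hr, rfl⟩
  · exact ⟨s, hs, fun _ _ h => h, fun x hx hr => absurd ⟨x, hx, hr⟩ h⟩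

theorem exists_extension_right (hA : FinSets 𝒟 A r) (hB : FinSets 𝒟 B t) (n s : M)
    (hs : PIso A B (crel 𝒟 r t s)) : ∃ s', PIso A B (crel 𝒟 r t s') ∧
      (∀ x y, crel 𝒟 r t s x y → crel 𝒟 r t s' x y) ∧
      ∀ y, B.atom y → t y = n → ∃ x, crel 𝒟 r t s' x y := by
  by_cases h : ∃ b, B.atom b ∧ t b = n
  · obtain ⟨b, hb, rfl⟩ := h
    have := crel_def hA hB
    obtain ⟨a, ha⟩ := hB.exists_extension hA (p := flip (crel 𝒟 r t s))
      (by unfold flip; fun_prop) (crel.bdd_left s) hs.flip hb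
    obtain ⟨s', hs'⟩ := hA.exists_crel_insert hB s a b
    refine ⟨s', ?_, fun x y h => ?_, fun y hy ht => ⟨a, ?_⟩⟩
    · rw [hs']
      intro x y x' y' h h'
      exact ha.flip x y x' y' (h.imp_right And.symm) (h'.imp_right And.symm)
    · rw [hs']; exact .inl h
    · rw [hs']; exact .inr ⟨rfl, hB.rank_inj ht⟩
  · exact ⟨s, hs, fun _ _ h => h, fun y hy ht => absurd ⟨y, hy, ht⟩ h⟩

/-- The back-and-forth construction. -/
theorem exists_atom_iso (hA : FinSets 𝒟 A r) (hB : FinSets 𝒟 B t) :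
    ∃ g : H → K → Prop, DefFun 𝒟 (fun q : H × K => g q.1 q.2) ∧ PIso A B g ∧
      (∀ x, A.atom x → ∃ y, g x y) ∧ ∀ y, B.atom y → ∃ x, g x y := by
  have hc := crel_def hA hB
  have hrA := hA.rank_def
  have haA := hA.atom_def
  have hlA := hA.lt_def
  have hrB := hB.rank_def
  have haB := hB.atom_def
  have hlB := hB.lt_def
  obtain ⟨s₀, hs₀⟩ := hA.exists_crel hB (p := fun _ _ => False) (by fun_prop)
    ⟨czero 𝒟, fun _ ⟨_, h⟩ => h.elim⟩ ⟨czero 𝒟, fun _ ⟨_, h⟩ => h.elim⟩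
  -- The states are codes of partial isomorphisms. Passing from stage `n` to the next treats the
  -- atoms of rank `n`, at most one on each side since ranks are injective.
  obtain ⟨R, hR, hex, hInv, huniq, hstep⟩ := exists_recursion (𝒟 := 𝒟)
    (Inv := fun s => PIso A B (crel 𝒟 r t s))
    (Step := fun n s s' => (∀ x y, crel 𝒟 r t s x y → crel 𝒟 r t s' x y) ∧
      (∀ x, A.atom x → r x = n → ∃ y, crel 𝒟 r t s' x y) ∧
      ∀ y, B.atom y → t y = n → ∃ x, crel 𝒟 r t s' x y) s₀
    (by
      simp only [PIso, imp_iff_Imp, forall_iff_All]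
      fun_prop)
    (by
      simp only [imp_iff_Imp, forall_iff_All]
      fun_prop)
    (by rw [hs₀]; exact fun _ _ _ _ h => h.elim)
    (by
      intro n s hs
      obtain ⟨s', hs', h1, h2⟩ := hA.exists_extension_left hB n s hs
      obtain ⟨s'', hs'', h3, h4⟩ := hA.exists_extension_right hB n s' hs'
      exact ⟨s'', hs'', fun x y h => h3 x y (h1 x y h), fun x hx hr =>
        (h2 x hx hr).imp fun y h => h3 x y h, h4⟩)
  have hmono : ∀ m, ∀ n s s', n ≤ m → R n s → R m s' →
      ∀ x y, crel 𝒟 r t s x y → crel 𝒟 r t s' x y := by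
    refine CodedOrder.ind (𝒟 := 𝒟) _ ?_ ?_ ?_
    · simp only [imp_iff_Imp, forall_iff_All]
      fun_prop
    · intro n s s' hn h h'
      obtain rfl := le_antisymm hn (CodedOrder.zero_le n)
      obtain rfl := huniq _ _ _ h h'
      exact fun _ _ h => h
    · intro m ih n s s' hn h h' x y hxy
      rcases hn.lt_or_eq with hn | rfl
      · obtain ⟨s₁, hs₁⟩ := hex m
        exact (hstep _ _ _ hs₁ h').1 x y (ih n s s₁ (lt_csucc.1 hn) h hs₁ x y hxy)
      · obtain rfl := huniq _ _ _ h h'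
        exact hxy
  refine ⟨fun x y => ∃ n s, R n s ∧ crel 𝒟 r t s x y, by fun_prop, ?_, ?_, ?_⟩
  · rintro x y x' y' ⟨n, s, h, hxy⟩ ⟨n', s', h', hxy'⟩
    rcases le_total n n' with hn | hn
    · exact hInv _ _ h' _ _ _ _ (hmono _ _ _ _ hn h h' _ _ hxy) hxy'
    · exact hInv _ _ h _ _ _ _ hxy (hmono _ _ _ _ hn h' h _ _ hxy')
  · intro x hx
    obtain ⟨s, hs⟩ := hex (r x)
    obtain ⟨s', hs'⟩ := hex (csucc 𝒟 (r x))
    obtain ⟨y, hy⟩ := (hstep _ _ _ hs hs').2.1 x hx rfl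
    exact ⟨y, _, s', hs', hy⟩
  · intro y hy
    obtain ⟨s, hs⟩ := hex (t y)
    obtain ⟨s', hs'⟩ := hex (csucc 𝒟 (t y))
    obtain ⟨x, hx⟩ := (hstep _ _ _ hs hs').2.2 y hy rfl
    exact ⟨x, _, s', hs', hx⟩

end FinSets

/-- Bisimulations that extend a given relation between the atoms. -/
def Bisim (A : HFStr H) (B : HFStr K) (g e : H → K → Prop) : Prop :=
  ∀ x y, e x y → (A.atom x ∧ B.atom y ∧ g x y) ∨ (¬ A.atom x ∧ ¬ B.atom y ∧
    (∀ x', A.mem x' x → ∃ y', B.mem y' y ∧ e x' y') ∧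
    ∀ y', B.mem y' y → ∃ x', A.mem x' x ∧ e x' y')

variable (𝒟) in
/-- A code of a bisimulation. -/
def CodesBisim (A : HFStr H) (B : HFStr K) (g : H → K → Prop) (r : H → M) (t : K → M) (s : M) : Prop :=
  Bisim A B g (crel 𝒟 r t s)

theorem Bisim.flip {g e : H → K → Prop} (h : Bisim A B g e) : Bisim B A (flip g) (flip e) :=
  fun x y hxy => (h y x hxy).imp (fun ⟨h1, h2, h3⟩ => ⟨h2, h1, h3⟩)
    fun ⟨h1, h2, h3, h4⟩ => ⟨h2, h1, h4, h3⟩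

namespace FinSets

/-- By `∈`-induction in `A`. Each element of one partner of `x` is matched with an element of the
other through a common element of `x`; by the induction hypothesis the two coincide, and
extensionality in `B` concludes. -/
theorem bisim_unique (hA : FinSets 𝒟 A r) (hB : FinSets 𝒟 B t) {g e : H → K → Prop}
    (hg : PIso A B g) (he : DefFun 𝒟 (fun q : H × K => e q.1 q.2)) (h : Bisim A B g e) :
    ∀ x y y', e x y → e x y' → y = y' := by
  refine hA.ind _ ?_ ?_
  · simp only [imp_iff_Imp, forall_iff_All]
    fun_prop
  · intro x ih y y' hy hy'
    rcases h x y hy with ⟨hx, -, hxy⟩ | ⟨hx, hys, h1, h2⟩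
    · rcases h x y' hy' with ⟨-, -, hxy'⟩ | ⟨hx', -⟩
      · exact (hg _ _ _ _ hxy hxy').2.2.2.1 rfl
      · exact absurd hx hx'
    · rcases h x y' hy' with ⟨hx', -⟩ | ⟨-, hys', h1', h2'⟩
      · exact absurd hx' hx
      · refine hB.ext y y' hys hys' fun z => ⟨fun hz => ?_, fun hz => ?_⟩
        · obtain ⟨u, hu, huz⟩ := h2 z hz
          obtain ⟨z', hz', huz'⟩ := h1' u hu
          exact ih u hu z z' huz huz' ▸ hz'
        · obtain ⟨u, hu, huz⟩ := h2' z hz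
          obtain ⟨z', hz', huz'⟩ := h1 u hu
          exact ih u hu z z' huz huz' ▸ hz'

/-- By `∈`-induction. Collection puts codes of bisimulations that cover the elements of a set `x`
below a common `b`. The union of all bisimulations with codes below `b` is again a bisimulation and
has a code, so no selection is needed. The partner of `x` is the set of the partners of its
elements. -/
theorem exists_bisim (hA : FinSets 𝒟 A r) (hB : FinSets 𝒟 B t) {g : H → K → Prop}
    (hg : PIso A B g) (hgd : DefFun 𝒟 (fun q : H × K => g q.1 q.2))
    (htot : ∀ x, A.atom x → ∃ y, g x y) :
    ∀ x, ∃ s y, CodesBisim 𝒟 A B g r t s ∧ crel 𝒟 r t s x y := by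
  have hc := crel_def hA hB
  have haA := hA.atom_def
  have hmA := hA.mem_def
  have haB := hB.atom_def
  have hmB := hB.mem_def
  have hbis : DefFun 𝒟 (fun s => CodesBisim 𝒟 A B g r t s) := by
    simp only [CodesBisim, Bisim, imp_iff_Imp, forall_iff_All]
    fun_prop
  refine hA.ind _ (by fun_prop) fun x ih => ?_
  by_cases hx : A.atom x
  · obtain ⟨y, hy⟩ := htot x hx
    obtain ⟨s, hs⟩ := hA.exists_crel hB (p := fun u v => u = x ∧ v = y) (by fun_prop)
      ((Bdd.eq 𝒟 r x).mono fun _ ⟨_, h⟩ => h.1) ((Bdd.eq 𝒟 t y).mono fun _ ⟨_, h⟩ => h.2)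
    refine ⟨s, y, ?_, ?_⟩
    · rw [CodesBisim, hs]
      rintro u v ⟨rfl, rfl⟩
      exact .inl ⟨hx, (hg _ _ _ _ hy hy).2.1, hy⟩
    · rw [hs]; exact ⟨rfl, rfl⟩
  · obtain ⟨b, hb⟩ := (hA.bdd x).collection hA.rank_def hA.rank_inj (by fun_prop)
      (R := fun u s => ∃ y, CodesBisim 𝒟 A B g r t s ∧ crel 𝒟 r t s u y) (by fun_prop) ih
    let e₀ : H → K → Prop := fun u v => ∃ s, s < b ∧ CodesBisim 𝒟 A B g r t s ∧ crel 𝒟 r t s u v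
    have he₀ : DefFun 𝒟 (fun q : H × K => e₀ q.1 q.2) := by
      simp only [e₀]
      fun_prop
    have hl : Bdd r (fun x => ∃ y, e₀ x y) :=
      ⟨b, fun _ ⟨_, s, hs, _, h⟩ =>
        ((CodedOrder.le_pair _ _).1.trans_lt (CodedOrder.mem_lt _ _ h)).trans hs⟩
    have hr : Bdd t (fun y => ∃ x, e₀ x y) :=
      ⟨b, fun _ ⟨_, s, hs, _, h⟩ =>
        ((CodedOrder.le_pair _ _).2.trans_lt (CodedOrder.mem_lt _ _ h)).trans hs⟩
    have hbis₀ : Bisim A B g e₀ := by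
      rintro u v ⟨s, hs, hbis, h⟩
      refine (hbis u v h).imp id ?_
      rintro ⟨h1, h2, h3, h4⟩
      refine ⟨h1, h2, fun u' hu' => ?_, fun v' hv' => ?_⟩
      · obtain ⟨v', hv', h⟩ := h3 u' hu'
        exact ⟨v', hv', s, hs, hbis, h⟩
      · obtain ⟨u', hu', h⟩ := h4 v' hv'
        exact ⟨u', hu', s, hs, hbis, h⟩
    obtain ⟨y, hy, hmem⟩ := hB.comp (fun v => ∃ u, A.mem u x ∧ e₀ u v) (by fun_prop)
      (hr.mono fun v ⟨u, _, h⟩ => ⟨u, h⟩)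
    obtain ⟨s, hs⟩ := hA.exists_crel hB (p := fun u v => e₀ u v ∨ (u = x ∧ v = y)) (by fun_prop)
      ((hl.or (Bdd.eq 𝒟 r x)).mono fun u ⟨v, h⟩ => h.imp (fun h => ⟨v, h⟩) And.left)
      ((hr.or (Bdd.eq 𝒟 t y)).mono fun v ⟨u, h⟩ => h.imp (fun h => ⟨u, h⟩) And.right)
    refine ⟨s, y, ?_, ?_⟩
    · rw [CodesBisim, hs]
      rintro u v (h | ⟨rfl, rfl⟩)
      · refine (hbis₀ u v h).imp id ?_
        rintro ⟨h1, h2, h3, h4⟩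
        exact ⟨h1, h2, fun u' hu' => (h3 u' hu').imp fun v' h => h.imp_right .inl,
          fun v' hv' => (h4 v' hv').imp fun u' h => h.imp_right .inl⟩
      · refine .inr ⟨hx, hy, fun u' hu' => ?_, fun v' hv' => ?_⟩
        · obtain ⟨s', hs', v', h1, h2⟩ := hb u' hu'
          have : e₀ u' v' := ⟨s', hs', h1, h2⟩
          exact ⟨v', (hmem v').2 ⟨u', hu', this⟩, .inl this⟩
        · obtain ⟨u', hu', h⟩ := (hmem v').1 hv'
          exact ⟨u', hu', .inl h⟩
    · rw [hs]; exact .inr ⟨rfl, rfl⟩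

/-- Internal categoricity. -/
theorem exists_iso (hA : FinSets 𝒟 A r) (hB : FinSets 𝒟 B t) :
    ∃ e : H → K → Prop, DefFun 𝒟 (fun q : H × K => e q.1 q.2) ∧ A.IsIso B e := by
  have hc := crel_def hA hB
  have haA := hA.atom_def
  have hmA := hA.mem_def
  have haB := hB.atom_def
  have hmB := hB.mem_def
  obtain ⟨g, hgd, hg, htot, hsurj⟩ := hA.exists_atom_iso hB
  -- A union of bisimulations is a bisimulation, so `bisim_unique`, applied to `e` and to its
  -- inverse, makes `e` single-valued and injective.
  let e : H → K → Prop := fun x y => ∃ s, CodesBisim 𝒟 A B g r t s ∧ crel 𝒟 r t s x y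
  have hbis : DefFun 𝒟 (fun s => CodesBisim 𝒟 A B g r t s) := by
    simp only [CodesBisim, Bisim, imp_iff_Imp, forall_iff_All]
    fun_prop
  have he : DefFun 𝒟 (fun q : H × K => e q.1 q.2) := by
    simp only [e]
    fun_prop
  have hb : Bisim A B g e := by
    rintro u v ⟨s, hbis, h⟩
    refine (hbis u v h).imp id ?_
    rintro ⟨h1, h2, h3, h4⟩
    refine ⟨h1, h2, fun u' hu' => ?_, fun v' hv' => ?_⟩
    · obtain ⟨v', hv', h⟩ := h3 u' hu'
      exact ⟨v', hv', s, hbis, h⟩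
    · obtain ⟨u', hu', h⟩ := h4 v' hv'
      exact ⟨u', hu', s, hbis, h⟩
  have hun := hA.bisim_unique hB hg he hb
  have hun' := hB.bisim_unique hA hg.flip (e := flip e) (by unfold flip; fun_prop) hb.flip
  have hat : ∀ x y, e x y → (A.atom x ↔ B.atom y) := fun x y h => by
    rcases hb x y h with ⟨h1, h2, -⟩ | ⟨h1, h2, -⟩
    · exact iff_of_true h1 h2
    · exact iff_of_false h1 h2
  have hge : ∀ x y, e x y → A.atom x → g x y := fun x y h hx => by
    rcases hb x y h with ⟨-, -, h⟩ | ⟨h1, -⟩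
    · exact h
    · exact absurd hx h1
  refine ⟨e, he, ?_, ?_, ?_, ?_, hat, ?_⟩
  · intro x
    obtain ⟨s, y, h⟩ := hA.exists_bisim hB hg hgd htot x
    exact ⟨y, s, h⟩
  · intro y
    -- Surjectivity is totality for the inverse of `g`. The bisimulation that this yields is recoded
    -- with its sides exchanged.
    obtain ⟨s, x, h1, h2⟩ := hB.exists_bisim hA hg.flip (by unfold flip; fun_prop) hsurj y
    have hc' := crel_def hB hA
    obtain ⟨s', hs'⟩ := hA.exists_crel hB (p := flip (crel 𝒟 t r s)) (by unfold flip; fun_prop)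
      (crel.bdd_right s) (crel.bdd_left s)
    exact ⟨x, s', by rw [CodesBisim, hs']; exact Bisim.flip h1, hs' ▸ h2⟩
  · intro x y x' y' h h'
    constructor
    · rintro rfl
      exact hun x y y' h h'
    · rintro rfl
      exact hun' y x x' h h'
  · intro x y x' y' h h'
    constructor
    · intro hm
      rcases hb x' y' h' with ⟨hx', -⟩ | ⟨-, -, h1, -⟩
      · exact absurd hm (hA.atom_empty _ _ hx')
      · obtain ⟨z, hz, hxz⟩ := h1 x hm
        exact hun x z y hxz h ▸ hz
    · intro hm
      rcases hb x' y' h' with ⟨-, hy', -⟩ | ⟨-, -, -, h1⟩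
      · exact absurd hm (hB.atom_empty _ _ hy')
      · obtain ⟨z, hz, hzy⟩ := h1 y hm
        exact hun' y z x hzy h ▸ hz
  · intro x y x' y' h h'
    constructor
    · intro hlt
      obtain ⟨h1, h2⟩ := hA.lt_atom _ _ hlt
      exact (hg _ _ _ _ (hge _ _ h h1) (hge _ _ h' h2)).2.2.1.1 hlt
    · intro hlt
      obtain ⟨h1, h2⟩ := hB.lt_atom _ _ hlt
      exact (hg _ _ _ _ (hge _ _ h ((hat _ _ h).2 h1)) (hge _ _ h' ((hat _ _ h').2 h2))).2.2.1.2 hlt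

end FinSets

end

/-! ### The ordered semiring of a model of arithmetic -/

namespace Arith

variable {M : Type u} [arith.Structure M]

/-- The interpretation of `0`. -/
def azero : M := Structure.funMap zeroSym ![]

/-- The interpretation of the successor function. -/
def asucc (x : M) : M := Structure.funMap succSym ![x]

/-- The interpretation of addition. -/
def aadd (x y : M) : M := Structure.funMap addSym ![x, y]

/-- The interpretation of multiplication. -/
def amul (x y : M) : M := Structure.funMap mulSym ![x, y]

/-- The axioms on successor, addition and multiplication, with induction for definable sets. -/
structure Induction (𝒟 : DefSystem M) : Prop where
  zero_def : DefFun 𝒟 (fun x : M => x = azero)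
  succ_def : DefFun 𝒟 (asucc : M → M)
  add_def : DefFun 𝒟 (fun q : M × M => aadd q.1 q.2)
  mul_def : DefFun 𝒟 (fun q : M × M => amul q.1 q.2)
  succ_ne : ∀ x : M, asucc x ≠ azero
  succ_inj : ∀ x y : M, asucc x = asucc y → x = y
  add_zero : ∀ x : M, aadd x azero = x
  add_succ : ∀ x y : M, aadd x (asucc y) = asucc (aadd x y)
  mul_zero : ∀ x : M, amul x azero = azero
  mul_succ : ∀ x y : M, amul x (asucc y) = aadd (amul x y) x
  ind : ∀ P : M → Prop, DefFun 𝒟 P → P azero → (∀ x, P x → P (asucc x)) → ∀ x, P x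

namespace Induction

variable {𝒟 : DefSystem M} [HasConsts 𝒟] (h : Induction 𝒟)

include h

theorem zero_add : ∀ x : M, aadd azero x = x := by
  have h1 := h.add_def
  refine h.ind _ (by fun_prop) (h.add_zero _) fun x ih => ?_
  rw [h.add_succ, ih]

theorem succ_add (x : M) : ∀ y : M, aadd (asucc x) y = asucc (aadd x y) := by
  have h1 := h.add_def
  have h2 := h.succ_def
  refine h.ind _ (by fun_prop) ?_ fun y ih => ?_
  · rw [h.add_zero, h.add_zero]
  · rw [h.add_succ, h.add_succ, ih]

theorem add_comm (x : M) : ∀ y : M, aadd x y = aadd y x := by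
  have h1 := h.add_def
  refine h.ind _ (by fun_prop) ?_ fun y ih => ?_
  · rw [h.add_zero, h.zero_add]
  · rw [h.add_succ, h.succ_add, ih]

theorem add_assoc (x y : M) : ∀ z : M, aadd (aadd x y) z = aadd x (aadd y z) := by
  have h1 := h.add_def
  refine h.ind _ (by fun_prop) ?_ fun z ih => ?_
  · rw [h.add_zero, h.add_zero]
  · rw [h.add_succ, h.add_succ, h.add_succ, ih]

theorem zero_mul : ∀ x : M, amul azero x = azero := by
  have h1 := h.mul_def
  refine h.ind _ (by fun_prop) (h.mul_zero _) fun x ih => ?_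
  rw [h.mul_succ, ih, h.add_zero]

theorem succ_mul (x : M) : ∀ y : M, amul (asucc x) y = aadd (amul x y) y := by
  have h1 := h.add_def
  have h2 := h.mul_def
  refine h.ind _ (by fun_prop) ?_ fun y ih => ?_
  · rw [h.mul_zero, h.mul_zero, h.add_zero]
  · rw [h.mul_succ, h.mul_succ, ih, h.add_succ, h.add_succ, h.add_assoc, h.add_assoc,
      h.add_comm x y]

theorem mul_comm (x : M) : ∀ y : M, amul x y = amul y x := by
  have h1 := h.mul_def
  refine h.ind _ (by fun_prop) ?_ fun y ih => ?_
  · rw [h.mul_zero, h.zero_mul]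
  · rw [h.mul_succ, h.succ_mul, ih]

theorem mul_add (x y : M) : ∀ z : M, amul x (aadd y z) = aadd (amul x y) (amul x z) := by
  have h1 := h.add_def
  have h2 := h.mul_def
  refine h.ind _ (by fun_prop) ?_ fun z ih => ?_
  · rw [h.mul_zero, h.add_zero, h.add_zero]
  · rw [h.add_succ, h.mul_succ, h.mul_succ, ih, h.add_assoc]

theorem mul_assoc (x y : M) : ∀ z : M, amul (amul x y) z = amul x (amul y z) := by
  have h1 := h.mul_def
  refine h.ind _ (by fun_prop) ?_ fun z ih => ?_
  · rw [h.mul_zero, h.mul_zero, h.mul_zero]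
  · rw [h.mul_succ, h.mul_succ, h.mul_add, ih]

theorem mul_one (x : M) : amul x (asucc azero) = x := by
  rw [h.mul_succ, h.mul_zero, h.zero_add]

theorem add_one (x : M) : aadd x (asucc azero) = asucc x := by
  rw [h.add_succ, h.add_zero]

theorem add_right_cancel (x y : M) : ∀ z : M, aadd x z = aadd y z → x = y := by
  have h1 := h.add_def
  refine h.ind _ ?_ ?_ fun z ih hz => ?_
  · simp only [imp_iff_Imp]
    fun_prop
  · rw [h.add_zero, h.add_zero]; exact id
  · rw [h.add_succ, h.add_succ] at hz
    exact ih (h.succ_inj _ _ hz)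

theorem eq_zero_or_succ : ∀ x : M, x = azero ∨ ∃ y, x = asucc y := by
  have h1 := h.succ_def
  exact h.ind _ (by fun_prop) (.inl rfl) fun x _ => .inr ⟨x, rfl⟩

theorem eq_zero_of_add (x y : M) (hxy : aadd x y = azero) : y = azero := by
  rcases h.eq_zero_or_succ y with rfl | ⟨z, rfl⟩
  · rfl
  · rw [h.add_succ] at hxy
    exact absurd hxy (h.succ_ne _)

theorem mul_ne_zero (x y : M) (hx : x ≠ azero) (hy : y ≠ azero) : amul x y ≠ azero := by
  rcases h.eq_zero_or_succ x with rfl | ⟨x, rfl⟩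
  · exact absurd rfl hx
  rcases h.eq_zero_or_succ y with rfl | ⟨y, rfl⟩
  · exact absurd rfl hy
  rw [h.mul_succ, h.add_succ]
  exact h.succ_ne _

theorem le_total (x : M) : ∀ y : M, (∃ z, aadd x z = y) ∨ ∃ z, aadd y z = x := by
  have h1 := h.add_def
  refine h.ind _ (by fun_prop) (.inr ⟨x, h.zero_add x⟩) fun y ih => ?_
  rcases ih with ⟨z, rfl⟩ | ⟨z, rfl⟩
  · exact .inl ⟨asucc z, h.add_succ x z⟩
  · rcases h.eq_zero_or_succ z with rfl | ⟨z, rfl⟩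
    · left
      exact ⟨asucc azero, by rw [h.add_one, h.add_zero]⟩
    · right
      exact ⟨z, by rw [h.succ_add, h.add_succ]⟩

/-- The semiring of a model of arithmetic. -/
@[reducible] def commSemiring : CommSemiring M where
  add := aadd
  zero := azero
  mul := amul
  one := asucc azero
  add_assoc := h.add_assoc
  zero_add := h.zero_add
  add_zero := h.add_zero
  add_comm := h.add_comm
  left_distrib := h.mul_add
  right_distrib x y z := by
    show amul (aadd x y) z = aadd (amul x z) (amul y z)
    rw [h.mul_comm, h.mul_add, h.mul_comm z x, h.mul_comm z y]
  zero_mul := h.zero_mul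
  mul_zero := h.mul_zero
  mul_assoc := h.mul_assoc
  one_mul x := (h.mul_comm _ _).trans (h.mul_one x)
  mul_one := h.mul_one
  mul_comm := h.mul_comm
  nsmul := @nsmulRec M ⟨azero⟩ ⟨aadd⟩

open Classical in
/-- The order of a model of arithmetic. -/
@[reducible] noncomputable def linearOrder : LinearOrder M where
  le x y := ∃ z, aadd x z = y
  le_refl x := ⟨azero, h.add_zero x⟩
  le_trans := by
    rintro x _ _ ⟨y, rfl⟩ ⟨z, rfl⟩
    exact ⟨aadd y z, (h.add_assoc _ _ _).symm⟩
  le_antisymm := by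
    rintro x _ ⟨y, rfl⟩ ⟨z, hz⟩
    rw [h.add_assoc] at hz
    have h0 : aadd y z = azero := by
      apply h.add_right_cancel _ _ x
      rw [h.add_comm, hz, h.zero_add]
    rw [h.add_comm] at h0
    rw [h.eq_zero_of_add _ _ h0, h.add_zero]
  le_total x y := h.le_total x y
  toDecidableLE := Classical.decRel _

/-- The ordered semiring serves only to reach the coding apparatus. The order is recorded through
addition so that it can later be seen to be definable without parameters. -/
theorem exists_codedOrder : ∃ (_ : LinearOrder M) (_ : CodedOrder 𝒟),
    ∀ x y : M, x ≤ y ↔ ∃ z, aadd x z = y := by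
  let := h.commSemiring
  let := h.linearOrder
  have hlt : ∀ x y : M, x < y ↔ ∃ z, z ≠ 0 ∧ x + z = y := by
    intro x y
    rw [lt_iff_le_and_ne]
    constructor
    · rintro ⟨⟨z, rfl⟩, hne⟩
      refine ⟨z, ?_, rfl⟩
      rintro rfl
      exact hne (h.add_zero x).symm
    · rintro ⟨z, hz, rfl⟩
      refine ⟨⟨z, rfl⟩, fun heq => hz (h.add_right_cancel _ _ x ?_)⟩
      rw [h.add_comm]
      exact heq.symm.trans (h.zero_add x).symm
  have hmul : ∀ c : M, 0 < c → ∀ a b : M, a < b → c * a < c * b := by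
    intro c hc a b hab
    obtain ⟨d, hd, rfl⟩ := (hlt a b).1 hab
    exact (hlt _ _).2 ⟨c * d, h.mul_ne_zero _ _ hc.ne' hd, (h.mul_add _ _ _).symm⟩
  have h1 : CanonicallyOrderedAdd M :=
    { exists_add_of_le := fun ⟨z, hz⟩ => ⟨z, hz.symm⟩
      le_self_add := fun x y => ⟨y, rfl⟩
      le_add_self := fun x y => ⟨y, h.add_comm _ _⟩ }
  have h2 : IsStrictOrderedRing M :=
    { add_le_add_left := by
        rintro x _ ⟨y, rfl⟩ z
        refine ⟨y, ?_⟩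
        show x + z + y = x + y + z
        ring
      le_of_add_le_add_left := by
        rintro x y z ⟨w, hw⟩
        refine ⟨w, h.add_right_cancel _ _ x ?_⟩
        rw [h.add_comm, ← h.add_assoc, h.add_comm z x]
        exact hw
      zero_le_one := ⟨1, h.zero_add _⟩
      exists_pair_ne := ⟨azero, asucc azero, (h.succ_ne _).symm⟩
      mul_lt_mul_of_pos_left := fun c hc a b hab => hmul c hc a b hab
      mul_lt_mul_of_pos_right := fun c hc a b hab => by
        have := hmul c hc a b hab
        rwa [_root_.mul_comm c a, _root_.mul_comm c b] at this }
  have h3 : PAModel 𝒟 :=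
    { add_def := h.add_def
      mul_def := h.mul_def
      lt_add_one := by
        intro x y
        rw [hlt]
        constructor
        · rintro ⟨z, hz, hxz⟩
          rcases h.eq_zero_or_succ z with rfl | ⟨z, rfl⟩
          · exact absurd rfl hz
          · refine ⟨z, h.succ_inj _ _ ?_⟩
            rw [← h.add_succ, ← h.add_one y]
            exact hxz
        · rintro ⟨z, rfl⟩
          exact ⟨asucc z, h.succ_ne _, by
            show aadd _ _ = aadd _ (asucc azero)
            rw [h.add_one, h.add_succ]⟩
      ind := fun P hP h0 hs => h.ind P hP h0 fun x hx => h.add_one x ▸ hs x hx }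
  exact ⟨_, PAModel.codedOrder 𝒟, fun _ _ => Iff.rfl⟩

end Induction

end Arith

/-! ### The axioms of HF(DLO), read semantically -/

namespace HFStr

variable {H : Type u} (A : HFStr H)

/-- `z = {x, y}` -/
def IsUpair (z x y : H) : Prop := ¬ A.atom z ∧ ∀ u, A.mem u z ↔ u = x ∨ u = y

/-- `p = ⟨x, y⟩` -/
def IsPair (p x y : H) : Prop := ¬ A.atom p ∧ ∀ u, A.mem u p ↔ A.IsUpair u x x ∨ A.IsUpair u x y

/-- `⟨x, y⟩ ∈ f` -/
def PairMem (x y f : H) : Prop := ∃ p, A.mem p f ∧ A.IsPair p x y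

/-- `x` is the empty set. -/
def IsEmptySet (x : H) : Prop := ¬ A.atom x ∧ ∀ y, ¬ A.mem y x

/-- `y = x ∪ {x}` -/
def IsSucc (y x : H) : Prop := ¬ A.atom y ∧ ∀ u, A.mem u y ↔ A.mem u x ∨ u = x

/-- `x` is a transitive set of sets. -/
def IsTrans (x : H) : Prop :=
  ¬ A.atom x ∧ ∀ y, A.mem y x → ¬ A.atom y ∧ ∀ z, A.mem z y → A.mem z x

/-- `x` is a transitive set of transitive sets. -/
def IsOrdinal (x : H) : Prop := A.IsTrans x ∧ ∀ y, A.mem y x → A.IsTrans y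

/-- `x` is zero or a successor. -/
def IsZeroOrSucc (x : H) : Prop := A.IsEmptySet x ∨ ∃ y, A.IsSucc x y

/-- `x` is a natural number. -/
def IsNat (x : H) : Prop :=
  (A.IsOrdinal x ∧ A.IsZeroOrSucc x) ∧ ∀ y, A.mem y x → A.IsZeroOrSucc y

/-- `f` is a bijection from `x` to `y`. -/
def IsBij (f x y : H) : Prop :=
  ((¬ A.atom f ∧ ∀ p, A.mem p f → ∃ u, A.mem u x ∧ ∃ v, A.mem v y ∧ A.IsPair p u v) ∧
    ∀ u, A.mem u x → ∃ v, A.mem v y ∧ A.PairMem u v f ∧ ∀ v', A.PairMem u v' f → v' = v) ∧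
    ∀ v, A.mem v y → ∃ u, A.mem u x ∧ A.PairMem u v f ∧ ∀ u', A.PairMem u' v f → u' = u

/-- The instance of replacement for a given relation. -/
def Replacement (R : H → H → Prop) : Prop :=
  ∀ w, (∀ x, A.mem x w → ∀ y z, R x y → R x z → y = z) →
    ∃ s, ¬ A.atom s ∧ ∀ y, A.mem y s ↔ ∃ x, A.mem x w ∧ R x y

/-- The instance of `∈`-induction for a given predicate. -/
def EpsInduction (P : H → Prop) : Prop :=
  (∀ x, (∀ y, A.mem y x → P y) → P x) → ∀ x, P x

/-- The set-theoretic axioms. -/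
structure IsSetTheory : Prop where
  pow : ∀ x, ∃ y, ∀ z, A.mem z y ↔ ¬ A.atom z ∧ ∀ u, A.mem u z → A.mem u x
  union : ∀ x, ∃ y, ¬ A.atom y ∧ ∀ z, A.mem z y ↔ ∃ u, A.mem u x ∧ A.mem z u
  finite : ∀ x, ¬ A.atom x → ∃ n, A.IsNat n ∧ ∃ f, A.IsBij f n x
  ext : ∀ x y, ¬ A.atom x → ¬ A.atom y → (∀ z, A.mem z x ↔ A.mem z y) → x = y
  atom_empty : ∀ x, A.atom x → ∀ y, ¬ A.mem y x

/-- The interpretations of the symbols in a structure. -/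
def ofStructure (N : Type u) [hfLang.Structure N] : HFStr N where
  mem x y := Structure.RelMap memSym ![x, y]
  atom x := Structure.RelMap atomSym ![x]
  lt x y := Structure.RelMap atomLtSym ![x, y]

end HFStr

namespace HF

variable {N : Type u} [hfLang.Structure N] {n : ℕ} (v : Empty → N) (xs : Fin n → N)

@[simp]
theorem realize_mem (x y : Fin n) :
    (mem x y).Realize v xs ↔ (HFStr.ofStructure N).mem (xs x) (xs y) := by
  simp [mem, BoundedFormula.realize_rel₂, HFStr.ofStructure]

@[simp]
theorem realize_atom (x : Fin n) :
    (atom x).Realize v xs ↔ (HFStr.ofStructure N).atom (xs x) := by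
  simp [atom, BoundedFormula.realize_rel₁, HFStr.ofStructure]

@[simp]
theorem realize_lt (x y : Fin n) :
    (lt x y).Realize v xs ↔ (HFStr.ofStructure N).lt (xs x) (xs y) := by
  simp [lt, BoundedFormula.realize_rel₂, HFStr.ofStructure]

@[simp]
theorem realize_eq (x y : Fin n) : (eq x y).Realize v xs ↔ xs x = xs y := by
  simp [eq]

@[simp]
theorem realize_allMem (x : Fin n) (φ : Fml (n + 1)) : (allMem x φ).Realize v xs ↔
    ∀ z, (HFStr.ofStructure N).mem z (xs x) → φ.Realize v (Fin.snoc xs z) := by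
  simp [allMem]

@[simp]
theorem realize_exMem (x : Fin n) (φ : Fml (n + 1)) : (exMem x φ).Realize v xs ↔
    ∃ z, (HFStr.ofStructure N).mem z (xs x) ∧ φ.Realize v (Fin.snoc xs z) := by
  simp [exMem]

@[simp]
theorem realize_isUpair (z x y : Fin n) : (isUpair z x y).Realize v xs ↔
    (HFStr.ofStructure N).IsUpair (xs z) (xs x) (xs y) := by
  simp [isUpair, HFStr.IsUpair]

@[simp]
theorem realize_isPair (z x y : Fin n) : (isPair z x y).Realize v xs ↔
    (HFStr.ofStructure N).IsPair (xs z) (xs x) (xs y) := by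
  simp [isPair, HFStr.IsPair]

@[simp]
theorem realize_pairMem (x y f : Fin n) : (pairMem x y f).Realize v xs ↔
    (HFStr.ofStructure N).PairMem (xs x) (xs y) (xs f) := by
  simp [pairMem, HFStr.PairMem]

@[simp]
theorem realize_isEmptySet (x : Fin n) : (isEmptySet x).Realize v xs ↔
    (HFStr.ofStructure N).IsEmptySet (xs x) := by
  simp [isEmptySet, HFStr.IsEmptySet]

@[simp]
theorem realize_isSucc (y x : Fin n) : (isSucc y x).Realize v xs ↔
    (HFStr.ofStructure N).IsSucc (xs y) (xs x) := by
  simp [isSucc, HFStr.IsSucc]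

@[simp]
theorem realize_isTransitive (x : Fin n) : (isTransitive x).Realize v xs ↔
    (HFStr.ofStructure N).IsTrans (xs x) := by
  simp [isTransitive, HFStr.IsTrans]

@[simp]
theorem realize_isNat (x : Fin n) : (isNat x).Realize v xs ↔
    (HFStr.ofStructure N).IsNat (xs x) := by
  simp [isNat, isOrdinal, isZeroOrSucc, HFStr.IsNat, HFStr.IsOrdinal, HFStr.IsZeroOrSucc]

@[simp]
theorem realize_isBijection (f x y : Fin n) : (isBijection f x y).Realize v xs ↔
    (HFStr.ofStructure N).IsBij (xs f) (xs x) (xs y) := by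
  simp [isBijection, HFStr.IsBij]

theorem models_setAxioms : N ⊨ setAxioms ↔ (HFStr.ofStructure N).IsSetTheory := by
  simp only [setAxioms, Theory.model_iff, Set.mem_insert_iff, Set.mem_singleton_iff, forall_eq_or_imp,
      forall_eq]
  simp [Sentence.Realize, Formula.Realize, Fin.snoc]
  exact ⟨fun ⟨h1, h2, h3, h4, h5⟩ => ⟨h1, h2, h3, h4, h5⟩,
    fun ⟨h1, h2, h3, h4, h5⟩ => ⟨h1, h2, h3, h4, h5⟩⟩

theorem models_atomAxioms : N ⊨ atomAxioms ↔ (HFStr.ofStructure N).IsDLO := by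
  simp only [atomAxioms, Theory.model_iff, Set.mem_insert_iff, Set.mem_singleton_iff, forall_eq_or_imp,
      forall_eq]
  simp [Sentence.Realize, Formula.Realize, Fin.snoc, or_assoc, and_assoc]
  exact ⟨fun ⟨h1, h2, h3, h4, h5, h6, h7, h8⟩ => ⟨h1, h2, h3, h4, h5, h6, h7, h8⟩,
    fun ⟨h1, h2, h3, h4, h5, h6, h7, h8⟩ => ⟨h1, h2, h3, h4, h5, h6, h7, h8⟩⟩

theorem replacementTemplate_holds {P : Set (Fin 2 → N)} : replacementTemplate.Holds N P ↔
    (HFStr.ofStructure N).Replacement (fun x y => ![x, y] ∈ P) := by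
  let := predStructure P
  show (N ⊨ replacementSentence) ↔ _
  simp [replacementSentence, Sentence.Realize, Formula.Realize, Fin.snoc, up, pred₂,
    BoundedFormula.realize_rel₂]
  exact Iff.rfl

theorem inductionTemplate_holds {P : Set (Fin 1 → N)} : inductionTemplate.Holds N P ↔
    (HFStr.ofStructure N).EpsInduction (fun x => ![x] ∈ P) := by
  let := predStructure P
  show (N ⊨ inductionSentence) ↔ _
  simp [inductionSentence, Sentence.Realize, Formula.Realize, Fin.snoc, up, pred₁,
    BoundedFormula.realize_rel₁]
  exact Iff.rfl

end HF

/-! ### Sets of a strong model are the bounded definable sets -/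

section

variable {M : Type u} {𝒟 : DefSystem M} [LinearOrder M] [CodedOrder 𝒟] [HasConsts 𝒟]
  {H : Type v} [Srt 𝒟 H] {A : HFStr H} {r : H → M}

namespace HFStr.IsSetTheory

/-- Replacement along the empty relation; `x` is merely something to apply it to. -/
theorem exists_empty (x : H) (hrepl : ∀ R : H → H → Prop,
    DefFun 𝒟 (fun q : H × H => R q.1 q.2) → A.Replacement R) : ∃ o, A.IsEmptySet o := by
  obtain ⟨o, ho, h⟩ := hrepl (fun _ _ => False) (by fun_prop) x (by simp)
  exact ⟨o, ho, fun y hy => by simpa using (h y).1 hy⟩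

/-- There is no axiom of pairing. Powerset, applied twice to the empty set `o`, gives `p = {o}` and
then a set `q` containing `o` and `p`. Replacement on `p` gives `{a}`, replacement on `q` gives the
set of `s` and `{a}`, and its union is the set sought. If `s` is an atom, it contributes no
elements. -/
theorem exists_insert (hA : A.IsSetTheory) (hrepl : ∀ R : H → H → Prop,
    DefFun 𝒟 (fun q : H × H => R q.1 q.2) → A.Replacement R) (s a : H) :
    ∃ s', ¬ A.atom s' ∧ ∀ y, A.mem y s' ↔ A.mem y s ∨ y = a := by
  obtain ⟨o, ho, ho'⟩ := exists_empty s hrepl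
  have ho_sub : ∀ z, ¬ A.atom z → (∀ u, A.mem u z → A.mem u o) → z = o := fun z hz h =>
    hA.ext z o hz ho fun u => iff_of_false (fun hu => ho' u (h u hu)) (ho' u)
  obtain ⟨p, hp⟩ := hA.pow o
  have hop : A.mem o p := (hp o).2 ⟨ho, fun _ h => h⟩
  have hpa : ¬ A.atom p := fun h => hA.atom_empty p h o hop
  have hp1 : ∀ z, A.mem z p ↔ z = o := fun z =>
    ⟨fun h => ho_sub z ((hp z).1 h).1 ((hp z).1 h).2, fun h => h ▸ hop⟩
  obtain ⟨q, hq⟩ := hA.pow p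
  have hoq : A.mem o q := (hq o).2 ⟨ho, fun u hu => absurd hu (ho' u)⟩
  have hpq : A.mem p q := (hq p).2 ⟨hpa, fun _ h => h⟩
  have hne : o ≠ p := by
    rintro rfl
    exact ho' o hop
  obtain ⟨a', ha', ha⟩ := hrepl (fun _ y => y = a) (by fun_prop) p
    (fun _ _ _ _ h h' => h.trans h'.symm)
  obtain ⟨w, hw, hmem⟩ := hrepl (fun x y => (x = o ∧ y = s) ∨ (x = p ∧ y = a')) (by fun_prop) q (by
    rintro x - y z (⟨rfl, rfl⟩ | ⟨rfl, rfl⟩) (⟨h, rfl⟩ | ⟨h, rfl⟩)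
    · rfl
    · exact absurd h hne
    · exact absurd h.symm hne
    · rfl)
  obtain ⟨s', hs', h⟩ := hA.union w
  refine ⟨s', hs', fun y => (h y).trans ?_⟩
  have hya : A.mem y a' ↔ y = a := by
    rw [ha]
    exact ⟨fun ⟨_, _, h⟩ => h, fun h => ⟨o, hop, h⟩⟩
  rw [← hya]
  constructor
  · rintro ⟨u, hu, hyu⟩
    obtain ⟨x, -, ⟨-, rfl⟩ | ⟨-, rfl⟩⟩ := (hmem u).1 hu
    · exact .inl hyu
    · exact .inr hyu
  · rintro (hy | hy)
    · exact ⟨s, (hmem s).2 ⟨o, hoq, .inl ⟨rfl, rfl⟩⟩, hy⟩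
    · exact ⟨a', (hmem a').2 ⟨p, hpq, .inr ⟨rfl, rfl⟩⟩, hy⟩

/-- The bounded definable predicates define sets. -/
theorem exists_comprehension (hA : A.IsSetTheory) (hrepl : ∀ R : H → H → Prop,
    DefFun 𝒟 (fun q : H × H => R q.1 q.2) → A.Replacement R) (hr : DefFun 𝒟 r)
    (hinj : Function.Injective r) (hm : DefFun 𝒟 (fun q : H × H => A.mem q.1 q.2))
    (ha : DefFun 𝒟 A.atom) (x₀ : H) (P : H → Prop) (hP : DefFun 𝒟 P) (hb : Bdd r P) :
    ∃ s, ¬ A.atom s ∧ ∀ y, A.mem y s ↔ P y := by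
  -- The set is built by induction along `M`, adjoining the at most one element of rank `n` at stage
  -- `n`.
  refine (hb.induction (𝒟 := 𝒟) (Φ := fun n => ∃ s, ¬ A.atom s ∧ ∀ y, A.mem y s ↔ P y ∧ r y < n)
    ?_ ?_ ?_).elim fun n ⟨⟨s, hs, h⟩, hn⟩ => ⟨s, hs, fun y => (h y).trans
      ⟨And.left, fun hy => ⟨hy, hn y hy⟩⟩⟩
  · simp only [forall_iff_All]
    fun_prop
  · obtain ⟨o, ho, h⟩ := exists_empty x₀ hrepl
    exact ⟨o, ho, fun y => iff_of_false (h y) fun hy => absurd hy.2 (not_lt.2 (CodedOrder.zero_le _))⟩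
  · rintro n ⟨s, hs, h⟩
    by_cases hn : ∃ x, P x ∧ r x = n
    · obtain ⟨a, ha, rfl⟩ := hn
      obtain ⟨s', hs', h'⟩ := hA.exists_insert hrepl s a
      refine ⟨s', hs', fun y => ?_⟩
      rw [h', h, lt_csucc, le_iff_lt_or_eq]
      constructor
      · rintro (⟨h1, h2⟩ | rfl)
        · exact ⟨h1, .inl h2⟩
        · exact ⟨ha, .inr rfl⟩
      · rintro ⟨h1, h2 | h2⟩
        · exact .inl ⟨h1, h2⟩
        · exact .inr (hinj h2)
    · refine ⟨s, hs, fun y => ?_⟩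
      rw [h, lt_csucc, le_iff_lt_or_eq]
      refine and_congr_right fun hy => (or_iff_left fun heq => hn ⟨y, hy, heq⟩).symm

/-- The finiteness axiom matches `x` with a natural number `n` of the structure by a bijection `f`.
By `∈`-induction on `k`, for `k` in `n` or equal to `n`, the values of `f` at the elements of `k`
have bounded ranks. Here the induction of the structure is applied to a statement about the order of
`M`, whereas comprehension uses the induction of `M`. -/
theorem bdd (hA : A.IsSetTheory) (hr : DefFun 𝒟 r)
    (hm : DefFun 𝒟 (fun q : H × H => A.mem q.1 q.2)) (ha : DefFun 𝒟 A.atom)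
    (hind : ∀ P : H → Prop, DefFun 𝒟 P → A.EpsInduction P) (x : H) :
    Bdd r (fun y => A.mem y x) := by
  by_cases hx : A.atom x
  · exact ⟨czero 𝒟, fun y hy => absurd hy (hA.atom_empty x hx y)⟩
  obtain ⟨n, ⟨⟨⟨⟨-, htr⟩, -⟩, hn⟩, hn'⟩, f, ⟨-, h1⟩, h2⟩ := hA.finite x hx
  have hpm : DefFun 𝒟 (fun q : H × H => A.PairMem q.1 q.2 f) := by
    simp only [PairMem, IsPair, IsUpair, forall_iff_All]
    fun_prop
  have key := hind (fun k => A.mem k n ∨ k = n → ∃ b, ∀ j, A.mem j k → ∀ y, A.PairMem j y f → r y < b)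
    (by
      simp only [imp_iff_Imp, forall_iff_All]
      fun_prop) (by
      intro k ih hk
      have hz : A.IsZeroOrSucc k := hk.elim (hn' k) (fun h => h ▸ hn)
      have hsub : ∀ j, A.mem j k → A.mem j n := fun j hj =>
        hk.elim (fun h => (htr k h).2 j hj) (fun h => h ▸ hj)
      rcases hz with hz | ⟨k', hk'⟩
      · exact ⟨czero 𝒟, fun j hj => absurd hj (hz.2 j)⟩
      · have hmem : A.mem k' k := (hk'.2 k').2 (.inr rfl)
        obtain ⟨b, hb⟩ := ih k' hmem (.inl (hsub k' hmem))
        obtain ⟨y', -, -, hy'⟩ := h1 k' (hsub k' hmem)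
        refine ⟨max b (csucc 𝒟 (r y')), fun j hj y hjy => ?_⟩
        rcases (hk'.2 j).1 hj with hj | rfl
        · exact (hb j hj y hjy).trans_le (le_max_left _ _)
        · rw [hy' y hjy]
          exact (lt_csucc_self 𝒟 _).trans_le (le_max_right _ _))
  obtain ⟨b, hb⟩ := key n (.inr rfl)
  refine ⟨b, fun y hy => ?_⟩
  obtain ⟨j, hj, hjy, -⟩ := h2 y hy
  exact hb j hj y hjy

theorem finSets (hA : A.IsSetTheory) (hD : A.IsDLO) (hr : DefFun 𝒟 r) (hinj : Function.Injective r)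
    (hm : DefFun 𝒟 (fun q : H × H => A.mem q.1 q.2)) (ha : DefFun 𝒟 A.atom)
    (hlt : DefFun 𝒟 (fun q : H × H => A.lt q.1 q.2))
    (hrepl : ∀ R : H → H → Prop, DefFun 𝒟 (fun q : H × H => R q.1 q.2) → A.Replacement R)
    (hind : ∀ P : H → Prop, DefFun 𝒟 P → A.EpsInduction P) : FinSets 𝒟 A r :=
  { hD with
    rank_def := hr
    rank_inj := hinj
    mem_def := hm
    atom_def := ha
    lt_def := hlt
    ind := hind
    ext := hA.ext
    atom_empty := fun x y h => hA.atom_empty x h y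
    bdd := hA.bdd hr hm ha hind
    comp := hA.exists_comprehension hrepl hr hinj hm ha hD.exists_atom.choose }

end HFStr.IsSetTheory

end

/-! ### From standalone definability to definability with parameters, and back -/

section

variable {M : Type u} {𝒟 : DefSystem M} {γ : Type v} {δ : Type w} [Srt 𝒟 γ] [Srt 𝒟 δ]

theorem DefFun.tuple {κ : Type} [Finite κ] {f : γ → κ → M}
    (h : ∀ i, DefFun 𝒟 (fun x => f x i)) : DefFun 𝒟 f := by
  classical
  have := Fintype.ofFinite κ
  apply DefFun.of_graph
  have key : ∀ s : Finset κ, DefFun 𝒟 (fun q : γ × (κ → M) => ∀ i ∈ s, f q.1 i = q.2 i) := by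
    intro s
    induction s using Finset.induction_on with
    | empty =>
      have : DefFun 𝒟 (fun q : γ × (κ → M) => q = q) := by fun_prop
      simpa using this
    | insert a s _ ih =>
      have h1 := h a
      have : DefFun 𝒟 (fun q : γ × (κ → M) => f q.1 a = Definiteness.coord a q.2) :=
        (h1.comp DefFun.fst').eq (by fun_prop)
      simpa [Definiteness.coord] using this.and ih
  simpa [funext_iff] using key Finset.univ

theorem DefFun.of_mem {κ : Type} [Finite κ] {s : Set (κ → M)} (hs : s ∈ 𝒟.D) :
    DefFun 𝒟 (fun v : κ → M => v ∈ s) := by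
  apply DefFun.of_pred
  refine 𝒟.congr hs fun v => ?_
  exact ⟨fun ⟨_, h, h'⟩ => h ▸ h', fun h => ⟨v, rfl, h⟩⟩

theorem DefFun.mem {κ : Type} [Finite κ] {P : (κ → M) → Prop} (hP : DefFun 𝒟 P) :
    {v | P v} ∈ 𝒟.D := by
  refine 𝒟.congr hP.pred fun v => ?_
  exact ⟨fun h => ⟨v, rfl, h⟩, fun ⟨_, h, h'⟩ => h ▸ h'⟩

theorem DefFun.of_mem₁ {s : Set (Fin 1 → M)} (hs : s ∈ 𝒟.D) {f : γ → M} (hf : DefFun 𝒟 f) :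
    DefFun 𝒟 (fun x => ![f x] ∈ s) :=
  (DefFun.of_mem hs).comp (DefFun.tuple fun i => by fin_cases i; exact hf)

theorem DefFun.of_mem₂ {s : Set (Fin 2 → M)} (hs : s ∈ 𝒟.D) {f g : γ → M} (hf : DefFun 𝒟 f)
    (hg : DefFun 𝒟 g) : DefFun 𝒟 (fun x => ![f x, g x] ∈ s) :=
  (DefFun.of_mem hs).comp (DefFun.tuple fun i => by fin_cases i; exacts [hf, hg])

theorem DefFun.of_mem₃ {s : Set (Fin 3 → M)} (hs : s ∈ 𝒟.D) {f g h : γ → M} (hf : DefFun 𝒟 f)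
    (hg : DefFun 𝒟 g) (hh : DefFun 𝒟 h) : DefFun 𝒟 (fun x => ![f x, g x, h x] ∈ s) :=
  (DefFun.of_mem hs).comp (DefFun.tuple fun i => by fin_cases i; exacts [hf, hg, hh])

end

namespace Arith.Induction

variable {M : Type u} [arith.Structure M] {𝒟 : DefSystem M}

/-- Induction for a member of a definable family follows from induction for the parameter-free
statement that every inductive member of the family holds at `x`. -/
theorem param (h : Induction 𝒟) : Induction 𝒟.param where
  zero_def := h.zero_def.param_pred
  succ_def := h.succ_def.param
  add_def := h.add_def.param
  mul_def := h.mul_def.param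
  succ_ne := h.succ_ne
  succ_inj := h.succ_inj
  add_zero := h.add_zero
  add_succ := h.add_succ
  mul_zero := h.mul_zero
  mul_succ := h.mul_succ
  ind := by
    intro P hP h0 hs
    obtain ⟨κ, hκ, p, R, hR, rfl⟩ := DefFun.exists_family hP
    have hz := h.zero_def
    have h1 := h.succ_def
    -- Zero enters through the predicate of being zero: constant maps are not available without
    -- parameters.
    have := h.ind (fun x => ∀ q, (∃ z, z = azero ∧ R q z) → (∀ y, R q y → R q (asucc y)) → R q x)
      (by
        simp only [imp_iff_Imp, forall_iff_All]
        fun_prop) (fun q ⟨z, hz, h⟩ _ => hz ▸ h) (fun x ih q h1 h2 => h2 x (ih q h1 h2))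
    exact fun x => this x p ⟨_, rfl, h0⟩ hs

theorem exists_order (h : Induction 𝒟) : ∃ (_ : LinearOrder M) (_ : CodedOrder 𝒟.param),
    DefFun 𝒟 (fun q : M × M => q.1 ≤ q.2) ∧ LeastNumber 𝒟 := by
  obtain ⟨ho, hc, hle⟩ := h.param.exists_codedOrder
  refine ⟨ho, hc, ?_, fun P hP => CodedOrder.least (𝒟 := 𝒟.param) P hP.param_pred⟩
  have h1 := h.add_def
  simp only [hle]
  fun_prop

end Arith.Induction

section

variable {M : Type u} {𝒟 : DefSystem M} [LinearOrder M] [CodedOrder 𝒟.param]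
  {H : Type v} {K : Type w} [hH : Srt 𝒟 H] [hK : Srt 𝒟 K] {A : HFStr H} {B : HFStr K}
  {r : H → M} {t : K → M}

/-- Strong models, where only relations that are definable without parameters are considered. -/
structure HFModel (𝒟 : DefSystem M) [Srt 𝒟 H] (A : HFStr H) (r : H → M) : Prop where
  set : A.IsSetTheory
  dlo : A.IsDLO
  rank_def : DefFun 𝒟 r
  rank_inj : Function.Injective r
  mem_def : DefFun 𝒟 (fun q : H × H => A.mem q.1 q.2)
  atom_def : DefFun 𝒟 A.atom
  lt_def : DefFun 𝒟 (fun q : H × H => A.lt q.1 q.2)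
  repl : ∀ R : H → H → Prop, DefFun 𝒟 (fun q : H × H => R q.1 q.2) → A.Replacement R
  ind : ∀ P : H → Prop, DefFun 𝒟 P → A.EpsInduction P

/-- The instances of replacement and of `∈`-induction are definable properties of the relation
concerned, so they transfer from relations defined without parameters to relations defined with
parameters. -/
theorem HFModel.finSets (hL : LeastNumber 𝒟) (hle : DefFun 𝒟 (fun q : M × M => q.1 ≤ q.2))
    (hA : HFModel 𝒟 A r) : let := Srt.param H hH; FinSets 𝒟.param A r := by
  intro
  have hm := hA.mem_def
  have ha := hA.atom_def
  refine hA.set.finSets hA.dlo hA.rank_def.param hA.rank_inj hA.mem_def.param_pred₂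
    hA.atom_def.param_pred hA.lt_def.param_pred₂ ?_ ?_
  · intro R hR
    refine hL.transfer hle (Φ := fun R : H × H → Prop => A.Replacement fun x y => R (x, y)) ?_
      (fun R hR => hA.repl _ hR) (P := fun q => R q.1 q.2) hR
    intro κ _ R hR
    simp only [HFStr.Replacement, imp_iff_Imp, forall_iff_All]
    fun_prop
  · intro P hP
    refine hL.transfer hle (Φ := fun P : H → Prop => A.EpsInduction P) ?_ (fun P hP => hA.ind _ hP) hP
    intro κ _ R hR
    simp only [HFStr.EpsInduction, imp_iff_Imp, forall_iff_All]
    fun_prop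

theorem HFStr.isIso_iff {e : H → K → Prop} : A.IsIso B e ↔ ((((((∀ x, ∃ y, e x y) ∧
    ∀ y, ∃ x, e x y) ∧
    ∀ x y x' y', e x y → e x' y' → (x = x' ↔ y = y')) ∧
    ∀ x y x' y', e x y → e x' y' → (A.mem x x' ↔ B.mem y y')) ∧
    ∀ x y, e x y → (A.atom x ↔ B.atom y)) ∧
    ∀ x y x' y', e x y → e x' y' → (A.lt x x' ↔ B.lt y y')) :=
  ⟨fun ⟨h1, h2, h3, h4, h5, h6⟩ => ⟨⟨⟨⟨⟨h1, h2⟩, h3⟩, h4⟩, h5⟩, h6⟩,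
    fun ⟨⟨⟨⟨⟨h1, h2⟩, h3⟩, h4⟩, h5⟩, h6⟩ => ⟨h1, h2, h3, h4, h5, h6⟩⟩

/-- Internal categoricity gives an isomorphism that is definable with parameters. Not being an
isomorphism is a definable property; if it held for all relations definable without parameters, it
would transfer to this one. -/
theorem HFModel.exists_iso (hL : LeastNumber 𝒟) (hle : DefFun 𝒟 (fun q : M × M => q.1 ≤ q.2))
    (hA : HFModel 𝒟 A r) (hB : HFModel 𝒟 B t) :
    ∃ e : H → K → Prop, DefFun 𝒟 (fun q : H × K => e q.1 q.2) ∧ A.IsIso B e := by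
  by_contra hno
  have hmA := hA.mem_def
  have haA := hA.atom_def
  have hlA := hA.lt_def
  have hmB := hB.mem_def
  have haB := hB.atom_def
  have hlB := hB.lt_def
  obtain ⟨e, he, hiso⟩ := let := Srt.param H hH; let := Srt.param K hK;
    FinSets.exists_iso (hA.finSets hL hle) (hB.finSets hL hle)
  refine hL.transfer hle (Φ := fun e : H × K → Prop => ¬ A.IsIso B fun x y => e (x, y)) ?_
    (fun e he h => hno ⟨_, he, h⟩) (P := fun q => e q.1 q.2) he hiso
  intro κ _ R hR
  simp only [HFStr.isIso_iff, imp_iff_Imp, forall_iff_All]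
  fun_prop

end

/-! ### The definability system of a universe with standalone comprehension -/

namespace Arith

variable {M : Type u} [arith.Structure M]

/-- The axioms on successor, addition and multiplication. -/
structure BaseAxioms (M : Type u) [arith.Structure M] : Prop where
  succ_ne : ∀ x : M, asucc x ≠ azero
  succ_inj : ∀ x y : M, asucc x = asucc y → x = y
  add_zero : ∀ x : M, aadd x azero = x
  add_succ : ∀ x y : M, aadd x (asucc y) = asucc (aadd x y)
  mul_zero : ∀ x : M, amul x azero = azero
  mul_succ : ∀ x y : M, amul x (asucc y) = aadd (amul x y) x
  lt_iff : ∀ x y : M, Lt x y ↔ ∃ z, aadd x (asucc z) = y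

section

variable {α : Type} {n : ℕ} (v : α → M) (t s : arith.Term α)

@[simp]
theorem realize_zero : (zero : arith.Term α).realize v = azero := by
  simp only [zero, Term.realize_constants, azero]
  exact congrArg (Structure.funMap zeroSym) (Subsingleton.elim _ _)

@[simp]
theorem realize_succ : (succ t).realize v = asucc (t.realize v) := by
  simp [succ, asucc, Term.realize_functions_apply₁]

@[simp]
theorem realize_add : (add t s).realize v = aadd (t.realize v) (s.realize v) := by
  simp [add, aadd, Term.realize_functions_apply₂]

@[simp]
theorem realize_mul : (mul t s).realize v = amul (t.realize v) (s.realize v) := by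
  simp [mul, amul, Term.realize_functions_apply₂]

end

theorem models_baseAxioms : M ⊨ baseAxioms ↔ BaseAxioms M := by
  simp only [baseAxioms, Theory.model_iff, Set.mem_insert_iff, Set.mem_singleton_iff, forall_eq_or_imp,
      forall_eq]
  simp [Sentence.Realize, Formula.Realize, Fin.snoc, lt, BoundedFormula.realize_rel₂]
  exact ⟨fun ⟨h1, h2, h3, h4, h5, h6, h7⟩ => ⟨h1, h2, h3, h4, h5, h6, h7⟩,
    fun ⟨h1, h2, h3, h4, h5, h6, h7⟩ => ⟨h1, h2, h3, h4, h5, h6, h7⟩⟩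

theorem inductionTemplate_holds {P : Set (Fin 1 → M)} : inductionTemplate.Holds M P ↔
    (![azero] ∈ P → (∀ x, ![x] ∈ P → ![asucc x] ∈ P) → ∀ x, ![x] ∈ P) := by
  let := predStructure P
  show (M ⊨ inductionSentence) ↔ _
  simp [inductionSentence, Sentence.Realize, Formula.Realize, Fin.snoc, pred,
    BoundedFormula.realize_rel₁]
  exact Iff.rfl

/-- The sets that are definable over a second-order universe without first-order parameters. -/
def standaloneSystem (X : SetUniverse M) (h : BaseAxioms M) : DefSystem M where
  D {ι} := {s | (∅ : Set M).Definable (arith.sum (setLang X)) s}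
  compl h := h.compl
  inter h h' := h.inter h'
  reindex f _ h := h.preimage_comp f
  proj h := Set.Definable.exists_of_finite h
  diag := Set.empty_definable_iff.2 ⟨Term.equal (.var true) (.var false), by
    ext v; simp [Formula.realize_equal]⟩
  zero := azero
  one := asucc azero
  zero_ne_one := (h.succ_ne _).symm
  zero_def := Set.empty_definable_iff.2
    ⟨Term.equal (.var ()) (LHom.sumInl.onTerm (zero : arith.Term Unit)), by
      ext v; simp [Formula.realize_equal]⟩
  one_def := Set.empty_definable_iff.2
    ⟨Term.equal (.var ()) (LHom.sumInl.onTerm (succ zero : arith.Term Unit)), by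
      ext v; simp [Formula.realize_equal]⟩

theorem mem_standaloneSystem {X : SetUniverse M} (h : BaseAxioms M) {n : ℕ} {s : Set (Fin n → M)}
    (hs : s ∈ X n) : s ∈ (standaloneSystem X h).D :=
  Set.empty_definable_iff.2
    ⟨Relations.formula (Sum.inr ⟨s, hs⟩ : (arith.sum (setLang X)).Relations n) Term.var, by
      ext v
      simp
      rfl⟩

theorem standaloneSystem_term {X : SetUniverse M} (h : BaseAxioms M) {κ : Type} (i : κ)
    (t : arith.Term κ) : {v : κ → M | t.realize v = v i} ∈ (standaloneSystem X h).D :=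
  Set.empty_definable_iff.2
    ⟨Term.equal (LHom.sumInl.onTerm t) (.var i), by ext v; simp [Formula.realize_equal]⟩

theorem induction_of_modelsStandalonePC {X : SetUniverse M} (h : BaseAxioms M)
    (hX : ModelsStandalonePC inductionScheme X) : Induction (standaloneSystem X h) where
  zero_def := (DefFun.of_mem₁ (s := {v | v 0 = azero}) (by
    refine (standaloneSystem X h).congr (standaloneSystem_term h 0 zero) fun v => ?_
    simp [eq_comm]) DefFun.id :)
  succ_def := DefFun.of_graph (DefFun.of_mem₂ (s := {v | asucc (v 0) = v 1}) (by
    refine (standaloneSystem X h).congr (standaloneSystem_term h 1 (succ (.var 0))) fun v => ?_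
    simp) DefFun.fst' DefFun.snd' :)
  add_def := DefFun.of_graph (DefFun.of_mem₃ (s := {v | aadd (v 0) (v 1) = v 2}) (by
    refine (standaloneSystem X h).congr
      (standaloneSystem_term h 2 (add (.var 0) (.var 1))) fun v => ?_
    simp) DefFun.fst'.fst DefFun.fst'.snd DefFun.snd' :)
  mul_def := DefFun.of_graph (DefFun.of_mem₃ (s := {v | amul (v 0) (v 1) = v 2}) (by
    refine (standaloneSystem X h).congr
      (standaloneSystem_term h 2 (mul (.var 0) (.var 1))) fun v => ?_
    simp) DefFun.fst'.fst DefFun.fst'.snd DefFun.snd' :)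
  succ_ne := h.succ_ne
  succ_inj := h.succ_inj
  add_zero := h.add_zero
  add_succ := h.add_succ
  mul_zero := h.mul_zero
  mul_succ := h.mul_succ
  ind P hP h0 hs := by
    have : {v : Fin 1 → M | P (coord 0 v)} ∈ X 1 := hX.2 _ _
      (DefFun.mem (𝒟 := standaloneSystem X h) (P := fun v => P (coord 0 v)) (by fun_prop))
    exact inductionTemplate_holds.1 (hX.1.2 inductionTemplate rfl _ this) h0 hs

end Arith

/-! ### Quotients of internal structures as sorts -/

namespace InternalStructure

section

variable {M : Type u} {K : FirstOrder.Language.{0, 0}} (N : InternalStructure K M)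

theorem mem_lift {n : ℕ} (R : Set (Fin n → N.Carrier)) (w : Fin n → M) :
    w ∈ N.lift R ↔ ∃ h : ∀ i, w i ∈ N.dom, (fun i => (⟦⟨w i, h i⟩⟧ : N.Carrier)) ∈ R := Iff.rfl

/-- An element of the domain represents an element of the quotient. -/
def Rep (a : N.Carrier) (m : M) : Prop := ∃ h : m ∈ N.dom, (⟦⟨m, h⟩⟧ : N.Carrier) = a

theorem Rep.unique {N : InternalStructure K M} {a b : N.Carrier} {m : M} (h : N.Rep a m)
    (h' : N.Rep b m) : a = b := by
  obtain ⟨h1, rfl⟩ := h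
  obtain ⟨h2, rfl⟩ := h'
  rfl

theorem mem_lift_iff {n : ℕ} (R : Set (Fin n → N.Carrier)) (w : Fin n → M) :
    w ∈ N.lift R ↔ ∃ a ∈ R, ∀ i, N.Rep (a i) (w i) := by
  rw [mem_lift]
  constructor
  · rintro ⟨h, hR⟩
    exact ⟨_, hR, fun i => ⟨h i, rfl⟩⟩
  · rintro ⟨a, ha, h⟩
    choose h1 h2 using h
    refine ⟨h1, ?_⟩
    rwa [show (fun i => (⟦⟨w i, h1 i⟩⟧ : N.Carrier)) = a from funext h2]

theorem mem_lift_of_rep {n : ℕ} (R : Set (Fin n → N.Carrier)) {w : Fin n → M}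
    {a : Fin n → N.Carrier} (h : ∀ i, N.Rep (a i) (w i)) : w ∈ N.lift R ↔ a ∈ R := by
  rw [mem_lift_iff]
  constructor
  · rintro ⟨b, hb, h'⟩
    rwa [show a = b from funext fun i => (h i).unique (h' i)]
  · exact fun ha => ⟨a, ha, h⟩

variable {N} in
theorem mem_eqRel {m m' : M} : ![m, m'] ∈ N.eqRel ↔ ∃ a, N.Rep a m ∧ N.Rep a m' := by
  rw [eqRel, mem_lift_iff]
  constructor
  · rintro ⟨a, h, h'⟩
    have h : a 0 = a 1 := h
    exact ⟨a 0, h' 0, h ▸ h' 1⟩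
  · rintro ⟨a, h, h'⟩
    refine ⟨fun _ => a, rfl, fun i => ?_⟩
    fin_cases i
    exacts [h, h']

theorem exists_rep (a : N.Carrier) : ∃ m, N.Rep a m := by
  obtain ⟨⟨m, hm⟩, rfl⟩ := Quotient.exists_rep a
  exact ⟨m, hm, rfl⟩

variable [LinearOrder M] {𝒟 : DefSystem M}

/-- The class of `a` is definable from any of its members, hence the use of the least number
principle with parameters. Least representatives code the quotient by elements of `M` and provide
its injective rank. -/
theorem exists_least_rep {N : InternalStructure K M} (hL : LeastNumber 𝒟.param)
    (hE : N.eqRel ∈ 𝒟.D) (a : N.Carrier) : ∃ m, N.Rep a m ∧ ∀ k, N.Rep a k → m ≤ k := by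
  obtain ⟨m₀, h₀⟩ := N.exists_rep a
  have : ∀ m, N.Rep a m ↔ ![m₀, m] ∈ N.eqRel := fun m => by
    rw [mem_eqRel]
    constructor
    · exact fun h => ⟨a, h₀, h⟩
    · rintro ⟨b, hb, h⟩
      exact h₀.unique hb ▸ h
  refine hL (fun m => N.Rep a m) ?_ ⟨m₀, h₀⟩
  simp only [this]
  exact DefFun.of_mem₂ (𝒟.mem_param hE) (DefFun.const m₀) DefFun.id

/-- The least representative of an element of the quotient. -/
noncomputable def rep (hL : LeastNumber 𝒟.param) (hE : N.eqRel ∈ 𝒟.D) (a : N.Carrier) : M :=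
  (exists_least_rep hL hE a).choose

variable {N} (hL : LeastNumber 𝒟.param) (hE : N.eqRel ∈ 𝒟.D)

theorem rep_spec (a : N.Carrier) : N.Rep a (N.rep hL hE a) := (exists_least_rep hL hE a).choose_spec.1

theorem rep_le {a : N.Carrier} {k : M} (h : N.Rep a k) : N.rep hL hE a ≤ k :=
  (exists_least_rep hL hE a).choose_spec.2 k h

theorem eq_rep_iff {m : M} : (∃ a, N.rep hL hE a = m) ↔
    ![m, m] ∈ N.eqRel ∧ ∀ k, ![k, m] ∈ N.eqRel → m ≤ k := by
  simp only [mem_eqRel]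
  constructor
  · rintro ⟨a, rfl⟩
    refine ⟨⟨a, rep_spec hL hE a, rep_spec hL hE a⟩, fun k ⟨b, hk, h⟩ => ?_⟩
    obtain rfl := h.unique (rep_spec hL hE a)
    exact rep_le hL hE hk
  · rintro ⟨⟨a, h, -⟩, hmin⟩
    exact ⟨a, le_antisymm (rep_le hL hE h) (hmin _ ⟨a, rep_spec hL hE a, h⟩)⟩

theorem rep_injective : Function.Injective (N.rep hL hE) := fun a b h =>
  (rep_spec hL hE a).unique (h ▸ rep_spec hL hE b)

/-- The quotient of an internal structure as a sort. -/
@[reducible] noncomputable def srt (hle : DefFun 𝒟 (fun q : M × M => q.1 ≤ q.2)) :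
    Srt 𝒟 N.Carrier where
  Ix := Unit
  fin := inferInstance
  code' a _ := N.rep hL hE a
  inj' _ _ h := rep_injective hL hE (congrFun h ())
  range' := by
    have : DefFun 𝒟 (fun v : Unit → M => ![coord () v, coord () v] ∈ N.eqRel ∧
        ∀ k, ![k, coord () v] ∈ N.eqRel → coord () v ≤ k) := by
      refine DefFun.and (DefFun.of_mem₂ hE (by fun_prop) (by fun_prop)) ?_
      simp only [imp_iff_Imp, forall_iff_All]
      refine DefFun.all (DefFun.imp (DefFun.of_mem₂ hE (by fun_prop) (by fun_prop)) ?_)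
      fun_prop
    refine 𝒟.congr this.mem fun v => ?_
    refine Iff.trans ?_ (eq_rep_iff hL hE)
    exact exists_congr fun a => ⟨fun h => congrFun h (), fun h => funext fun _ => h⟩

section

variable (hle : DefFun 𝒟 (fun q : M × M => q.1 ≤ q.2))

theorem rep_def : let := srt hL hE hle; DefFun 𝒟 (N.rep hL hE) := by
  intro
  apply DefFun.of_graph
  apply DefFun.of_pred
  refine 𝒟.congr (𝒟.inter (𝒟.diag' (Sum.inl () : Unit ⊕ Unit) (Sum.inr ()))
    (𝒟.reindex (Sum.inl : Unit → Unit ⊕ Unit) (Srt.range 𝒟 N.Carrier))) fun v => ?_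
  constructor
  · rintro ⟨⟨a, m⟩, rfl, h⟩
    exact ⟨h, a, rfl⟩
  · rintro ⟨h, a, ha⟩
    refine ⟨(a, v (.inr ())), ?_, ?_⟩
    · ext (i | i)
      · exact congrFun ha i
      · rfl
    · exact (congrFun ha ()).trans h

theorem Rep_def : let := srt hL hE hle; DefFun 𝒟 (fun q : N.Carrier × M => N.Rep q.1 q.2) := by
  intro
  have h1 := rep_def hL hE hle
  have : ∀ a m, N.Rep a m ↔ ![N.rep hL hE a, m] ∈ N.eqRel := fun a m => by
    rw [mem_eqRel]
    constructor
    · exact fun h => ⟨a, rep_spec hL hE a, h⟩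
    · rintro ⟨b, hb, h⟩
      exact (rep_spec hL hE a).unique hb ▸ h
  simp only [this]
  exact DefFun.of_mem₂ hE (by fun_prop) (by fun_prop)

theorem lift_mem₁ {P : N.Carrier → Prop} (hP : let := srt hL hE hle; DefFun 𝒟 P) :
    N.lift {v : Fin 1 → N.Carrier | P (v 0)} ∈ 𝒟.D := by
  let := srt hL hE hle
  have h1 := Rep_def hL hE hle
  have : DefFun 𝒟 (fun w : Fin 1 → M => ∃ a, P a ∧ N.Rep a (coord 0 w)) := by fun_prop
  refine 𝒟.congr this.mem fun w => ?_
  rw [mem_lift_iff]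
  constructor
  · rintro ⟨a, ha, h⟩
    exact ⟨a 0, ha, h 0⟩
  · rintro ⟨a, ha, h⟩
    refine ⟨fun _ => a, ha, fun i => ?_⟩
    fin_cases i
    exact h

theorem lift_mem₂ {P : N.Carrier → N.Carrier → Prop}
    (hP : let := srt hL hE hle; DefFun 𝒟 (fun q : N.Carrier × N.Carrier => P q.1 q.2)) :
    N.lift {v : Fin 2 → N.Carrier | P (v 0) (v 1)} ∈ 𝒟.D := by
  let := srt hL hE hle
  have h1 := Rep_def hL hE hle
  have : DefFun 𝒟 (fun w : Fin 2 → M =>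
      ∃ a b, P a b ∧ N.Rep a (coord 0 w) ∧ N.Rep b (coord 1 w)) := by fun_prop
  refine 𝒟.congr this.mem fun w => ?_
  rw [mem_lift_iff]
  constructor
  · rintro ⟨a, ha, h⟩
    exact ⟨a 0, a 1, ha, h 0, h 1⟩
  · rintro ⟨a, b, ha, h, h'⟩
    refine ⟨![a, b], ha, fun i => ?_⟩
    fin_cases i
    exacts [h, h']

theorem rel_def₁ {R : Set (Fin 1 → N.Carrier)} (hR : N.lift R ∈ 𝒟.D) :
    let := srt hL hE hle; DefFun 𝒟 (fun a : N.Carrier => ![a] ∈ R) := by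
  intro
  have h1 := rep_def hL hE hle
  have : ∀ a, ![a] ∈ R ↔ ![N.rep hL hE a] ∈ N.lift R := fun a =>
    (N.mem_lift_of_rep R fun i => by fin_cases i; exact rep_spec hL hE a).symm
  simp only [this]
  exact DefFun.of_mem₁ hR (by fun_prop)

theorem rel_def₂ {R : Set (Fin 2 → N.Carrier)} (hR : N.lift R ∈ 𝒟.D) :
    let := srt hL hE hle
    DefFun 𝒟 (fun q : N.Carrier × N.Carrier => ![q.1, q.2] ∈ R) := by
  intro
  have h1 := rep_def hL hE hle
  have : ∀ a b, ![a, b] ∈ R ↔ ![N.rep hL hE a, N.rep hL hE b] ∈ N.lift R := fun a b =>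
    (N.mem_lift_of_rep R fun i => by
      fin_cases i; exacts [rep_spec hL hE a, rep_spec hL hE b]).symm
  simp only [this]
  exact DefFun.of_mem₂ hR (by fun_prop) (by fun_prop)

end

end

/-- The isomorphism with a given graph. -/
theorem exists_equiv {N N' : Type u} [hfLang.Structure N] [hfLang.Structure N'] {e : N → N' → Prop}
    (he : (HFStr.ofStructure N).IsIso (HFStr.ofStructure N') e) :
    ∃ f : N ≃[hfLang] N', ∀ x y, f x = y ↔ e x y := by
  choose f hf using he.total
  have hf' : ∀ x y, f x = y ↔ e x y := fun x y =>
    ⟨fun h => h ▸ hf x, fun h => (he.eq_iff _ _ _ _ (hf x) h).1 rfl⟩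
  let F : N ≃ N' := Equiv.ofBijective f
    ⟨fun x x' h => (he.eq_iff _ _ _ _ (hf x) (hf x')).2 h, fun y => (he.surj y).imp fun x h => (hf' x y).2 h⟩
  refine ⟨⟨F, fun f => f.elim, ?_⟩, hf'⟩
  have vec1 : ∀ {T : Type u} (v : Fin 1 → T), v = ![v 0] := fun v => by
    ext i; fin_cases i; rfl
  have vec2 : ∀ {T : Type u} (v : Fin 2 → T), v = ![v 0, v 1] := fun v => by
    ext i; fin_cases i <;> rfl
  intro n R v
  cases R with
  | mem =>
    show Structure.RelMap memSym (f ∘ v) ↔ Structure.RelMap memSym v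
    rw [vec2 (f ∘ v)]
    conv_rhs => rw [vec2 v]
    exact (he.mem_iff _ _ _ _ (hf _) (hf _)).symm
  | atom =>
    show Structure.RelMap atomSym (f ∘ v) ↔ Structure.RelMap atomSym v
    rw [vec1 (f ∘ v)]
    conv_rhs => rw [vec1 v]
    exact (he.atom_iff _ _ (hf _)).symm
  | lt =>
    show Structure.RelMap atomLtSym (f ∘ v) ↔ Structure.RelMap atomLtSym v
    rw [vec2 (f ∘ v)]
    conv_rhs => rw [vec2 v]
    exact (he.lt_iff _ _ _ _ (hf _) (hf _)).symm

end InternalStructure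

open InternalStructure in
-- Relations in `X` are definable, being admitted as second-order parameters, and relations
-- definable without first-order parameters are in `X` by standalone comprehension. So strong models
-- are instances of `HFModel`, and the definable isomorphism found has its graph in `X`.
theorem standaloneCategorical_hfDLO : StandaloneCategorical.{u} hfDLO Arith.inductionScheme := by
  intro M _ _ X hX N₀ N₁ h₀ h₁
  have hbase := Arith.models_baseAxioms.1 hX.1.1
  let 𝒟 := Arith.standaloneSystem X hbase
  have hmem : ∀ {n : ℕ} {s : Set (Fin n → M)}, s ∈ X n → s ∈ 𝒟.D := Arith.mem_standaloneSystem hbase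
  obtain ⟨_, _, hle, hL⟩ := (Arith.induction_of_modelsStandalonePC hbase hX).exists_order
  have hL' : LeastNumber 𝒟.param := CodedOrder.least
  have key : ∀ (N : InternalStructure hfLang M) (hN : N.IsStrongModel X hfDLO),
      let := srt hL' (hmem hN.1.2.1) hle
      HFModel 𝒟 (HFStr.ofStructure N.Carrier) (N.rep hL' (hmem hN.1.2.1)) := by
    intro N hN
    have hE : N.eqRel ∈ 𝒟.D := hmem hN.1.2.1
    let := srt hL' hE hle
    have hax := hN.2.1
    exact
      { set := HF.models_setAxioms.1 (hax.mono Set.subset_union_left)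
        dlo := HF.models_atomAxioms.1 (hax.mono Set.subset_union_right)
        rank_def := rep_def hL' hE hle
        rank_inj := rep_injective hL' hE
        mem_def := rel_def₂ hL' hE hle (hmem (hN.1.2.2 2 memSym))
        atom_def := rel_def₁ hL' hE hle (hmem (hN.1.2.2 1 atomSym))
        lt_def := rel_def₂ hL' hE hle (hmem (hN.1.2.2 2 atomLtSym))
        repl := fun R hR => HF.replacementTemplate_holds.1 (hN.2.2 HF.replacementTemplate (.inl rfl)
          (show Set (Fin 2 → N.Carrier) from {v | R (v 0) (v 1)}) (hX.2 _ _ (lift_mem₂ hL' hE hle hR)))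
        ind := fun P hP => HF.inductionTemplate_holds.1 (hN.2.2 HF.inductionTemplate (.inr rfl)
          (show Set (Fin 1 → N.Carrier) from {v | P (v 0)}) (hX.2 _ _ (lift_mem₁ hL' hE hle hP))) }
  have hE₀ : N₀.eqRel ∈ 𝒟.D := hmem h₀.1.2.1
  have hE₁ : N₁.eqRel ∈ 𝒟.D := hmem h₁.1.2.1
  let := srt hL' hE₀ hle
  let := srt hL' hE₁ hle
  obtain ⟨e, he, hiso⟩ := HFModel.exists_iso hL hle (key N₀ h₀) (key N₁ h₁)
  obtain ⟨f, hf⟩ := exists_equiv hiso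
  refine ⟨f, hX.2 _ _ ?_⟩
  have hr₀ := Rep_def hL' hE₀ hle
  have hr₁ := Rep_def hL' hE₁ hle
  have : DefFun 𝒟 (fun w : Fin 2 → M =>
      ∃ a b, e a b ∧ N₀.Rep a (coord 0 w) ∧ N₁.Rep b (coord 1 w)) := by fun_prop
  refine 𝒟.congr this.mem fun w => ?_
  constructor
  · rintro ⟨h, h', heq⟩
    exact ⟨_, _, (hf _ _).1 heq, ⟨h, rfl⟩, ⟨h', rfl⟩⟩
  · rintro ⟨a, b, hab, ⟨h, rfl⟩, ⟨h', rfl⟩⟩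
    exact ⟨h, h', (hf _ _).2 hab⟩

/-! ### Instances of templates, and the standard model of PA -/

section

variable {L : FirstOrder.Language.{0, 0}} {k m : ℕ} {M : Type u} [L.Structure M]

theorem realize_eraseTerm {α : Type} (P : Set (Fin k → M)) (v : α → M)
    (t : (L.sum (predLang k)).Term α) :
    (eraseTerm t).realize v = (let := predStructure P; t.realize v) := by
  induction t with
  | var a => rfl
  | func f ts ih =>
    cases f with
    | inl f =>
      simp only [eraseTerm, Term.realize, ih]
      rfl
    | inr f => exact f.elim

theorem realize_paramTerm {n : ℕ} (P : Set (Fin k → M)) (v : Fin m → M) (xs : Fin n → M)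
    (t : (L.sum (predLang k)).Term (Empty ⊕ Fin n)) :
    (paramTerm t).realize (Sum.elim v xs) =
      (let := predStructure P; t.realize (Sum.elim default xs)) := by
  rw [paramTerm, Term.realize_relabel, realize_eraseTerm P]
  refine congrArg (fun w => (let := predStructure P; t.realize w)) (funext fun i => ?_)
  rcases i with i | i
  · exact i.elim
  · rfl

/-- The substitution lemma behind `models_inst`: an instance is the template with `P` read as the
set that `φ` defines from the parameters. Thus `ℕ`, which satisfies induction for all its subsets,
satisfies PA. -/
theorem realize_substPred (φ : L.Formula (Fin k ⊕ Fin m)) (v : Fin m → M) {n : ℕ}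
    (ψ : (L.sum (predLang k)).BoundedFormula Empty n) (xs : Fin n → M) :
    (substPred φ ψ).Realize v xs ↔
      (let := predStructure {w | φ.Realize (Sum.elim w v)}; ψ.Realize default xs) := by
  let := predStructure {w | φ.Realize (Sum.elim w v)}
  induction ψ with
  | falsum => exact Iff.rfl
  | equal t s =>
    simp only [substPred, BoundedFormula.Realize, realize_paramTerm {w | φ.Realize (Sum.elim w v)}]
  | rel R ts =>
    cases R with
    | inl R =>
      simp only [substPred, BoundedFormula.Realize, realize_paramTerm {w | φ.Realize (Sum.elim w v)}]
      rfl
    | inr R =>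
      cases R
      simp only [substPred]
      rw [BoundedFormula.realize_relabel, BoundedFormula.realize_subst]
      refine iff_of_eq (congrArg₂ (fun w xs => BoundedFormula.Realize φ w xs) (funext fun i => ?_)
        (Subsingleton.elim _ _))
      rcases i with i | i
      · refine Eq.trans ?_ (realize_paramTerm _ v xs (ts i))
        refine congrArg (fun w => (paramTerm (ts i)).realize w) (funext fun j => ?_)
        rcases j with j | j <;> rfl
      · rfl
  | imp _ _ ih ih' =>
    simp only [substPred, BoundedFormula.Realize, ih, ih']
  | all _ ih =>
    simp only [substPred, BoundedFormula.Realize, ih]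

theorem models_inst {t : Template L} (h : ∀ P, t.Holds M P)
    (φ : L.Formula (Fin t.arity ⊕ Fin m)) : M ⊨ t.inst φ := by
  refine BoundedFormula.realize_alls.2 fun xs => ?_
  refine BoundedFormula.realize_relabel.2 ((realize_substPred φ _ _ _).2 ?_)
  have hxs : (xs ∘ Fin.natAdd m : Fin 0 → M) = default := Subsingleton.elim _ _
  rw [hxs]
  exact h _

theorem models_theory {S : Scheme L} (h : M ⊨ S.axioms) (h' : ∀ t ∈ S.templates, ∀ P, t.Holds M P) :
    M ⊨ S.theory := by
  rw [Theory.model_iff]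
  rintro φ (hφ | ⟨t, ht, m, ψ, rfl⟩)
  · exact h.realize_of_mem φ hφ
  · exact models_inst (h' t ht) ψ

end

namespace Arith

/-- The standard model. -/
instance : arith.Structure (ULift.{u} ℕ) where
  funMap f v := match f with
    | .zero => ⟨0⟩
    | .succ => ⟨(v 0).down + 1⟩
    | .add => ⟨(v 0).down + (v 1).down⟩
    | .mul => ⟨(v 0).down * (v 1).down⟩
  RelMap R v := match R with
    | .lt => (v 0).down < (v 1).down

theorem standard_models_peano : ULift.{u} ℕ ⊨ peano := by
  apply models_theory
  · refine models_baseAxioms.2 ⟨?_, ?_, ?_, ?_, ?_, ?_, ?_⟩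
    · rintro ⟨x⟩ h
      exact absurd (congrArg ULift.down h) (Nat.succ_ne_zero x)
    · rintro ⟨x⟩ ⟨y⟩ h
      exact congrArg ULift.up (Nat.succ.inj (congrArg ULift.down h))
    · rintro ⟨x⟩
      rfl
    · rintro ⟨x⟩ ⟨y⟩
      rfl
    · rintro ⟨x⟩
      rfl
    · rintro ⟨x⟩ ⟨y⟩
      rfl
    · rintro ⟨x⟩ ⟨y⟩
      show x < y ↔ _
      constructor
      · intro h
        obtain ⟨z, rfl⟩ := Nat.exists_eq_add_of_lt h
        exact ⟨⟨z⟩, rfl⟩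
      · rintro ⟨⟨z⟩, h⟩
        have : x + (z + 1) = y := congrArg ULift.down h
        omega
  · rintro t rfl P
    refine inductionTemplate_holds.2 fun h0 hs => ?_
    rintro ⟨n⟩
    induction n with
    | zero => exact h0
    | succ n ih => exact hs _ ih

end Arith

/-! ### An ultrapower of `ℕ` with a segment of size continuum -/

namespace Arith

open Filter

/-- An ultrapower of the standard model. -/
abbrev Ultrapower : Type u :=
  ((hyperfilter ℕ : Ultrafilter ℕ) : Filter ℕ).Product fun _ => ULift.{u} ℕ

namespace Ultrapower

/-- The element of the ultrapower represented by a sequence. -/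
noncomputable def ofSeq (f : ℕ → ℕ) : Ultrapower.{u} :=
  Quotient.mk _ fun n => ⟨f n⟩

theorem exists_ofSeq (x : Ultrapower.{u}) : ∃ f, x = ofSeq f := by
  induction x using Quotient.inductionOn with
  | h f => exact ⟨fun n => (f n).down, rfl⟩

theorem ofSeq_eq {f g : ℕ → ℕ} :
    (ofSeq f : Ultrapower.{u}) = ofSeq g ↔ ∀ᶠ n in hyperfilter ℕ, f n = g n := by
  refine Quotient.eq.trans ?_
  refine eventually_congr (Eventually.of_forall fun n => ?_)
  exact ULift.up_inj

theorem ofSeq_lt {f g : ℕ → ℕ} :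
    Lt (ofSeq f : Ultrapower.{u}) (ofSeq g) ↔ ∀ᶠ n in hyperfilter ℕ, f n < g n := by
  have h := relMap_quotient_mk' (((hyperfilter ℕ : Ultrafilter ℕ) : Filter ℕ).productSetoid
    fun _ => ULift.{u} ℕ) ltSym ![fun n => ⟨f n⟩, fun n => ⟨g n⟩]
  refine Iff.trans (iff_of_eq (congrArg (Structure.RelMap ltSym) (funext fun i => ?_))) h
  fin_cases i <;> rfl

theorem models_peano : Ultrapower.{u} ⊨ peano := by
  rw [Theory.model_iff]
  intro φ hφ
  rw [Ultraproduct.sentence_realize]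
  exact Eventually.of_forall fun _ => standard_models_peano.realize_of_mem φ hφ

/-- The ultrafilter is nonprincipal and contains every tail, so sequences that differ eventually
represent different elements. -/
theorem ofSeq_ne_of_lt {f g : ℕ → ℕ} (N : ℕ) (h : ∀ n, N < n → f n ≠ g n) :
    (ofSeq f : Ultrapower.{u}) ≠ ofSeq g := by
  intro hfg
  have h₁ : ∀ᶠ n in hyperfilter ℕ, N < n :=
    (Nat.hyperfilter_le_atTop) (eventually_gt_atTop N)
  obtain ⟨n, hn, hn'⟩ := (h₁.and (ofSeq_eq.1 hfg)).exists
  exact h n hn hn'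

/-- A code for the first `n` values of `b`. -/
noncomputable def code (b : ℕ → Bool) (n : ℕ) : ℕ :=
  Fintype.equivFin (Fin n → Bool) fun i => b i

theorem code_lt (b : ℕ → Bool) (n : ℕ) : code b n < Fintype.card (Fin n → Bool) :=
  Fin.isLt _

/-- Once two binary sequences have differed, all their longer restrictions differ. The codes thus
form continuum many eventually different sequences, all below `2 ^ n`. -/
theorem exists_code_ne {b c : ℕ → Bool} (h : b ≠ c) : ∃ N, ∀ n, N < n → code b n ≠ code c n := by
  obtain ⟨N, hN⟩ := Function.ne_iff.1 h
  refine ⟨N, fun n hn hbc => hN ?_⟩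
  exact congrFun ((Fintype.equivFin (Fin n → Bool)).injective (Fin.ext hbc)) ⟨N, hn⟩

/-- The length of the initial segment considered. -/
noncomputable def bound : Ultrapower.{u} := ofSeq fun n => Fintype.card (Fin n → Bool)

/-- A proper initial segment of the ultrapower. -/
def segment : Set Ultrapower.{u} := {x | Lt x bound}

theorem segment_isInitial {x y : Ultrapower.{u}} (hx : x ∈ segment) (hy : Lt y x) :
    y ∈ segment := by
  obtain ⟨f, rfl⟩ := exists_ofSeq x
  obtain ⟨g, rfl⟩ := exists_ofSeq y
  refine ofSeq_lt.2 ?_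
  filter_upwards [ofSeq_lt.1 hx, ofSeq_lt.1 hy] with n h₁ h₂ using h₂.trans h₁

/-- The elements of the segment indexed by binary sequences. -/
noncomputable def inSegment (b : ℕ → Bool) : segment.{u} :=
  ⟨ofSeq (code b), ofSeq_lt.2 (Eventually.of_forall fun n => code_lt b n)⟩

/-- Elements outside the segment indexed by binary sequences. -/
noncomputable def outSegment (b : ℕ → Bool) : ↥(segment.{u}ᶜ) :=
  ⟨ofSeq fun n => Fintype.card (Fin n → Bool) + code b n, fun h => by
    obtain ⟨n, hn⟩ := (ofSeq_lt.1 h).exists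
    omega⟩

theorem inSegment_injective : Function.Injective inSegment.{u} := by
  intro b c h
  by_contra hbc
  obtain ⟨N, hN⟩ := exists_code_ne hbc
  exact ofSeq_ne_of_lt N hN (congrArg Subtype.val h)

theorem outSegment_injective : Function.Injective outSegment.{u} := by
  intro b c h
  by_contra hbc
  obtain ⟨N, hN⟩ := exists_code_ne hbc
  refine ofSeq_ne_of_lt N (fun n hn h => hN n hn ?_) (congrArg Subtype.val h)
  exact Nat.add_left_cancel h

open Cardinal

/-- From above, the sequences of natural numbers are counted; from below, the codes of binary
sequences. -/
theorem mk_segment : #segment.{u} = continuum := by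
  refine le_antisymm ?_ ?_
  · refine (mk_set_le _).trans (mk_quotient_le.trans ?_)
    simp
  · have := lift_mk_le_lift_mk_of_injective inSegment_injective.{u}
    simpa using this

/-- Shifting the codes by `2 ^ n` moves them out of the segment. This leaves room for the sets of
the counterexample, whose atoms fill the segment. -/
theorem continuum_le_mk_compl_segment : continuum ≤ #↥(segment.{u}ᶜ) := by
  have := lift_mk_le_lift_mk_of_injective outSegment_injective.{u}
  simpa using this

theorem segment_ne_univ : segment.{u} ≠ Set.univ := by
  intro h
  exact (outSegment.{u} default).2 ((Set.ext_iff.1 h _).2 trivial)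

instance : Uncountable Ultrapower.{u} := by
  rw [← aleph0_lt_mk_iff]
  refine aleph0_lt_continuum.trans_le ?_
  rw [← mk_segment]
  exact mk_set_le _

/-- A theory has no templates and so puts no condition on the universe, which may contain all
relations. -/
theorem modelsPC : ModelsPC (ofTheory peano) fun n => (Set.univ : Set (Set (Fin n → Ultrapower.{u}))) :=
  ⟨⟨models_peano, fun _ h => absurd h (Set.notMem_empty _)⟩, fun _ _ _ => trivial⟩

end Ultrapower

end Arith

/-! ### Hereditarily finite sets as an initial algebra -/

section HereditarilyFinite

/-- Finite sets of atoms and of elements of `x`. -/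
def FinsetOver (α x : Type u) : Type u := Finset (α ⊕ x)

-- A finite set of atoms and elements is presented by its set of atoms and a list of `n` elements,
-- up to order and repetition. This exhibits the functor as a quotient of a polynomial functor with
-- finite arities, which provides both the initial algebra and a bound on its cardinality.
open Classical in
noncomputable instance (α : Type u) : QPF (FinsetOver α) where
  map f s := s.toLeft.disjSum (s.toRight.image f)
  P := ⟨Finset α × ℕ, fun a => ULift (Fin a.2)⟩
  abs p := p.1.1.disjSum (Finset.univ.image p.2)
  repr {x} s := ⟨(s.toLeft, s.toRight.card), fun i => (s.toRight.equivFin.symm i.down).1⟩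
  abs_repr s := by
    refine Eq.trans ?_ (Finset.toLeft_disjSum_toRight (u := s))
    refine congrArg (Finset.disjSum _) ?_
    ext y
    simp only [Finset.mem_image, Finset.mem_univ, true_and]
    constructor
    · rintro ⟨i, rfl⟩
      exact Subtype.prop _
    · intro hy
      refine ⟨⟨s.toRight.equivFin ⟨y, hy⟩⟩, ?_⟩
      exact congrArg Subtype.val (Equiv.symm_apply_apply _ _)
  abs_map f p := by
    obtain ⟨⟨s, n⟩, g⟩ := p
    refine Eq.trans ?_ (congrArg₂ Finset.disjSum (Finset.toLeft_disjSum (s := s)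
      (t := Finset.univ.image g)).symm (congrArg (Finset.image f) (Finset.toRight_disjSum (s := s)
      (t := Finset.univ.image g)).symm))
    rw [Finset.image_image]
    rfl

/-- The hereditarily finite sets with atoms from `α`. -/
def HFSet (α : Type u) : Type u := QPF.Fix (FinsetOver α)

namespace HFSet

variable {α : Type u}

/-- Finite sets of atoms and hereditarily finite sets are hereditarily finite sets. -/
noncomputable def equiv : Finset (α ⊕ HFSet α) ≃ HFSet α where
  toFun := QPF.Fix.mk (F := FinsetOver α)
  invFun := QPF.Fix.dest (F := FinsetOver α)
  left_inv := QPF.Fix.dest_mk (F := FinsetOver α)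
  right_inv := QPF.Fix.mk_dest (F := FinsetOver α)

theorem ind {p : HFSet α → Prop}
    (h : ∀ s : Finset (α ⊕ HFSet α), (∀ y, Sum.inr y ∈ s → p y) → p (equiv s)) (x : HFSet α) :
    p x := by
  refine QPF.Fix.ind (F := FinsetOver α) p (fun s hs => h s ?_) x
  obtain ⟨u, rfl⟩ := hs
  intro y hy
  classical
  obtain ⟨z, -, rfl⟩ := Finset.mem_image.1 (Finset.inr_mem_disjSum.1 hy)
  exact z.2

-- The trees in question have finite branching and as many kinds of nodes as there are atoms.
open Cardinal in
theorem mk_le [Infinite α] : #(HFSet α) ≤ #α := by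
  refine mk_quotient_le.trans ((WType.cardinalMk_le_max_aleph0_of_finite
    (β := fun a : Finset α × ℕ => ULift.{u} (Fin a.2))).trans ?_)
  have h : #(Finset α × ℕ) = #α := by
    rw [mk_prod]
    simp
  rw [h, max_eq_left (aleph0_le_mk α)]

end HFSet

end HereditarilyFinite

/-! ### True hereditarily finite sets satisfy HF -/

/-- The sets of the structure are exactly the finite sets of its elements, and are well-founded. -/
structure HFStr.IsHF {H : Type u} (A : HFStr H) (σ : Finset H → H) : Prop where
  mem_iff : ∀ x s, A.mem x (σ s) ↔ x ∈ s
  not_atom : ∀ s, ¬ A.atom (σ s)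
  exists_eq : ∀ x, ¬ A.atom x → ∃ s, x = σ s
  atom_empty : ∀ x, A.atom x → ∀ y, ¬ A.mem y x
  ind : ∀ P, A.EpsInduction P

namespace HFStr.IsHF

variable {H : Type u} {A : HFStr H} {σ : Finset H → H} (h : A.IsHF σ)

include h

theorem exists_elems (x : H) : ∃ s : Finset H, ∀ y, A.mem y x ↔ y ∈ s := by
  by_cases hx : A.atom x
  · exact ⟨∅, fun y => iff_of_false (h.atom_empty x hx y) (Finset.notMem_empty y)⟩
  · obtain ⟨s, rfl⟩ := h.exists_eq x hx
    exact ⟨s, fun y => h.mem_iff y s⟩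

theorem exists_set {T : Set H} (hT : T.Finite) : ∃ s, ¬ A.atom s ∧ ∀ y, A.mem y s ↔ y ∈ T :=
  ⟨σ hT.toFinset, h.not_atom _, fun _ => (h.mem_iff _ _).trans hT.mem_toFinset⟩

theorem finite_elems (x : H) : {y | A.mem y x}.Finite := by
  obtain ⟨s, hs⟩ := h.exists_elems x
  exact s.finite_toSet.subset fun y hy => (hs y).1 hy

theorem ext (x y : H) (hx : ¬ A.atom x) (hy : ¬ A.atom y) (hxy : ∀ z, A.mem z x ↔ A.mem z y) :
    x = y := by
  obtain ⟨s, rfl⟩ := h.exists_eq x hx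
  obtain ⟨t, rfl⟩ := h.exists_eq y hy
  congr 1
  ext z
  rw [← h.mem_iff, hxy, h.mem_iff]

theorem irrefl (x : H) : ¬ A.mem x x :=
  h.ind (fun x => ¬ A.mem x x) (fun x ih hx => ih x hx hx) x

/-- The image of a finite set under a functional relation is finite, whether or not the relation is
definable. -/
theorem replacement (R : H → H → Prop) : A.Replacement R := by
  intro w hw
  have : {y | ∃ x, A.mem x w ∧ R x y} = ⋃ x ∈ {x | A.mem x w}, {y | R x y} := by
    ext y
    simp
  refine h.exists_set (T := {y | ∃ x, A.mem x w ∧ R x y}) (this ▸ (h.finite_elems w).biUnion ?_)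
  intro x hx
  exact Set.Subsingleton.finite fun y hy z hz => hw x hx y z hy hz

theorem isUpair_unique {z a b c d : H} (h₁ : A.IsUpair z a b) (h₂ : A.IsUpair z c d) :
    (a = c ∧ b = d) ∨ (a = d ∧ b = c) := by
  have e : ∀ u, (u = a ∨ u = b) ↔ (u = c ∨ u = d) := fun u => (h₁.2 u).symm.trans (h₂.2 u)
  have ha := (e a).1 (.inl rfl)
  have hb := (e b).1 (.inr rfl)
  have hc := (e c).2 (.inl rfl)
  have hd := (e d).2 (.inr rfl)
  grind

theorem exists_upair (x y : H) : ∃ z, A.IsUpair z x y :=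
  h.exists_set (T := {x, y}) (Set.toFinite _)

theorem exists_pair (x y : H) : ∃ p, A.IsPair p x y := by
  obtain ⟨z, hz⟩ := h.exists_upair x x
  obtain ⟨z', hz'⟩ := h.exists_upair x y
  obtain ⟨p, hp⟩ := h.exists_upair z z'
  refine ⟨p, hp.1, fun u => (hp.2 u).trans (or_congr ?_ ?_)⟩
  · exact ⟨fun e => e ▸ hz, fun hu => h.ext u z hu.1 hz.1 fun v => (hu.2 v).trans (hz.2 v).symm⟩
  · exact ⟨fun e => e ▸ hz', fun hu => h.ext u z' hu.1 hz'.1 fun v => (hu.2 v).trans (hz'.2 v).symm⟩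

theorem isPair_unique {p a b c d : H} (h₁ : A.IsPair p a b) (h₂ : A.IsPair p c d) :
    a = c ∧ b = d := by
  obtain ⟨z, hz⟩ := h.exists_upair a a
  obtain ⟨z', hz'⟩ := h.exists_upair a b
  obtain ⟨w, hw⟩ := h.exists_upair c c
  obtain ⟨w', hw'⟩ := h.exists_upair c d
  have h1 := (h₂.2 z).1 ((h₁.2 z).2 (.inl hz))
  have h2 := (h₂.2 z').1 ((h₁.2 z').2 (.inr hz'))
  have h3 := (h₁.2 w).1 ((h₂.2 w).2 (.inl hw))
  have h4 := (h₁.2 w').1 ((h₂.2 w').2 (.inr hw'))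
  have e1 := h1.imp (h.isUpair_unique hz) (h.isUpair_unique hz)
  have e2 := h2.imp (h.isUpair_unique hz') (h.isUpair_unique hz')
  have e3 := h3.imp (h.isUpair_unique hw) (h.isUpair_unique hw)
  have e4 := h4.imp (h.isUpair_unique hw') (h.isUpair_unique hw')
  grind

omit h

open Classical in
/-- The elements of the finite von Neumann ordinals. -/
noncomputable def numElems (σ : Finset H → H) : ℕ → Finset H
  | 0 => ∅
  | n + 1 => insert (σ (numElems σ n)) (numElems σ n)

theorem mem_numElems {n : ℕ} {x : H} : x ∈ numElems σ n ↔ ∃ i < n, x = σ (numElems σ i) := by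
  classical
  induction n with
  | zero => simp [numElems]
  | succ n ih =>
    rw [numElems, Finset.mem_insert, ih]
    constructor
    · rintro (rfl | ⟨i, hi, rfl⟩)
      · exact ⟨n, n.lt_succ_self, rfl⟩
      · exact ⟨i, hi.trans n.lt_succ_self, rfl⟩
    · rintro ⟨i, hi, rfl⟩
      rcases Nat.lt_succ_iff_lt_or_eq.1 hi with hi | rfl
      · exact .inr ⟨i, hi, rfl⟩
      · exact .inl rfl

include h

theorem mem_num {n : ℕ} {x : H} :
    A.mem x (σ (numElems σ n)) ↔ ∃ i < n, x = σ (numElems σ i) :=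
  (h.mem_iff _ _).trans mem_numElems

theorem num_injective : Function.Injective fun n => σ (numElems σ n) := by
  have key : ∀ m n, m < n → σ (numElems σ m) ≠ σ (numElems σ n) := fun m n hmn heq => by
    have : A.mem (σ (numElems σ m)) (σ (numElems σ n)) := h.mem_num.2 ⟨m, hmn, rfl⟩
    exact h.irrefl _ (heq ▸ this)
  intro m n hmn
  by_contra hne
  rcases Nat.lt_or_gt_of_ne hne with hlt | hlt
  · exact key _ _ hlt hmn
  · exact key _ _ hlt hmn.symm

theorem isTrans_num (n : ℕ) : A.IsTrans (σ (numElems σ n)) := by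
  refine ⟨h.not_atom _, fun y hy => ?_⟩
  obtain ⟨i, hi, rfl⟩ := h.mem_num.1 hy
  refine ⟨h.not_atom _, fun z hz => ?_⟩
  obtain ⟨j, hj, rfl⟩ := h.mem_num.1 hz
  exact h.mem_num.2 ⟨j, hj.trans hi, rfl⟩

theorem isZeroOrSucc_num (n : ℕ) : A.IsZeroOrSucc (σ (numElems σ n)) := by
  cases n with
  | zero =>
    refine .inl ⟨h.not_atom _, fun y hy => ?_⟩
    obtain ⟨i, hi, -⟩ := h.mem_num.1 hy
    exact Nat.not_lt_zero i hi
  | succ n =>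
    refine .inr ⟨σ (numElems σ n), h.not_atom _, fun u => ?_⟩
    classical
    rw [h.mem_iff, h.mem_iff, numElems, Finset.mem_insert, or_comm]

theorem isNat_num (n : ℕ) : A.IsNat (σ (numElems σ n)) := by
  refine ⟨⟨⟨h.isTrans_num n, fun y hy => ?_⟩, h.isZeroOrSucc_num n⟩, fun y hy => ?_⟩ <;>
    obtain ⟨i, -, rfl⟩ := h.mem_num.1 hy
  · exact h.isTrans_num i
  · exact h.isZeroOrSucc_num i

theorem exists_isBij (s : Finset H) : ∃ n, A.IsNat n ∧ ∃ f, A.IsBij f n (σ s) := by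
  choose p hp using h.exists_pair
  let e := s.equivFin
  let num (n : ℕ) : H := σ (numElems σ n)
  -- An external enumeration of `s` is finite, so its graph is a set of the structure.
  obtain ⟨f, hf, hmem⟩ := h.exists_set
    (T := Set.range fun y : s => p (num (e y)) y) (Set.finite_range _)
  have hpair : ∀ u v, A.PairMem u v f ↔ ∃ y : s, u = num (e y) ∧ v = y := fun u v => by
    constructor
    · rintro ⟨q, hq, hquv⟩
      obtain ⟨y, rfl⟩ := (hmem q).1 hq
      exact ⟨y, h.isPair_unique hquv (hp _ _)⟩
    · rintro ⟨y, rfl, rfl⟩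
      exact ⟨_, (hmem _).2 ⟨y, rfl⟩, hp _ _⟩
  refine ⟨num s.card, h.isNat_num _, f, ⟨⟨hf, fun q hq => ?_⟩, fun u hu => ?_⟩, fun v hv => ?_⟩
  · obtain ⟨y, rfl⟩ := (hmem q).1 hq
    exact ⟨_, h.mem_num.2 ⟨e y, (e y).2, rfl⟩, y, (h.mem_iff _ _).2 y.2, hp _ _⟩
  · obtain ⟨i, hi, rfl⟩ := h.mem_num.1 hu
    refine ⟨e.symm ⟨i, hi⟩, (h.mem_iff _ _).2 (Subtype.prop _), (hpair _ _).2
      ⟨e.symm ⟨i, hi⟩, by simp [num], rfl⟩, fun v' hv' => ?_⟩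
    obtain ⟨y, hy, rfl⟩ := (hpair _ _).1 hv'
    have hy : i = e y := h.num_injective hy
    refine congrArg Subtype.val (e.injective ?_)
    rw [Equiv.apply_symm_apply]
    exact Fin.ext hy.symm
  · have hv := (h.mem_iff _ _).1 hv
    refine ⟨num (e ⟨v, hv⟩), h.mem_num.2 ⟨_, Fin.isLt _, rfl⟩, (hpair _ _).2 ⟨⟨v, hv⟩, rfl, rfl⟩,
      fun u' hu' => ?_⟩
    obtain ⟨y, rfl, hy⟩ := (hpair _ _).1 hu'
    rw [show y = ⟨v, hv⟩ from Subtype.ext hy.symm]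

theorem isSetTheory : A.IsSetTheory where
  pow x := by
    obtain ⟨s, hs⟩ := h.exists_elems x
    obtain ⟨y, -, hy⟩ := h.exists_set (T := σ '' {t | t ⊆ s})
      ((Set.Finite.ofFinset s.powerset fun t => Finset.mem_powerset).image σ)
    refine ⟨y, fun z => (hy z).trans ⟨?_, fun ⟨hz, hzx⟩ => ?_⟩⟩
    · rintro ⟨t, ht, rfl⟩
      exact ⟨h.not_atom t, fun u hu => (hs u).2 (ht ((h.mem_iff u t).1 hu))⟩
    · obtain ⟨t, rfl⟩ := h.exists_eq z hz
      exact ⟨t, fun u hu => (hs u).1 (hzx u ((h.mem_iff u t).2 hu)), rfl⟩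
  union x := by
    have : {z | ∃ u, A.mem u x ∧ A.mem z u} = ⋃ u ∈ {u | A.mem u x}, {z | A.mem z u} := by
      ext z
      simp
    exact h.exists_set (T := {z | ∃ u, A.mem u x ∧ A.mem z u})
      (this ▸ (h.finite_elems x).biUnion fun u _ => h.finite_elems u)
  finite x hx := by
    obtain ⟨s, rfl⟩ := h.exists_eq x hx
    exact h.exists_isBij s
  ext := h.ext
  atom_empty := h.atom_empty

end HFStr.IsHF

section

variable {H : Type u} {K : Type u}

/-- The structure transported along a bijection. -/
def HFStr.comap (A : HFStr H) (ε : K ≃ H) : HFStr K where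
  mem x y := A.mem (ε x) (ε y)
  atom x := A.atom (ε x)
  lt x y := A.lt (ε x) (ε y)

theorem HFStr.IsHF.comap {A : HFStr H} {σ : Finset H → H} (h : A.IsHF σ) (ε : K ≃ H) :
    (A.comap ε).IsHF fun s => ε.symm (σ (s.map ε.toEmbedding)) where
  mem_iff x s := by
    show A.mem (ε x) (ε (ε.symm _)) ↔ _
    rw [Equiv.apply_symm_apply, h.mem_iff]
    simp
  not_atom s := by
    show ¬ A.atom (ε (ε.symm _))
    rw [Equiv.apply_symm_apply]
    exact h.not_atom _
  exists_eq x hx := by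
    obtain ⟨s, hs⟩ := h.exists_eq _ hx
    refine ⟨s.map ε.symm.toEmbedding, (Equiv.eq_symm_apply ε).2 (hs.trans (congrArg σ ?_))⟩
    ext y
    simp
  atom_empty x hx y := h.atom_empty _ hx _
  ind P hP x := by
    have := h.ind (fun y => P (ε.symm y)) (fun y hy => hP _ fun z hz => ?_) (ε x)
    · simpa using this
    · have hz : A.mem (ε z) (ε (ε.symm y)) := hz
      rw [Equiv.apply_symm_apply] at hz
      simpa using hy _ hz

theorem HFStr.IsDLO.comap {A : HFStr H} (h : A.IsDLO) (ε : K ≃ H) : (A.comap ε).IsDLO where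
  lt_atom _ _ := h.lt_atom _ _
  exists_atom := (ε.exists_congr_left (p := fun x => A.atom (ε x))).2 (by simpa using h.exists_atom)
  irrefl _ := h.irrefl _
  trans _ _ _ := h.trans _ _ _
  tot x y hx hy := (h.tot _ _ hx hy).imp_right (Or.imp_left fun e => ε.injective e)
  dense x y hx hy hxy := by
    obtain ⟨z, hz⟩ := h.dense _ _ hx hy hxy
    exact ⟨ε.symm z, by simpa [HFStr.comap] using hz⟩
  noMax x hx := by
    obtain ⟨z, hz⟩ := h.noMax _ hx
    exact ⟨ε.symm z, by simpa [HFStr.comap] using hz⟩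
  noMin x hx := by
    obtain ⟨z, hz⟩ := h.noMin _ hx
    exact ⟨ε.symm z, by simpa [HFStr.comap] using hz⟩

end

/-! ### Ordered atoms, and the asymmetry of `ℝ ⊕ ℚ` -/

section

variable {α : Type u}

/-- The hereditarily finite sets over a set of atoms with a relation. -/
noncomputable def hfStr (r : α → α → Prop) : HFStr (α ⊕ HFSet α) where
  mem x y := ∃ s, x ∈ s ∧ y = .inr (HFSet.equiv s)
  atom x := ∃ a, x = .inl a
  lt x y := ∃ a b, r a b ∧ x = .inl a ∧ y = .inl b

theorem hfStr_isHF (r : α → α → Prop) : (hfStr r).IsHF fun s => .inr (HFSet.equiv s) where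
  mem_iff x s := by
    constructor
    · rintro ⟨t, hx, ht⟩
      rwa [HFSet.equiv.injective (Sum.inr_injective ht)]
    · exact fun hx => ⟨s, hx, rfl⟩
  not_atom s := by
    rintro ⟨a, ha⟩
    exact Sum.inr_ne_inl ha
  exists_eq x hx := by
    rcases x with a | y
    · exact absurd ⟨a, rfl⟩ hx
    · exact ⟨HFSet.equiv.symm y, by rw [Equiv.apply_symm_apply]⟩
  atom_empty x hx y hy := by
    obtain ⟨a, rfl⟩ := hx
    obtain ⟨s, -, hs⟩ := hy
    exact Sum.inl_ne_inr hs
  ind P hP := by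
    have h : ∀ a, P (.inl a) := fun a => hP _ fun y ⟨s, _, hs⟩ => absurd hs Sum.inl_ne_inr
    rintro (a | y)
    · exact h a
    · refine HFSet.ind (p := fun y => P (.inr y)) (fun s hs => hP _ fun z ⟨t, hz, ht⟩ => ?_) y
      obtain rfl := HFSet.equiv.injective (Sum.inr_injective ht)
      rcases z with a | z
      · exact h a
      · exact hs z hz

theorem hfStr_isDLO {β : Type v} [LinearOrder β] [DenselyOrdered β] [NoMinOrder β] [NoMaxOrder β]
    [Nonempty β] (e : α ≃ β) : (hfStr fun a b => e a < e b).IsDLO where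
  lt_atom x y := by
    rintro ⟨a, b, -, rfl, rfl⟩
    exact ⟨⟨a, rfl⟩, ⟨b, rfl⟩⟩
  exists_atom := ⟨_, e.symm (Classical.arbitrary β), rfl⟩
  irrefl x := by
    rintro - ⟨a, b, h, rfl, hb⟩
    rw [Sum.inl_injective hb] at h
    exact lt_irrefl _ h
  trans x y z := by
    rintro - - - ⟨a, b, h, rfl, rfl⟩ ⟨b', c, h', hb, rfl⟩
    obtain rfl := Sum.inl_injective hb
    exact ⟨a, c, h.trans h', rfl, rfl⟩
  tot x y := by
    rintro ⟨a, rfl⟩ ⟨b, rfl⟩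
    rcases lt_trichotomy (e a) (e b) with h | h | h
    · exact .inl ⟨a, b, h, rfl, rfl⟩
    · exact .inr (.inl (congrArg _ (e.injective h)))
    · exact .inr (.inr ⟨b, a, h, rfl, rfl⟩)
  dense x y := by
    rintro - - ⟨a, b, h, rfl, rfl⟩
    obtain ⟨c, h₁, h₂⟩ := exists_between h
    obtain ⟨c, rfl⟩ := e.surjective c
    exact ⟨_, ⟨c, rfl⟩, ⟨a, c, h₁, rfl, rfl⟩, ⟨c, b, h₂, rfl, rfl⟩⟩
  noMax x := by
    rintro ⟨a, rfl⟩
    obtain ⟨c, h⟩ := exists_gt (e a)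
    obtain ⟨c, rfl⟩ := e.surjective c
    exact ⟨_, ⟨c, rfl⟩, a, c, h, rfl, rfl⟩
  noMin x := by
    rintro ⟨a, rfl⟩
    obtain ⟨c, h⟩ := exists_lt (e a)
    obtain ⟨c, rfl⟩ := e.surjective c
    exact ⟨_, ⟨c, rfl⟩, c, a, h, rfl, rfl⟩

/-- The order of the reals followed by the rationals is not isomorphic to its reverse. -/
theorem not_exists_lt_iff_gt (e : α ≃ ℝ ⊕ₗ ℚ) (g : α ⊕ HFSet α ≃ α ⊕ HFSet α)
    (hg : ∀ x y, (hfStr fun a b => e b < e a).lt (g x) (g y) ↔ (hfStr fun a b => e a < e b).lt x y) :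
    False := by
  let ρ (t : ℝ) : α ⊕ HFSet α := .inl (e.symm (Sum.inlₗ t))
  let q (t : ℚ) : α ⊕ HFSet α := .inl (e.symm (Sum.inrₗ t))
  -- In the reversed order, only rationals precede the rational `0`.
  have hS : {x | (hfStr fun a b => e b < e a).lt x (q 0)}.Countable := by
    refine (Set.countable_range q).mono ?_
    rintro x ⟨a, b, h, rfl, hb⟩
    rw [← Sum.inl_injective hb, Equiv.apply_symm_apply] at h
    obtain ⟨c, rfl⟩ := e.symm.surjective a
    rw [Equiv.apply_symm_apply] at h
    rcases hc : ofLex c with t | t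
    · obtain rfl : c = Sum.inlₗ t := hc
      exact absurd h (Sum.Lex.not_inr_lt_inl)
    · obtain rfl : c = Sum.inrₗ t := hc
      exact ⟨t, rfl⟩
  obtain ⟨y, hy⟩ := g.surjective (q 0)
  -- The bijection `g` is not assumed to respect atoms. But something precedes `q 0`, hence
  -- something precedes `y`, and the order relates only atoms.
  have hy_atom : ∃ b, y = .inl b := by
    obtain ⟨x, hx⟩ := g.surjective (q 1)
    have : (hfStr fun a b => e b < e a).lt (g x) (g y) := by
      rw [hx, hy]
      refine ⟨_, _, ?_, rfl, rfl⟩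
      show e (e.symm _) < e (e.symm _)
      rw [Equiv.apply_symm_apply, Equiv.apply_symm_apply]
      exact Sum.Lex.inr_lt_inr_iff.2 one_pos
    obtain ⟨a, b, -, -, hb⟩ := (hg x y).1 this
    exact ⟨b, hb⟩
  obtain ⟨b, rfl⟩ := hy_atom
  -- In the original order every point has a ray of reals below it; `g` would embed this ray into
  -- the countable set of predecessors of `q 0`.
  obtain ⟨t, ht⟩ : ∃ t, ∀ s < t, Sum.inlₗ s < e b := by
    rcases hc : ofLex (e b) with t | t
    · have hc : e b = Sum.inlₗ t := hc
      exact ⟨t, fun s hs => hc ▸ Sum.Lex.inl_lt_inl_iff.2 hs⟩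
    · have hc : e b = Sum.inrₗ t := hc
      exact ⟨0, fun s hs => hc ▸ Sum.Lex.inl_lt_inr _ _⟩
  have hρ : Function.Injective fun s => g (ρ s) := fun s s' h =>
    Sum.inl_injective (e.symm.injective (Sum.inl_injective (g.injective h)))
  have hT : (Set.Iio t).Countable := by
    refine (hS.preimage hρ).mono fun s hs => ?_
    show (hfStr fun a b => e b < e a).lt (g (ρ s)) (q 0)
    rw [← hy, hg]
    refine ⟨_, b, ?_, rfl, rfl⟩
    show e (e.symm _) < e b
    rw [Equiv.apply_symm_apply]
    exact ht s hs
  have := hT.le_aleph0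
  rw [Cardinal.mk_Iio_real] at this
  exact not_lt.2 this Cardinal.aleph0_lt_continuum

end

/-! ### Copies inside `M`, and the counterexample -/

namespace HFStr

section

variable {M : Type u} {H : Type u} (A : HFStr H) {j : H → M} (hj : Function.Injective j)

/-- The elements of `M` that represent the elements of `H`, up to absolute equality. -/
noncomputable def quotientEquiv : Quotient (⊥ : Setoid (Set.range j)) ≃ H :=
  (Setoid.quotientBotEquiv).trans (Equiv.ofInjective j hj).symm

/-- The copy of a structure on the range of an injection. -/
noncomputable def toInternal [Nonempty H] : InternalStructure hfLang M where
  dom := Set.range j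
  dom_nonempty := Set.range_nonempty j
  equality := ⊥
  str :=
    { funMap := fun f => f.elim
      RelMap := fun R v => match R with
        | .mem => A.mem (quotientEquiv hj (v 0)) (quotientEquiv hj (v 1))
        | .atom => A.atom (quotientEquiv hj (v 0))
        | .lt => A.lt (quotientEquiv hj (v 0)) (quotientEquiv hj (v 1)) }

variable [Nonempty H]

theorem rep_toInternal {c : (A.toInternal hj).Carrier} {m : M} :
    (A.toInternal hj).Rep c m ↔ m = j (quotientEquiv hj c) := by
  constructor
  · rintro ⟨⟨x, rfl⟩, rfl⟩
    refine congrArg j (((Equiv.ofInjective j hj).eq_symm_apply).2 ?_)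
    rfl
  · rintro rfl
    refine ⟨⟨_, rfl⟩, (quotientEquiv hj).injective ?_⟩
    refine ((Equiv.ofInjective j hj).symm_apply_eq).2 ?_
    rfl

/-- When all relations are admitted, a strong model has to satisfy full second-order replacement and
`∈`-induction, which true hereditarily finite sets do. -/
theorem isStrongModel_toInternal {σ : Finset H → H} (h : A.IsHF σ) (hD : A.IsDLO) :
    (A.toInternal hj).IsStrongModel (fun n => (Set.univ : Set (Set (Fin n → M)))) hfDLO := by
  have h' := h.comap (quotientEquiv hj)
  refine ⟨⟨trivial, trivial, fun _ _ => trivial⟩, ?_, ?_⟩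
  · refine Theory.model_union_iff.2 ⟨HF.models_setAxioms.2 h'.isSetTheory,
      HF.models_atomAxioms.2 (hD.comap (quotientEquiv hj))⟩
  · rintro t (rfl | rfl) P -
    · exact HF.replacementTemplate_holds.2 (h'.replacement _)
    · exact HF.inductionTemplate_holds.2 (h'.ind _)

theorem eqRel_toInternal :
    (A.toInternal hj).eqRel = {w | w 0 ∈ (A.toInternal hj).dom ∧ w 0 = w 1} := by
  ext w
  constructor
  · rintro ⟨h, h'⟩
    exact ⟨h 0, congrArg Subtype.val (Quotient.exact h')⟩
  · rintro ⟨h, h'⟩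
    have hw : ∀ i, w i ∈ (A.toInternal hj).dom := fun i => by
      fin_cases i
      exacts [h, (h' ▸ h :)]
    exact ⟨hw, congrArg (Quotient.mk _) (Subtype.ext h')⟩

theorem mem_atomRel_toInternal {w : Fin 1 → M} :
    w ∈ (A.toInternal hj).rel atomSym ↔ ∃ a, A.atom a ∧ w 0 = j a := by
  refine ((A.toInternal hj).mem_lift_iff _ w).trans ?_
  simp only [rep_toInternal]
  constructor
  · rintro ⟨c, hc, h⟩
    exact ⟨_, hc, h 0⟩
  · rintro ⟨a, ha, h⟩
    obtain ⟨c, rfl⟩ := (quotientEquiv hj).surjective a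
    refine ⟨fun _ => c, ha, fun i => ?_⟩
    fin_cases i
    exact h

theorem mem_ltRel_toInternal {x y : M} :
    ![x, y] ∈ (A.toInternal hj).rel atomLtSym ↔ ∃ a b, A.lt a b ∧ x = j a ∧ y = j b := by
  refine ((A.toInternal hj).mem_lift_iff _ _).trans ?_
  simp only [rep_toInternal]
  constructor
  · rintro ⟨c, hc, h⟩
    exact ⟨_, _, hc, h 0, h 1⟩
  · rintro ⟨a, b, ha, h, h'⟩
    obtain ⟨c, rfl⟩ := (quotientEquiv hj).surjective a
    obtain ⟨d, rfl⟩ := (quotientEquiv hj).surjective b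
    refine ⟨![c, d], ha, fun i => ?_⟩
    fin_cases i
    exacts [h, h']

end

end HFStr

section

variable {M : Type u} {I : Set M} (e : I ≃ ℝ ⊕ₗ ℚ) {j : I ⊕ HFSet I → M}
  (hj : Function.Injective j)

instance : Nonempty (I ⊕ HFSet I) := ⟨.inr (HFSet.equiv ∅)⟩

/-- The hereditarily finite sets over a set ordered as the reals followed by the rationals. -/
noncomputable def realRat : InternalStructure hfLang M :=
  (hfStr fun a b => e a < e b).toInternal hj

/-- The hereditarily finite sets over a set ordered in the reverse way. -/
noncomputable def ratReal : InternalStructure hfLang M :=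
  (hfStr fun a b => e b < e a).toInternal hj

theorem isRealRatReversal (hI : ∀ i : I, j (.inl i) = i) :
    IsRealRatReversal I (realRat e hj) (ratReal e hj) := by
  have hatom : ∀ r : I → I → Prop, ((hfStr r).toInternal hj).rel atomSym = {w | w 0 ∈ I} := by
    intro r
    ext w
    rw [HFStr.mem_atomRel_toInternal]
    constructor
    · rintro ⟨-, ⟨i, rfl⟩, h⟩
      rw [hI] at h
      exact (h ▸ i.2 : w 0 ∈ I)
    · intro h
      exact ⟨_, ⟨⟨w 0, h⟩, rfl⟩, (hI ⟨w 0, h⟩).symm⟩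
  have hlt : ∀ (r : I → I → Prop) (x y : M), ![x, y] ∈ ((hfStr r).toInternal hj).rel atomLtSym ↔
      ∃ a b : I, r a b ∧ x = a ∧ y = b := by
    intro r x y
    rw [HFStr.mem_ltRel_toInternal]
    constructor
    · rintro ⟨-, -, ⟨a, b, h, rfl, rfl⟩, rfl, rfl⟩
      exact ⟨a, b, h, hI a, hI b⟩
    · rintro ⟨a, b, h, rfl, rfl⟩
      exact ⟨_, _, ⟨a, b, h, rfl, rfl⟩, (hI a).symm, (hI b).symm⟩
  refine ⟨rfl, HFStr.eqRel_toInternal _ hj, HFStr.eqRel_toInternal _ hj, rfl, hatom _, hatom _,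
    ⟨e, fun x y => (hlt _ _ _).trans ?_⟩, fun x y => ((hlt _ _ _).trans ?_).trans (hlt _ _ _).symm⟩
  · constructor
    · rintro ⟨a, b, h, hx, hy⟩
      rwa [Subtype.ext hx, Subtype.ext hy]
    · exact fun h => ⟨x, y, h, rfl, rfl⟩
  · constructor
    · rintro ⟨a, b, h, hx, hy⟩
      exact ⟨b, a, h, hy, hx⟩
    · rintro ⟨a, b, h, hx, hy⟩
      exact ⟨b, a, h, hy, hx⟩

theorem isStrongModel_realRat :
    (realRat e hj).IsStrongModel (fun n => (Set.univ : Set (Set (Fin n → M)))) hfDLO :=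
  HFStr.isStrongModel_toInternal _ hj (hfStr_isHF _) (hfStr_isDLO e)

theorem isStrongModel_ratReal :
    (ratReal e hj).IsStrongModel (fun n => (Set.univ : Set (Set (Fin n → M)))) hfDLO :=
  HFStr.isStrongModel_toInternal _ hj (hfStr_isHF _) (hfStr_isDLO (e.trans OrderDual.toDual))

theorem isEmpty_realRat_equiv_ratReal :
    IsEmpty ((realRat e hj).Carrier ≃[hfLang] (ratReal e hj).Carrier) := by
  refine ⟨fun f => ?_⟩
  let ε := HFStr.quotientEquiv hj
  refine not_exists_lt_iff_gt e ((ε.symm.trans f.toEquiv).trans ε) fun x y => ?_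
  have h := f.map_rel atomLtSym ![ε.symm x, ε.symm y]
  have h' : (hfStr fun a b => e b < e a).lt (ε (f (ε.symm x))) (ε (f (ε.symm y))) ↔
    (hfStr fun a b => e a < e b).lt (ε (ε.symm x)) (ε (ε.symm y)) := h
  rwa [Equiv.apply_symm_apply, Equiv.apply_symm_apply] at h'

end

-- Having the cardinality of the continuum, `I` can be given the order of `ℝ ⊕ ℚ` through an
-- arbitrary bijection. The sets over `I` are at most continuum many and are injected into the
-- complement of `I`, so that the elements of `I` represent themselves as atoms. The two structures
-- differ only in the order, so the identity is a bijection between them.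
open Cardinal in
theorem exists_realRatReversal :
    ∃ (M : Type u) (_ : arith.Structure M) (X : SetUniverse M) (I : Set M)
        (N₀ N₁ : InternalStructure hfLang M),
      ModelsPC (ofTheory Arith.peano) X ∧ Uncountable M ∧
      (∀ x ∈ I, ∀ y : M, Arith.Lt y x → y ∈ I) ∧ I ≠ Set.univ ∧
      Cardinal.mk I = Cardinal.continuum ∧
      IsRealRatReversal I N₀ N₁ ∧
      N₀.IsStrongModel X hfDLO ∧ N₁.IsStrongModel X hfDLO ∧
      N₀.EquinumerousIn N₁ X ∧ IsEmpty (N₀.Carrier ≃[hfLang] N₁.Carrier) := by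
  let I : Set Arith.Ultrapower.{u} := Arith.Ultrapower.segment
  have hI : #I = continuum := Arith.Ultrapower.mk_segment
  have : Infinite I := by
    rw [infinite_iff, hI]
    exact aleph0_le_continuum
  obtain ⟨e⟩ : Nonempty (I ≃ ℝ ⊕ₗ ℚ) := by
    refine lift_mk_eq'.1 ?_
    have : #(ℝ ⊕ₗ ℚ) = continuum := by
      refine (mk_sum ℝ ℚ).trans ?_
      simp [mk_real]
    rw [hI, this, lift_continuum, lift_continuum]
  obtain ⟨k⟩ : Nonempty (HFSet I ↪ ↥Iᶜ) :=
    HFSet.mk_le.trans (hI.le.trans Arith.Ultrapower.continuum_le_mk_compl_segment)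
  let j : I ⊕ HFSet I → Arith.Ultrapower.{u} := Sum.elim Subtype.val fun s => (k s).1
  have hj : Function.Injective j := by
    refine Subtype.val_injective.sumElim (Subtype.val_injective.comp k.injective) fun a b h => ?_
    exact (k b).2 (h ▸ a.2 : ((k b).1 ∈ I))
  exact ⟨_, inferInstance, _, I, realRat e hj, ratReal e hj, Arith.Ultrapower.modelsPC, inferInstance,
    fun x hx y => Arith.Ultrapower.segment_isInitial hx, Arith.Ultrapower.segment_ne_univ, hI,
    isRealRatReversal e hj fun _ => rfl, isStrongModel_realRat e hj, isStrongModel_ratReal e hj,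
    ⟨Equiv.refl _, trivial⟩, isEmpty_realRat_equiv_ratReal e hj⟩

theorem not_categoricalInEveryCardinality_hfDLO :
    ¬ CategoricalInEveryCardinality.{u} hfDLO (ofTheory Arith.peano) := by
  intro h
  obtain ⟨M, _, X, I, N₀, N₁, hX, _, -, -, -, -, h₀, h₁, he, hN⟩ := exists_realRatReversal.{u}
  obtain ⟨f, -⟩ := h M X hX N₀ N₁ h₀ h₁ he
  exact hN.false f

end Definiteness

open Definiteness

theorem mainTheorem7 :
    StandaloneCategorical.{u} hfDLO Arith.inductionScheme ∧
    ¬ CategoricalInEveryCardinality.{u} hfDLO (ofTheory Arith.peano) ∧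
    ∃ (M : Type u) (_ : arith.Structure M) (X : SetUniverse M) (I : Set M)
        (N₀ N₁ : InternalStructure hfLang M),
      ModelsPC (ofTheory Arith.peano) X ∧ Uncountable M ∧
      (∀ x ∈ I, ∀ y : M, Arith.Lt y x → y ∈ I) ∧ I ≠ Set.univ ∧
      Cardinal.mk I = Cardinal.continuum ∧
      IsRealRatReversal I N₀ N₁ ∧
      N₀.IsStrongModel X hfDLO ∧ N₁.IsStrongModel X hfDLO ∧
      N₀.EquinumerousIn N₁ X ∧ IsEmpty (N₀.Carrier ≃[hfLang] N₁.Carrier) :=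
  ⟨standaloneCategorical_hfDLO, not_categoricalInEveryCardinality_hfDLO, exists_realRatReversal⟩
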